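/- **Setting.** Event times are integers. A generalized stateful operator $O^+$ is given by a window advance $WA$ and a window size $WS$ with $0<WA\le WS$, a number $I$ of input streams, a function $f_{MK}$ that maps each tuple to a finite set of keys, a window type $WT\in\{\text{single},\text{multi}\}$, and user functions $f_U$ (update), $f_O$ (output on expiration) and $f_S$ (slide). For every key it keeps a list of sets of $I$ window instances (one per input stream, with a common left boundary $l\in WA\cdot\mathbb Z$, covering $[l,l+WS)$); an output tuple produced from such a set has event time $l+WS$. The *semantics* of $O^+$ on a stream is given by its sequential processing by one instance that is responsible for all keys: for each tuple $t$, update the watermark $W$ (initially $0$); while $\rho+WS<W$ (with $\rho$ initially $0$), output via $f_O$ and then shift via $f_S$ (if $WT$ is single and some returned state is non-empty) or remove every set starting at $\rho$, and increase $\rho$ by $WA$; then set $\rho$ to the minimum of $\rho$ and the earliest left boundary of a window containing $t$ (if $t$ has a key), and for each key of $t$ create, if missing, and update via $f_U$ the sets that $t$ falls in (the only set of the key if $WT$ is single). For every key $k$ this determines, after the first $n$ items of the stream, a list of window sets $\sigma_n(k)$ and a sequence of output tuples $\mathrm{out}_n(k)$. **Parallel elastic execution.** Finitely or infinitely many instances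 share one state $\sigma$ and run concurrently; an execution is an arbitrary interleaving of their atomic steps, where reading a window set of a key and writing it back are different steps. An input tuple buffer $TB_{in}$ delivers one and the same infinite sequence of items, in the same order and each item exactly once, to each of its readers; outputs are added to an output buffer $TB_{out}$, which accepts tuples from its sources only. Regular tuples convey non-decreasing watermarks, and no tuple is earlier than the watermark conveyed by itself or by an earlier tuple. A control tuple carries an epoch number $e^*$, a finite non-empty set $\mathbb O^*$ of instances, a mapping $f_\mu^*$ from keys to $\mathbb O^*$ and an event time $\gamma$; an instance whose epoch number is smaller than $e^*$ stores these values, and does nothing else. With every regular tuple $t$, an instance $j$ updates its watermark $W$ and, if $W$ has increased and $W>\gamma$, runs the following reconfiguration code: it waits at a barrier until all instances of its current set $\mathbb O$ have reached the barrier for $t$; if $|\mathbb O^*|>|\mathbb O|$ it tries to add $\mathbb O^*\setminus\mathbb O$ to the sources of $TB_{out}$ and, if it succeeds, adds them to the readers of $TB_{in}$, which deliver $t$ to them first, the new readers having the same epoch variables as $j$; if $|\mathbb O^*|<|\mathbb O|$ it tries to remove $\mathbb O\setminus\mathbb O^*$ from the readers of $TB_{in}$ and, if it succeeds, removes them from the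 sources of $TB_{out}$; finally it replaces its epoch number, instance set $\mathbb O$ and mapping $f_\mu$ by $e^*$, $\mathbb O^*$, $f_\mu^*$. An attempt to add sources succeeds only if $j$ is a source and none of the added instances is one; an attempt to remove readers succeeds only if $j$ is a reader and all removed instances are readers. Then, whether or not this code was run, $j$ processes expired window instances and $t$ as in the sequential processing, with its own $W$ and $\rho$ (initially $0$) but restricted to keys $k$ with $f_\mu(k)=j$. Initially $\sigma$ is empty and exactly the instances of a non-empty finite set $\mathbb O_0$, to which the initial mapping maps all keys, are readers and sources. A control tuple that starts a new epoch is delivered only when no disconnected instance is still busy (the previous reconfiguration has been completed). The *epoch after $n$ items*, with set $\mathbb O_n$ and mapping $f_n$, is the one determined by applying these rules to the first $n$ items. **Theorem 3.** Suppose that every control tuple that starts a new epoch satisfies $\mathbb O\subseteq\mathbb O^*$ (provisioning) or $\mathbb O^*\subseteq\mathbb O$ (decommissioning), with equality for a mere remapping of keys, where $\mathbb O$ belongs to the epoch in force when it arrives, and that no tuple with a key falls in a window with negative left boundary. Then, for any number of reconfigurations: 1. In every reachable state, no two instances are in the middle of an update of the same key. Every step of an instance $j$ that changes the state or the outputs of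 a key $k$ while $j$ processes item number $n$ (counting from $0$) is taken by the instance responsible for $k$, i.e. $f_{n+1}(k)=j$, while $j$ is connected to $TB_{in}$ and $TB_{out}$ and no other instance is in the middle of an update of $k$. 2. In every reachable state in which the instance $f_n(k)$ has completed exactly the first $n$ items, the shared state of $k$ is $\sigma_n(k)$, and the sequence of outputs for $k$ is $\mathrm{out}_n(k)$. In every reachable state the outputs for $k$ are a prefix of $\mathrm{out}_n(k)$ for some $n$. 3. In every reachable state in which some instance of $\mathbb O_n$ has completed exactly the first $n$ items, the readers of $TB_{in}$ are contained in $\mathbb O_n$, and $\mathbb O_n$ is contained in the sources of $TB_{out}$. If all instances are idle and all instances of $\mathbb O_n$ have completed exactly the first $n$ items, then the set of readers and the set of sources are both equal to $\mathbb O_n$. 4. In every weakly fair infinite execution and for every $n$, from some time on every instance of $\mathbb O_n$ has completed at least the first $n$ items, and, for every key $k$, $\mathrm{out}_n(k)$ is eventually a prefix of the outputs for $k$. -/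

import Mathlib

namespace VSN

/-! ## Tuples, window instances, operators -/

/-- Window type: one set of sliding window instances per key, or several overlapping sets. -/
inductive WinType
  | single
  | multi

/-- A (regular) input tuple of an operator with `I` input streams: event time `τ`, the watermark
`wm` that the tuple's metadata conveys, the index of the input stream, and the payload.
Implicit watermarks are the case `wm = τ`; a special tuple that only conveys a watermark is a
tuple without keys. -/
structure Tup (I : ℕ) (P : Type*) where
  τ : ℤ
  wm : ℤ
  src : Fin I
  φ : P

/-- An output tuple: event time and payload. -/
structure OutTup (Q : Type*) where
  τ : ℤ
  φ : Q

/-- A window instance `⟨ζ, l, k⟩`: state, left boundary, key. -/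
structure Win (K Z : Type*) where
  ζ : Z
  l : ℤ
  k : K

/-- A set of `I` window instances (one per input stream) of one key with a common left boundary. -/
structure WSet (I : ℕ) (Z : Type*) where
  l : ℤ
  ζ : Fin I → Z

/-- The generalized operator `O⁺(WA, WS, I, f_MK, WT, S, -, f_U, f_O, f_S)`; the mapping function
`f_μ` is not part of it because it changes over time (see `Config`). The output schema is the
type `Q`, and `empty` is the empty window state. -/
structure Oper (I : ℕ) (K Z P Q : Type*) where
  WA : ℤ
  WS : ℤ
  WT : WinType
  fMK : Tup I P → Finset K
  empty : Z
  fU : (Fin I → Win K Z) → Tup I P → (Fin I → Z) × List Q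
  fO : (Fin I → Win K Z) → List Q
  fS : (Fin I → Win K Z) → (Fin I → Z)

section Methods

variable {I : ℕ} {K Z P Q : Type*} (op : Oper I K Z P Q)

/-- The `I` window instances of a set, with their key and left boundary. -/
def WSet.insts (w : WSet I Z) (k : K) : Fin I → Win K Z := fun i => ⟨w.ζ i, w.l, k⟩

/-- Insertion that keeps the sets of a key in the order of their left boundaries. -/
def insertSet (w : WSet I Z) : List (WSet I Z) → List (WSet I Z)
  | [] => [w]
  | v :: rest => if w.l ≤ v.l then w :: v :: rest else v :: insertSet w rest

/-- `prepareOutTuples`: the event time of an output tuple is the right boundary `l + WS`. -/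
def Oper.prepareOutTuples (l : ℤ) (qs : List Q) : List (OutTup Q) :=
  qs.map fun q => ⟨l + op.WS, q⟩

/-- The smallest multiple `l` of `WA` with `τ < l + WS`. -/
def Oper.earliestWinL (t : Tup I P) : ℤ := ((t.τ - op.WS) / op.WA + 1) * op.WA

/-- The largest multiple `l` of `WA` with `l ≤ τ`. -/
def Oper.latestWinL (t : Tup I P) : ℤ := (t.τ / op.WA) * op.WA

/-- The number of window sets per key that a tuple updates, i.e. the number of values that `ℓ`
takes in `{0, …, (τ₂ - τ₁) / WA}`. -/
def Oper.numWin (t : Tup I P) : ℕ :=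
  match op.WT with
  | .single => 1
  | .multi => ((op.latestWinL t - op.earliestWinL t) / op.WA).toNat + 1

/-- The left boundary `τ₁ + ℓ * WA`. -/
def Oper.winL (t : Tup I P) (ℓ : ℕ) : ℤ := op.earliestWinL t + ℓ * op.WA

open Classical in
/-- `check&Create(k, l)` on the list of window sets of a key. With `WT = single` a key has at most
one set, which slides, so that a set is created only if the key has none. -/
noncomputable def Oper.checkCreate (ks : List (WSet I Z)) (l : ℤ) : List (WSet I Z) :=
  match op.WT with
  | .single => if ks = [] then [⟨l, fun _ => op.empty⟩] else ks
  | .multi => if ∃ w ∈ ks, w.l = l then ks else insertSet ⟨l, fun _ => op.empty⟩ ks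

/-- The set that a tuple updates: the only set of the key, or the one with left boundary `l`. -/
def Oper.lookup (ks : List (WSet I Z)) (l : ℤ) : Option (WSet I Z) :=
  match op.WT with
  | .single => ks.head?
  | .multi => ks.find? fun w => w.l = l

/-- `set`: overwrite the states of that set. -/
def Oper.setStates (ks : List (WSet I Z)) (l : ℤ) (ζ : Fin I → Z) : List (WSet I Z) :=
  match op.WT with
  | .single => ks.modifyHead fun w => { w with ζ := ζ }
  | .multi => ks.map fun w => if w.l = l then { w with ζ := ζ } else w

open Classical in
/-- The second part of `forwardAndShift(k)`: the first set of the key, whose content `w` has been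
read before, is shifted by `WA` with the states returned by `f_S` (`WT = single`, some state not
empty) or removed (otherwise). -/
noncomputable def Oper.shiftFirst (k : K) (w : WSet I Z) (ks : List (WSet I Z)) :
    List (WSet I Z) :=
  match op.WT with
  | .multi => ks.tail
  | .single =>
      if ∃ i, op.fS (w.insts k) i ≠ op.empty then
        insertSet ⟨w.l + op.WA, op.fS (w.insts k)⟩ ks.tail
      else ks.tail

end Methods

/-! ## The semantics of the operator

The reference is `processSN` run by one instance that is responsible for all keys and receives all
tuples. It is written key by key: no user function sees two keys, so that the order in which keys
are visited within a loop is immaterial for the state and for the output sequence of each key. -/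

/-- State of the reference: watermark, `ρ`, window sets of every key, and, for every key, the
sequence of the output tuples forwarded so far in connection to window instances of that key. -/
structure Ref (I : ℕ) (K Z Q : Type*) where
  W : ℤ
  ρ : ℤ
  σ : K → List (WSet I Z)
  outs : K → List (OutTup Q)

section Reference

variable {I : ℕ} {K Z P Q : Type*} (op : Oper I K Z P Q)

/-- `forwardAndShift(k)`, if the first set of the key starts at `ρ`. -/
noncomputable def Oper.forwardAndShift (k : K) (ρ : ℤ)
    (x : List (WSet I Z) × List (OutTup Q)) : List (WSet I Z) × List (OutTup Q) :=
  match x.1 with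
  | [] => x
  | w :: _ =>
      if w.l = ρ then
        (op.shiftFirst k w x.1, x.2 ++ op.prepareOutTuples w.l (op.fO (w.insts k)))
      else x

/-- `while σ[k][1].l = ρ do forwardAndShift(k)`. Each round leaves one set less at `ρ`, so that
the number of sets bounds the number of rounds. -/
noncomputable def Oper.drain (k : K) (ρ : ℤ)
    (x : List (WSet I Z) × List (OutTup Q)) : List (WSet I Z) × List (OutTup Q) :=
  (op.forwardAndShift k ρ)^[x.1.length] x

/-- One round of the loop over expired window instances, if the loop condition holds. -/
noncomputable def Oper.expireRound (r : Ref I K Z Q) : Ref I K Z Q :=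
  if r.ρ + op.WS < r.W then
    { r with
      ρ := r.ρ + op.WA
      σ := fun k => (op.drain k r.ρ (r.σ k, r.outs k)).1
      outs := fun k => (op.drain k r.ρ (r.σ k, r.outs k)).2 }
  else r

/-- The whole loop. As `ρ` grows by `WA ≥ 1`, at most `W - (ρ + WS)` rounds are needed. -/
noncomputable def Oper.expireLoop (r : Ref I K Z Q) : Ref I K Z Q :=
  op.expireRound^[(r.W - (r.ρ + op.WS)).toNat] r

/-- Create (if needed) and update the `ℓ`-th set of the key that the tuple falls in. -/
noncomputable def Oper.updateKey (k : K) (t : Tup I P)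
    (x : List (WSet I Z) × List (OutTup Q)) (ℓ : ℕ) : List (WSet I Z) × List (OutTup Q) :=
  let ks := op.checkCreate x.1 (op.winL t ℓ)
  match op.lookup ks (op.winL t ℓ) with
  | none => (ks, x.2)
  | some w =>
      (op.setStates ks (op.winL t ℓ) (op.fU (w.insts k) t).1,
        x.2 ++ op.prepareOutTuples w.l (op.fU (w.insts k) t).2)

open Classical in
/-- `handleInputTuple(t)`. -/
noncomputable def Oper.handleInput (r : Ref I K Z Q) (t : Tup I P) : Ref I K Z Q :=
  let upd := fun k => (List.range (op.numWin t)).foldl (op.updateKey k t) (r.σ k, r.outs k)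
  { r with
    ρ := if (op.fMK t).Nonempty then min r.ρ (op.earliestWinL t) else r.ρ
    σ := fun k => if k ∈ op.fMK t then (upd k).1 else r.σ k
    outs := fun k => if k ∈ op.fMK t then (upd k).2 else r.outs k }

/-- `processSN(t)`. -/
noncomputable def Oper.processSN (r : Ref I K Z Q) (t : Tup I P) : Ref I K Z Q :=
  op.handleInput (op.expireLoop { r with W := max r.W t.wm }) t

end Reference

/-! ## Control tuples and epochs -/

/-- The content of a control tuple: number, instances and mapping function of the next epoch, and
the event time that triggers the reconfiguration. -/
structure Ctl (K ι : Type*) where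
  e : ℕ
  O : Finset ι
  f : K → ι
  γ : ℤ

/-- What the input tuple buffer delivers. -/
inductive Item (I : ℕ) (P K ι : Type*)
  | data (t : Tup I P)
  | control (c : Ctl K ι)

/-- The reconfiguration variables of an instance: `e, 𝕆, f_μ` of the current epoch, `e*, 𝕆*, f_μ*`
of the next one, and `γ`. -/
structure Config (K ι : Type*) where
  e : ℕ
  O : Finset ι
  f : K → ι
  eN : ℕ
  ON : Finset ι
  fN : K → ι
  γ : ℤ

section Epochs

variable {I : ℕ} {K Z P Q ι : Type*}

/-- `prepareReconfig`. -/
def Config.prepareReconfig (g : Config K ι) (c : Ctl K ι) : Config K ι :=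
  if g.e < c.e then { g with eN := c.e, ON := c.O, fN := c.f, γ := c.γ } else g

/-- `{e, 𝕆, f_μ} ← {e*, 𝕆*, f_μ*}`. -/
def Config.switch (g : Config K ι) : Config K ι := { g with e := g.eN, O := g.ON, f := g.fN }

/-- The initial variables, when no reconfiguration is pending. -/
def Config.initial (c : Ctl K ι) : Config K ι := ⟨c.e, c.O, c.f, c.e, c.O, c.f, c.γ⟩

/-- The watermark and the epoch variables that result from the first `n` items of the stream: a
control tuple sets the variables of the next epoch, which starts with the next regular tuple that
increases the watermark to a value greater than `γ`. -/
def epochAt (c₀ : Ctl K ι) (inp : ℕ → Item I P K ι) : ℕ → ℤ × Config K ι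
  | 0 => (0, Config.initial c₀)
  | n + 1 =>
      let x := epochAt c₀ inp n
      match inp n with
      | .control c => (x.1, x.2.prepareReconfig c)
      | .data t =>
          (max x.1 t.wm, if x.1 < max x.1 t.wm ∧ x.2.γ < max x.1 t.wm then x.2.switch else x.2)

/-- The reference after the first `n` items; control tuples do not update the state. -/
noncomputable def refAt (op : Oper I K Z P Q) (inp : ℕ → Item I P K ι) : ℕ → Ref I K Z Q
  | 0 => ⟨0, 0, fun _ => [], fun _ => []⟩
  | n + 1 =>
      match inp n with
      | .control _ => refAt op inp n
      | .data t => op.processSN (refAt op inp n) t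

/-- An epoch has at least one instance, and every key is mapped to one of its instances. -/
def Ctl.Valid (c : Ctl K ι) : Prop := c.O.Nonempty ∧ ∀ k, c.f k ∈ c.O

/-- Every control tuple that announces a new epoch is valid, and asks for provisioning (`𝕆 ⊆ 𝕆*`)
or decommissioning (`𝕆* ⊆ 𝕆`) of instances, or only for a new mapping (`𝕆* = 𝕆`), where `𝕆`
belongs to the epoch during which it arrives. -/
def ValidReconfigs (c₀ : Ctl K ι) (inp : ℕ → Item I P K ι) : Prop :=
  ∀ n c, inp n = .control c → (epochAt c₀ inp n).2.e < c.e →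
    c.Valid ∧ ((epochAt c₀ inp n).2.O ⊆ c.O ∨ c.O ⊆ (epochAt c₀ inp n).2.O)

/-- The conveyed watermarks are non-decreasing, and they are watermarks: no tuple is earlier than
the watermark conveyed by itself or by a previous tuple. -/
def Watermarked (inp : ℕ → Item I P K ι) : Prop :=
  ∀ m n t u, m ≤ n → inp m = .data t → inp n = .data u → t.wm ≤ u.wm ∧ t.wm ≤ u.τ

end Epochs

/-! ## The parallel, elastic system

Instances run `processVSN` concurrently: an execution is an arbitrary interleaving of the atomic
steps below. Reading and writing back the state of a key are separate steps. -/

/-- Program counter of an instance, with the local variables of the loops. -/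
inductive PC (I : ℕ) (K Z : Type*)
  /-- about to call `get` -/
  | idle
  /-- blocked in `waitForInstances(𝕆)` -/
  | barrier
  /-- about to evaluate `|𝕆*| > |𝕆| ∧ TB_out.addSources(𝕆* \ 𝕆)` -/
  | addSources
  /-- about to call `TB_in.addReaders(𝕆* \ 𝕆, j)` -/
  | addReaders
  /-- about to evaluate `|𝕆*| < |𝕆| ∧ TB_in.removeReaders(𝕆 \ 𝕆*)` -/
  | removeReaders
  /-- about to call `TB_out.removeSources(𝕆 \ 𝕆*)` -/
  | removeSources
  /-- about to switch to the next epoch -/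
  | switch
  /-- at the head of the loop over expired window instances -/
  | expire
  /-- in `forwardAndShift(k)`: the first set `w` of `k` has been read and its results forwarded -/
  | shift (k : K) (w : WSet I Z)
  /-- about to call `handleInputTuple` -/
  | handle
  /-- in round `ℓ` of the update loop, with the keys in `S` left -/
  | update (ℓ : ℕ) (S : Finset K)
  /-- `check&Create` has been called for key `k` -/
  | read (ℓ : ℕ) (S : Finset K) (k : K)
  /-- `f_U` has returned the states `ζ` and its results are forwarded -/
  | write (ℓ : ℕ) (S : Finset K) (k : K) (ζ : Fin I → Z)

/-- Instance-local variables. `pos` is the cursor of the instance in the stream of `TB_in`: the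
index of the item that it is processing, or that `get` will return next. -/
structure Local (I : ℕ) (K Z ι : Type*) where
  W : ℤ
  ρ : ℤ
  cfg : Config K ι
  pos : ℕ
  pc : PC I K Z

/-- Global state: instances, readers of `TB_in`, sources of `TB_out`, barrier (`arrived i` is `n + 1`
if `n` is the index of the last item at which `i` has called `waitForInstances`, and `0` before the
first call), shared state `σ`, and the tuples added to `TB_out`, listed separately for each key. -/
structure State (I : ℕ) (K Z Q ι : Type*) where
  loc : ι → Local I K Z ι
  readers : Finset ι
  sources : Finset ι
  arrived : ι → ℕ
  σ : K → List (WSet I Z)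
  outs : K → List (OutTup Q)

section System

variable {I : ℕ} {K Z P Q ι : Type*} [DecidableEq K] [DecidableEq ι]

/-- Initially the instances of the first epoch are connected to both buffers, and all others wait
in a pool. -/
def State.initial (c₀ : Ctl K ι) : State I K Z Q ι where
  loc := fun _ => ⟨0, 0, Config.initial c₀, 0, .idle⟩
  readers := c₀.O
  sources := c₀.O
  arrived := fun _ => 0
  σ := fun _ => []
  outs := fun _ => []

/-- Replace the local variables of instance `j`. -/
def State.setLoc (s : State I K Z Q ι) (j : ι) (L : Local I K Z ι) : State I K Z Q ι :=
  { s with loc := Function.update s.loc j L }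

/-- Move the program counter of instance `j`. -/
def State.goto (s : State I K Z Q ι) (j : ι) (pc : PC I K Z) : State I K Z Q ι :=
  s.setLoc j { s.loc j with pc := pc }

/-- Replace the window sets of key `k` in the shared state. -/
def State.setKey (s : State I K Z Q ι) (k : K) (ks : List (WSet I Z)) : State I K Z Q ι :=
  { s with σ := Function.update s.σ k ks }

/-- `forward`: instance `j` adds output tuples of key `k` to `TB_out`. This has an effect only if
`j` is a source of `TB_out`. -/
def State.forward (s : State I K Z Q ι) (j : ι) (k : K) (o : List (OutTup Q)) :
    State I K Z Q ι :=
  if j ∈ s.sources then { s with outs := Function.update s.outs k (s.outs k ++ o) } else s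

/-- `TB_out.addSources(S)`, invoked by `j`, succeeds. -/
def State.CanAddSources (s : State I K Z Q ι) (j : ι) (S : Finset ι) : Prop :=
  j ∈ s.sources ∧ Disjoint S s.sources

/-- `TB_in.removeReaders(S)`, invoked by `j`, succeeds. -/
def State.CanRemoveReaders (s : State I K Z Q ι) (j : ι) (S : Finset ι) : Prop :=
  j ∈ s.readers ∧ S ⊆ s.readers

/-- `TB_in.addReaders(S, j)`: every instance of `S` that is not a reader becomes one. The first item
delivered to it is the one that `j` is processing, and it knows the reconfiguration variables. -/
def State.addReaders (s : State I K Z Q ι) (j : ι) (S : Finset ι) : State I K Z Q ι :=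
  { s with
    readers := s.readers ∪ S
    loc := fun i =>
      if i ∈ S \ s.readers then
        { s.loc i with pos := (s.loc j).pos, cfg := (s.loc j).cfg }
      else s.loc i }

/-- The atomic steps of instance `j` running `processVSN` on the stream `inp` delivered by `TB_in`. -/
inductive Step (op : Oper I K Z P Q) (inp : ℕ → Item I P K ι) (j : ι) :
    State I K Z Q ι → State I K Z Q ι → Prop
  /-- `get` returns a control tuple. One that starts a reconfiguration is delivered only after the
  previous reconfiguration has been completed: no disconnected instance is still busy. -/
  | control (s : State I K Z Q ι) (c : Ctl K ι) :
      (s.loc j).pc = .idle → j ∈ s.readers → inp (s.loc j).pos = .control c →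
      ((s.loc j).cfg.e < c.e → ∀ i, i ∉ s.readers → (s.loc i).pc = .idle) →
      Step op inp j s
        (s.setLoc j
          { s.loc j with
            cfg := (s.loc j).cfg.prepareReconfig c
            pos := (s.loc j).pos + 1 })
  /-- `get` returns a regular tuple that triggers the reconfiguration code; `j` calls
  `waitForInstances`. -/
  | trigger (s : State I K Z Q ι) (t : Tup I P) :
      (s.loc j).pc = .idle → j ∈ s.readers → inp (s.loc j).pos = .data t →
      (s.loc j).W < max (s.loc j).W t.wm ∧ (s.loc j).cfg.γ < max (s.loc j).W t.wm →
      Step op inp j s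
        { s.setLoc j { s.loc j with W := max (s.loc j).W t.wm, pc := .barrier } with
          arrived := Function.update s.arrived j ((s.loc j).pos + 1) }
  /-- `get` returns any other regular tuple. -/
  | regular (s : State I K Z Q ι) (t : Tup I P) :
      (s.loc j).pc = .idle → j ∈ s.readers → inp (s.loc j).pos = .data t →
      ¬ ((s.loc j).W < max (s.loc j).W t.wm ∧ (s.loc j).cfg.γ < max (s.loc j).W t.wm) →
      Step op inp j s
        (s.setLoc j { s.loc j with W := max (s.loc j).W t.wm, pc := .expire })
  /-- The barrier opens: all instances in `𝕆` have called `waitForInstances` at this tuple. -/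
  | leaveBarrier (s : State I K Z Q ι) :
      (s.loc j).pc = .barrier → (∀ i ∈ (s.loc j).cfg.O, (s.loc j).pos < s.arrived i) →
      Step op inp j s (s.goto j .addSources)
  | addSourcesTrue (s : State I K Z Q ι) :
      (s.loc j).pc = .addSources →
      (s.loc j).cfg.O.card < (s.loc j).cfg.ON.card ∧
        s.CanAddSources j ((s.loc j).cfg.ON \ (s.loc j).cfg.O) →
      Step op inp j s
        { s.goto j .addReaders with
          sources := s.sources ∪ ((s.loc j).cfg.ON \ (s.loc j).cfg.O) }
  | addSourcesFalse (s : State I K Z Q ι) :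
      (s.loc j).pc = .addSources →
      ¬ ((s.loc j).cfg.O.card < (s.loc j).cfg.ON.card ∧
        s.CanAddSources j ((s.loc j).cfg.ON \ (s.loc j).cfg.O)) →
      Step op inp j s (s.goto j .removeReaders)
  | addReaders (s : State I K Z Q ι) :
      (s.loc j).pc = .addReaders →
      Step op inp j s
        ((s.addReaders j ((s.loc j).cfg.ON \ (s.loc j).cfg.O)).goto j .removeReaders)
  | removeReadersTrue (s : State I K Z Q ι) :
      (s.loc j).pc = .removeReaders →
      (s.loc j).cfg.ON.card < (s.loc j).cfg.O.card ∧
        s.CanRemoveReaders j ((s.loc j).cfg.O \ (s.loc j).cfg.ON) →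
      Step op inp j s
        { s.goto j .removeSources with
          readers := s.readers \ ((s.loc j).cfg.O \ (s.loc j).cfg.ON) }
  | removeReadersFalse (s : State I K Z Q ι) :
      (s.loc j).pc = .removeReaders →
      ¬ ((s.loc j).cfg.ON.card < (s.loc j).cfg.O.card ∧
        s.CanRemoveReaders j ((s.loc j).cfg.O \ (s.loc j).cfg.ON)) →
      Step op inp j s (s.goto j .switch)
  | removeSources (s : State I K Z Q ι) :
      (s.loc j).pc = .removeSources →
      Step op inp j s
        { s.goto j .switch with
          sources := s.sources \ ((s.loc j).cfg.O \ (s.loc j).cfg.ON) }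
  | switch (s : State I K Z Q ι) :
      (s.loc j).pc = .switch →
      Step op inp j s (s.setLoc j { s.loc j with cfg := (s.loc j).cfg.switch, pc := .expire })
  /-- An expired window set of some key that `j` is responsible for starts at `ρ`: the set is read,
  and its results are forwarded. -/
  | output (s : State I K Z Q ι) (k : K) (w : WSet I Z) :
      (s.loc j).pc = .expire → (s.loc j).ρ + op.WS < (s.loc j).W →
      (s.σ k).head? = some w → w.l = (s.loc j).ρ → (s.loc j).cfg.f k = j →
      Step op inp j s
        ((s.forward j k (op.prepareOutTuples w.l (op.fO (w.insts k)))).goto j (.shift k w))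
  /-- The set is shifted or removed. -/
  | shift (s : State I K Z Q ι) (k : K) (w : WSet I Z) :
      (s.loc j).pc = .shift k w →
      Step op inp j s ((s.setKey k (op.shiftFirst k w (s.σ k))).goto j .expire)
  /-- No such window set is left at `ρ`. -/
  | advance (s : State I K Z Q ι) :
      (s.loc j).pc = .expire → (s.loc j).ρ + op.WS < (s.loc j).W →
      (¬ ∃ k w, (s.σ k).head? = some w ∧ w.l = (s.loc j).ρ ∧ (s.loc j).cfg.f k = j) →
      Step op inp j s (s.setLoc j { s.loc j with ρ := (s.loc j).ρ + op.WA })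
  /-- No expired window instance is left. -/
  | expired (s : State I K Z Q ι) :
      (s.loc j).pc = .expire → ¬ (s.loc j).ρ + op.WS < (s.loc j).W →
      Step op inp j s (s.goto j .handle)
  /-- `j` is responsible for some key of the tuple. -/
  | handle (s : State I K Z Q ι) (t : Tup I P) :
      (s.loc j).pc = .handle → inp (s.loc j).pos = .data t →
      (∃ k ∈ op.fMK t, (s.loc j).cfg.f k = j) →
      Step op inp j s
        (s.setLoc j
          { s.loc j with
            ρ := min (s.loc j).ρ (op.earliestWinL t)
            pc := .update 0 ((op.fMK t).filter fun k => (s.loc j).cfg.f k = j) })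
  /-- `j` is responsible for no key of the tuple, which is done. -/
  | skip (s : State I K Z Q ι) (t : Tup I P) :
      (s.loc j).pc = .handle → inp (s.loc j).pos = .data t →
      (¬ ∃ k ∈ op.fMK t, (s.loc j).cfg.f k = j) →
      Step op inp j s (s.setLoc j { s.loc j with pos := (s.loc j).pos + 1, pc := .idle })
  /-- `check&Create` for some key that is left. -/
  | create (s : State I K Z Q ι) (t : Tup I P) (ℓ : ℕ) (S : Finset K) (k : K) :
      (s.loc j).pc = .update ℓ S → inp (s.loc j).pos = .data t → k ∈ S →
      Step op inp j s
        ((s.setKey k (op.checkCreate (s.σ k) (op.winL t ℓ))).goto j (.read ℓ (S.erase k) k))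
  /-- Read the window set, invoke `f_U` and forward its results. -/
  | compute (s : State I K Z Q ι) (t : Tup I P) (ℓ : ℕ) (S : Finset K) (k : K) (w : WSet I Z) :
      (s.loc j).pc = .read ℓ S k → inp (s.loc j).pos = .data t →
      op.lookup (s.σ k) (op.winL t ℓ) = some w →
      Step op inp j s
        ((s.forward j k (op.prepareOutTuples w.l (op.fU (w.insts k) t).2)).goto j
          (.write ℓ S k (op.fU (w.insts k) t).1))
  /-- Write the returned states. -/
  | write (s : State I K Z Q ι) (t : Tup I P) (ℓ : ℕ) (S : Finset K) (k : K) (ζ : Fin I → Z) :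
      (s.loc j).pc = .write ℓ S k ζ → inp (s.loc j).pos = .data t →
      Step op inp j s
        ((s.setKey k (op.setStates (s.σ k) (op.winL t ℓ) ζ)).goto j (.update ℓ S))
  /-- Continue with the next value of `ℓ`. -/
  | nextRound (s : State I K Z Q ι) (t : Tup I P) (ℓ : ℕ) :
      (s.loc j).pc = .update ℓ ∅ → inp (s.loc j).pos = .data t → ℓ + 1 < op.numWin t →
      Step op inp j s
        (s.goto j (.update (ℓ + 1) ((op.fMK t).filter fun k => (s.loc j).cfg.f k = j)))
  /-- All values of `ℓ` have been handled, and the tuple is done. -/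
  | finish (s : State I K Z Q ι) (t : Tup I P) (ℓ : ℕ) :
      (s.loc j).pc = .update ℓ ∅ → inp (s.loc j).pos = .data t → ¬ ℓ + 1 < op.numWin t →
      Step op inp j s (s.setLoc j { s.loc j with pos := (s.loc j).pos + 1, pc := .idle })

/-- The states that some execution reaches. -/
def Reachable (op : Oper I K Z P Q) (c₀ : Ctl K ι) (inp : ℕ → Item I P K ι) :
    State I K Z Q ι → Prop :=
  Relation.ReflTransGen (fun s s' => ∃ j, Step op inp j s s') (State.initial c₀)

/-- Infinite executions: at each time, the instance `act T` takes a step, or nothing happens. -/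
def IsRun (op : Oper I K Z P Q) (c₀ : Ctl K ι) (inp : ℕ → Item I P K ι)
    (run : ℕ → State I K Z Q ι) (act : ℕ → Option ι) : Prop :=
  run 0 = State.initial c₀ ∧
    ∀ T, (act T = none ∧ run (T + 1) = run T) ∨
      ∃ j, act T = some j ∧ Step op inp j (run T) (run (T + 1))

/-- Weak fairness: an instance that can take a step at all times from some time on takes one. -/
def IsFair (op : Oper I K Z P Q) (inp : ℕ → Item I P K ι)
    (run : ℕ → State I K Z Q ι) (act : ℕ → Option ι) : Prop :=
  ∀ j T, (∀ T' ≥ T, ∃ s', Step op inp j (run T') s') → ∃ T' ≥ T, act T' = some j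

/-- Instance `j` is in the middle of an update of key `k`. -/
def State.Updating (s : State I K Z Q ι) (j : ι) (k : K) : Prop :=
  (∃ w, (s.loc j).pc = .shift k w) ∨ (∃ ℓ S, (s.loc j).pc = .read ℓ S k) ∨
    ∃ ℓ S ζ, (s.loc j).pc = .write ℓ S k ζ

/-- Instance `j` has completed exactly the first `n` items. -/
def State.DoneWith (s : State I K Z Q ι) (j : ι) (n : ℕ) : Prop :=
  (s.loc j).pc = .idle ∧ (s.loc j).pos = n

end System

end VSN

set_option linter.unusedSectionVars false

namespace VSN

/-! ## Epochs along the stream -/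

section EpochFacts

variable {I : ℕ} {K P ι : Type*} (c₀ : Ctl K ι) (inp : ℕ → Item I P K ι)

/-! All instances read the same stream, so the watermark and the epoch after `n` items depend on `n`
alone (`epochAt`). Instances stand at different cursors at the same time, but each of them can be
compared with the stream at its own cursor. The proof treats control, data and progress separately.

Control. `Step.skel` projects the system onto a skeleton that forgets the window sets. Its invariant
`SInv` carries a ghost counter `N`: item `N - 1` is the last one whose change of the connected
instances has been begun. Exactly one instance carries out each change. For a later one at the same
item the test of the buffer fails, because the instances to be added are already sources, or those
to be removed are no longer readers. The first one cannot fail, because all earlier changes have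
been completed (`SInv.ready`): a change needs an announcement after the previous change
(`Changes.exists_announces`), an announcement is delivered only when no disconnected instance is
busy, and the barrier has brought all members of the epoch to the present item. Since the old and
the new set are comparable, the cardinality tests decide between provisioning and decommissioning.

Exclusive access. A key changes hands only at an item that triggers a reconfiguration, and the
barrier there holds the new instance back until the old one has completed all previous items
(`SInv.reached_of_started`). Hence the items are completed for a key in the order of the stream, and
at most one instance is active on it (`SInv.active_unique`).

Data. The local `ρ` of an instance may differ from that of the reference, for instance because it
comes from an earlier connection. This does no harm: rounds of the expiration loop at values where
no set starts are idle, so the result for a key is the same for all starting points that are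
multiples of `WA` and not beyond any of its sets (`Oper.expireKey_congr`). `Oper.RhoOK` says that
`ρ` is such a value, and the watermarks ensure that no tuple falls in an expired window. Thus
`refKey_data` computes the effect of a tuple with any admissible `ρ`. The invariant `DInv` then
states that a key is in the reference state between two items, and that during an item the work left
(`Oper.remain`) leads from the current state to the next reference state. An atomic step does a
piece of this work or concerns other keys.

Progress. By induction on `n`, all members of the epoch after `n` items complete them
(`exists_all_done`). A busy instance finishes because of a well-founded measure (`State.work`), the
barrier opens since all members arrive, and added instances are handed the item. The delicate case
is a guarded control tuple: while a member of the epoch waits for it, nobody gets disconnected, and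
the finitely many disconnected instances that are still busy finish, so that the guard eventually
holds for good. -/

/-- The watermark after `n` items. -/
def wmAt (n : ℕ) : ℤ := (epochAt c₀ inp n).1

/-- The epoch variables after `n` items. -/
def cfgAt (n : ℕ) : Config K ι := (epochAt c₀ inp n).2

/-- Item `n` triggers the reconfiguration code. -/
def Triggers (n : ℕ) : Prop :=
  ∃ t, inp n = .data t ∧
    wmAt c₀ inp n < max (wmAt c₀ inp n) t.wm ∧ (cfgAt c₀ inp n).γ < max (wmAt c₀ inp n) t.wm

/-- Item `n` changes the set of instances. -/
def Changes (n : ℕ) : Prop := (cfgAt c₀ inp (n + 1)).O ≠ (cfgAt c₀ inp n).O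

/-- Item `n` is a control tuple that announces a new epoch. -/
def Announces (n : ℕ) : Prop := ∃ c, inp n = .control c ∧ (cfgAt c₀ inp n).e < c.e

variable {c₀ inp}

theorem wmAt_control {n : ℕ} {c : Ctl K ι} (h : inp n = .control c) :
    wmAt c₀ inp (n + 1) = wmAt c₀ inp n := by
  simp [wmAt, epochAt, h]

theorem cfgAt_control {n : ℕ} {c : Ctl K ι} (h : inp n = .control c) :
    cfgAt c₀ inp (n + 1) = (cfgAt c₀ inp n).prepareReconfig c := by
  simp [cfgAt, epochAt, h]

theorem wmAt_data {n : ℕ} {t : Tup I P} (h : inp n = .data t) :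
    wmAt c₀ inp (n + 1) = max (wmAt c₀ inp n) t.wm := by
  simp [wmAt, epochAt, h]

theorem cfgAt_triggers {n : ℕ} (h : Triggers c₀ inp n) :
    cfgAt c₀ inp (n + 1) = (cfgAt c₀ inp n).switch := by
  obtain ⟨t, ht, h⟩ := h
  simp only [cfgAt, epochAt, ht]
  exact if_pos h

theorem cfgAt_data_not_triggers {n : ℕ} {t : Tup I P} (ht : inp n = .data t)
    (h : ¬ Triggers c₀ inp n) : cfgAt c₀ inp (n + 1) = cfgAt c₀ inp n := by
  simp only [cfgAt, epochAt, ht]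
  exact if_neg fun h' => h ⟨t, ht, h'⟩

/-- A control tuple writes only the variables of the next epoch, so the current set and mapping
change at triggering items alone. -/
theorem cfgAt_not_triggers {n : ℕ} (h : ¬ Triggers c₀ inp n) :
    (cfgAt c₀ inp (n + 1)).e = (cfgAt c₀ inp n).e ∧ (cfgAt c₀ inp (n + 1)).O = (cfgAt c₀ inp n).O ∧
      (cfgAt c₀ inp (n + 1)).f = (cfgAt c₀ inp n).f := by
  cases hi : inp n with
  | data t => simp [cfgAt_data_not_triggers hi h]
  | control c =>
    rw [cfgAt_control hi]
    unfold Config.prepareReconfig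
    split <;> simp

theorem Changes.triggers {n : ℕ} (h : Changes c₀ inp n) : Triggers c₀ inp n := by
  by_contra h'
  exact h (cfgAt_not_triggers h').2.1

theorem Triggers.ON_eq {n : ℕ} (h : Triggers c₀ inp n) :
    (cfgAt c₀ inp n).ON = (cfgAt c₀ inp (n + 1)).O := by
  rw [cfgAt_triggers h]; rfl

theorem wmAt_le_succ (n : ℕ) : wmAt c₀ inp n ≤ wmAt c₀ inp (n + 1) := by
  cases hi : inp n with
  | data t => rw [wmAt_data hi]; exact le_max_left _ _
  | control c => rw [wmAt_control hi]

theorem wmAt_mono : Monotone (wmAt c₀ inp) := monotone_nat_of_le_succ wmAt_le_succ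

/-- Every epoch, and every announced epoch, is valid, and the announced set of instances is
comparable with the current one. -/
theorem cfgAt_valid (hinit : c₀.Valid) (hctl : ValidReconfigs c₀ inp) (n : ℕ) :
    (cfgAt c₀ inp n).O.Nonempty ∧ (∀ k, (cfgAt c₀ inp n).f k ∈ (cfgAt c₀ inp n).O) ∧
      (cfgAt c₀ inp n).ON.Nonempty ∧ (∀ k, (cfgAt c₀ inp n).fN k ∈ (cfgAt c₀ inp n).ON) ∧
      ((cfgAt c₀ inp n).O ⊆ (cfgAt c₀ inp n).ON ∨ (cfgAt c₀ inp n).ON ⊆ (cfgAt c₀ inp n).O) := by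
  induction n with
  | zero =>
    exact ⟨hinit.1, hinit.2, hinit.1, hinit.2, Or.inl (Finset.Subset.refl _)⟩
  | succ n ih =>
    cases hi : inp n with
    | data t =>
      by_cases h : Triggers c₀ inp n
      · rw [cfgAt_triggers h]
        exact ⟨ih.2.2.1, ih.2.2.2.1, ih.2.2.1, ih.2.2.2.1, Or.inl (Finset.Subset.refl _)⟩
      · rw [cfgAt_data_not_triggers hi h]
        exact ih
    | control c =>
      rw [cfgAt_control hi]
      unfold Config.prepareReconfig
      split
      · rename_i hc
        obtain ⟨hv, hs⟩ := hctl n c hi hc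
        exact ⟨ih.1, ih.2.1, hv.1, hv.2, hs⟩
      · exact ih

/-- Without an announcement `ON` keeps its value, and a trigger merely copies `ON` onto `O`. So
repeated triggers after a switch change nothing. -/
theorem ON_eq_O_of_not_announces {m n : ℕ} (hmn : m ≤ n)
    (hm : (cfgAt c₀ inp m).ON = (cfgAt c₀ inp m).O)
    (h : ∀ i, m ≤ i → i < n → ¬ Announces c₀ inp i) :
    (cfgAt c₀ inp n).ON = (cfgAt c₀ inp n).O := by
  induction n, hmn using Nat.le_induction with
  | base => exact hm
  | succ n hn ih =>
    have ih := ih fun i h1 h2 => h i h1 (by omega)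
    have hna := h n hn (by omega)
    cases hi : inp n with
    | data t =>
      by_cases h : Triggers c₀ inp n
      · rw [cfgAt_triggers h]; rfl
      · rw [cfgAt_data_not_triggers hi h]
        exact ih
    | control c =>
      have : ¬ (cfgAt c₀ inp n).e < c.e := fun hc => hna ⟨c, hi, hc⟩
      rw [cfgAt_control hi, Config.prepareReconfig, if_neg this]
      exact ih

theorem O_eq_of_not_changes {m n : ℕ} (hmn : m ≤ n)
    (h : ∀ i, m ≤ i → i < n → ¬ Changes c₀ inp i) :
    (cfgAt c₀ inp n).O = (cfgAt c₀ inp m).O := by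
  induction n, hmn using Nat.le_induction with
  | base => rfl
  | succ n hn ih =>
    have := h n hn (by omega)
    rw [Changes, not_not] at this
    rw [this, ih fun i h1 h2 => h i h1 (by omega)]

/-- Up to the least change after `m` the set of instances is constant, so a member of the epoch
after `m` items is awaited at the barrier of that change. -/
theorem exists_first_change {m g : ℕ} (hmg : m ≤ g) (hg : Changes c₀ inp g) :
    ∃ g', m ≤ g' ∧ g' ≤ g ∧ Changes c₀ inp g' ∧ (cfgAt c₀ inp g').O = (cfgAt c₀ inp m).O := by
  classical
  have hex : ∃ g', m ≤ g' ∧ Changes c₀ inp g' := ⟨g, hmg, hg⟩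
  refine ⟨Nat.find hex, (Nat.find_spec hex).1, Nat.find_min' hex ⟨hmg, hg⟩,
    (Nat.find_spec hex).2, O_eq_of_not_changes (Nat.find_spec hex).1 fun i h1 h2 h3 => ?_⟩
  exact Nat.find_min hex h2 ⟨h1, h3⟩

/-- A change of the instances is announced after the previous one. -/
theorem Changes.exists_announces {N n : ℕ} (hN : N = 0 ∨ ∃ g, N = g + 1 ∧ Changes c₀ inp g)
    (hNn : N ≤ n) (hn : Changes c₀ inp n) : ∃ m, N ≤ m ∧ m < n ∧ Announces c₀ inp m := by
  by_contra hcon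
  push Not at hcon
  -- Initially and right after a change nothing new is announced, since the switch has copied `ON`
  -- onto `O`.
  have hset : (cfgAt c₀ inp N).ON = (cfgAt c₀ inp N).O := by
    rcases hN with rfl | ⟨g, rfl, hg⟩
    · rfl
    · rw [cfgAt_triggers hg.triggers]; rfl
  have := ON_eq_O_of_not_announces hNn hset hcon
  rw [hn.triggers.ON_eq] at this
  exact hn this

end EpochFacts

/-! ## The control skeleton of the system -/

/-- The control part of the local variables of an instance. The stage is `0` if the instance is
idle, `1, …, 6` within the reconfiguration code, and `7` during the processing of a tuple. -/
structure SLoc (K ι : Type*) where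
  W : ℤ
  cfg : Config K ι
  pos : ℕ
  st : ℕ

/-- The control part of a global state. -/
structure Skel (K ι : Type*) where
  loc : ι → SLoc K ι
  readers : Finset ι
  sources : Finset ι
  arrived : ι → ℕ

/-- The stage of a program counter. -/
def PC.stage {I : ℕ} {K Z : Type*} : PC I K Z → ℕ
  | .idle => 0
  | .barrier => 1
  | .addSources => 2
  | .addReaders => 3
  | .removeReaders => 4
  | .removeSources => 5
  | .switch => 6
  | _ => 7

def Local.skel {I : ℕ} {K Z ι : Type*} (L : Local I K Z ι) : SLoc K ι :=
  ⟨L.W, L.cfg, L.pos, L.pc.stage⟩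

def State.skel {I : ℕ} {K Z Q ι : Type*} (s : State I K Z Q ι) : Skel K ι :=
  ⟨fun i => (s.loc i).skel, s.readers, s.sources, s.arrived⟩

section Skeleton

variable {I : ℕ} {K Z P Q ι : Type*} [DecidableEq ι]

def Skel.setLoc (a : Skel K ι) (j : ι) (L : SLoc K ι) : Skel K ι :=
  { a with loc := Function.update a.loc j L }

/-- The steps of the skeleton. -/
inductive SStep (inp : ℕ → Item I P K ι) (j : ι) (a : Skel K ι) : Skel K ι → Prop
  | control (c : Ctl K ι) :
      (a.loc j).st = 0 → j ∈ a.readers → inp (a.loc j).pos = .control c →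
      ((a.loc j).cfg.e < c.e → ∀ i, i ∉ a.readers → (a.loc i).st = 0) →
      SStep inp j a (a.setLoc j
        ⟨(a.loc j).W, (a.loc j).cfg.prepareReconfig c, (a.loc j).pos + 1, 0⟩)
  | trigger (t : Tup I P) :
      (a.loc j).st = 0 → j ∈ a.readers → inp (a.loc j).pos = .data t →
      (a.loc j).W < max (a.loc j).W t.wm ∧ (a.loc j).cfg.γ < max (a.loc j).W t.wm →
      SStep inp j a
        { a.setLoc j ⟨max (a.loc j).W t.wm, (a.loc j).cfg, (a.loc j).pos, 1⟩ with
          arrived := Function.update a.arrived j ((a.loc j).pos + 1) }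
  | regular (t : Tup I P) :
      (a.loc j).st = 0 → j ∈ a.readers → inp (a.loc j).pos = .data t →
      ¬ ((a.loc j).W < max (a.loc j).W t.wm ∧ (a.loc j).cfg.γ < max (a.loc j).W t.wm) →
      SStep inp j a (a.setLoc j ⟨max (a.loc j).W t.wm, (a.loc j).cfg, (a.loc j).pos, 7⟩)
  | leaveBarrier :
      (a.loc j).st = 1 → (∀ i ∈ (a.loc j).cfg.O, (a.loc j).pos < a.arrived i) →
      SStep inp j a (a.setLoc j { a.loc j with st := 2 })
  | addSourcesTrue :
      (a.loc j).st = 2 → (a.loc j).cfg.O.card < (a.loc j).cfg.ON.card →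
      j ∈ a.sources → Disjoint ((a.loc j).cfg.ON \ (a.loc j).cfg.O) a.sources →
      SStep inp j a
        { a.setLoc j { a.loc j with st := 3 } with
          sources := a.sources ∪ ((a.loc j).cfg.ON \ (a.loc j).cfg.O) }
  | addSourcesFalse :
      (a.loc j).st = 2 →
      ¬ ((a.loc j).cfg.O.card < (a.loc j).cfg.ON.card ∧
        j ∈ a.sources ∧ Disjoint ((a.loc j).cfg.ON \ (a.loc j).cfg.O) a.sources) →
      SStep inp j a (a.setLoc j { a.loc j with st := 4 })
  | addReaders :
      (a.loc j).st = 3 →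
      SStep inp j a
        { a with
          loc := fun i =>
            if i = j then ⟨(a.loc j).W, (a.loc j).cfg, (a.loc j).pos, 4⟩
            else if i ∈ ((a.loc j).cfg.ON \ (a.loc j).cfg.O) \ a.readers then
              ⟨(a.loc i).W, (a.loc j).cfg, (a.loc j).pos, (a.loc i).st⟩
            else a.loc i
          readers := a.readers ∪ ((a.loc j).cfg.ON \ (a.loc j).cfg.O) }
  | removeReadersTrue :
      (a.loc j).st = 4 → (a.loc j).cfg.ON.card < (a.loc j).cfg.O.card →
      j ∈ a.readers → ((a.loc j).cfg.O \ (a.loc j).cfg.ON) ⊆ a.readers →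
      SStep inp j a
        { a.setLoc j { a.loc j with st := 5 } with
          readers := a.readers \ ((a.loc j).cfg.O \ (a.loc j).cfg.ON) }
  | removeReadersFalse :
      (a.loc j).st = 4 →
      ¬ ((a.loc j).cfg.ON.card < (a.loc j).cfg.O.card ∧
        j ∈ a.readers ∧ ((a.loc j).cfg.O \ (a.loc j).cfg.ON) ⊆ a.readers) →
      SStep inp j a (a.setLoc j { a.loc j with st := 6 })
  | removeSources :
      (a.loc j).st = 5 →
      SStep inp j a
        { a.setLoc j { a.loc j with st := 6 } with
          sources := a.sources \ ((a.loc j).cfg.O \ (a.loc j).cfg.ON) }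
  | switch :
      (a.loc j).st = 6 →
      SStep inp j a (a.setLoc j { a.loc j with cfg := (a.loc j).cfg.switch, st := 7 })
  | done :
      (a.loc j).st = 7 →
      SStep inp j a (a.setLoc j { a.loc j with pos := (a.loc j).pos + 1, st := 0 })

theorem State.skel_setLoc (s : State I K Z Q ι) (j : ι) (L : Local I K Z ι) :
    (s.setLoc j L).skel = s.skel.setLoc j L.skel := by
  simp only [State.skel, State.setLoc, Skel.setLoc, Skel.mk.injEq, and_true]
  funext i
  by_cases h : i = j
  · subst h; simp
  · simp [h]

theorem State.skel_goto (s : State I K Z Q ι) (j : ι) (pc : PC I K Z) :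
    (s.goto j pc).skel = s.skel.setLoc j { s.skel.loc j with st := pc.stage } :=
  s.skel_setLoc j _

theorem Skel.setLoc_self (a : Skel K ι) (j : ι) : a.setLoc j (a.loc j) = a := by
  simp [Skel.setLoc]

theorem PC.stage_eq_zero {pc : PC I K Z} : pc.stage = 0 ↔ pc = .idle := by
  cases pc <;> simp [PC.stage]

theorem State.skel_setKey [DecidableEq K] (s : State I K Z Q ι) (k : K) (ks : List (WSet I Z)) :
    (s.setKey k ks).skel = s.skel := rfl

theorem State.skel_forward [DecidableEq K] (s : State I K Z Q ι) (j : ι) (k : K)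
    (o : List (OutTup Q)) : (s.forward j k o).skel = s.skel := by
  unfold State.forward
  split <;> rfl

theorem State.skel_setLoc_of_eq (s : State I K Z Q ι) (j : ι) (L : Local I K Z ι)
    (h : L.skel = (s.loc j).skel) : (s.setLoc j L).skel = s.skel := by
  rw [State.skel_setLoc, h]
  exact Skel.setLoc_self s.skel j

theorem State.loc_forward [DecidableEq K] (s : State I K Z Q ι) (j : ι) (k : K)
    (o : List (OutTup Q)) : (s.forward j k o).loc = s.loc := by
  unfold State.forward
  split <;> rfl

/-- A step of the system is a step of the skeleton, or does not touch the skeleton. -/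
theorem Step.skel [DecidableEq K] {op : Oper I K Z P Q} {inp : ℕ → Item I P K ι} {j : ι}
    {s s' : State I K Z Q ι} (h : Step op inp j s s') :
    (s'.skel = s.skel ∧ (s.loc j).pc.stage = 7) ∨ SStep inp j s.skel s'.skel := by
  cases h with
  | control c h1 h2 h3 h4 =>
    right
    rw [State.skel_setLoc]
    have := SStep.control (inp := inp) (j := j) (a := s.skel) c (by simp [State.skel, Local.skel, h1, PC.stage]) h2 h3
      (fun h i hi => by simp [State.skel, Local.skel, h4 h i hi, PC.stage])
    convert this using 2
    simp [Local.skel, h1, PC.stage, State.skel]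
  | trigger t h1 h2 h3 h4 =>
    right
    have := SStep.trigger (inp := inp) (j := j) (a := s.skel) t (by simp [State.skel, Local.skel, h1, PC.stage]) h2 h3 h4
    convert this using 1
    have := State.skel_setLoc s j { s.loc j with W := max (s.loc j).W t.wm, pc := .barrier }
    simp only [State.skel, Skel.mk.injEq, State.setLoc, Skel.setLoc] at this ⊢
    refine ⟨this.1, ?_⟩
    simp [Local.skel]
  | regular t h1 h2 h3 h4 =>
    right
    rw [State.skel_setLoc]
    exact SStep.regular t (by simp [State.skel, Local.skel, h1, PC.stage]) h2 h3 h4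
  | leaveBarrier h1 h2 =>
    right
    rw [State.skel_goto]
    exact SStep.leaveBarrier (by simp [State.skel, Local.skel, h1, PC.stage]) h2
  | addSourcesTrue h1 h2 =>
    right
    have := SStep.addSourcesTrue (inp := inp) (j := j) (a := s.skel)
      (by simp [State.skel, Local.skel, h1, PC.stage]) h2.1 h2.2.1 h2.2.2
    convert this using 1
    have := State.skel_goto s j .addReaders
    simp only [State.skel, Skel.mk.injEq, Skel.setLoc] at this ⊢
    exact ⟨this.1, rfl, rfl, rfl⟩
  | addSourcesFalse h1 h2 =>
    right
    rw [State.skel_goto]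
    exact SStep.addSourcesFalse (by simp [State.skel, Local.skel, h1, PC.stage]) h2
  | addReaders h1 =>
    right
    have := SStep.addReaders (inp := inp) (j := j) (a := s.skel)
      (by simp [State.skel, Local.skel, h1, PC.stage])
    convert this using 1
    simp only [State.skel, Skel.mk.injEq, State.goto, State.setLoc, State.addReaders]
    refine ⟨?_, rfl, trivial, trivial⟩
    funext i
    by_cases hi : i = j
    · subst hi
      simp only [Function.update_self, if_true]
      split <;> simp [Local.skel, PC.stage]
    · simp only [Function.update_of_ne hi, if_neg hi]
      by_cases hm : i ∈ ((s.loc j).cfg.ON \ (s.loc j).cfg.O) \ s.readers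
      · rw [if_pos hm]
        exact (if_pos hm).symm
      · rw [if_neg hm]
        exact (if_neg hm).symm
  | removeReadersTrue h1 h2 =>
    right
    have := SStep.removeReadersTrue (inp := inp) (j := j) (a := s.skel)
      (by simp [State.skel, Local.skel, h1, PC.stage]) h2.1 h2.2.1 h2.2.2
    convert this using 1
    have := State.skel_goto s j .removeSources
    simp only [State.skel, Skel.mk.injEq, Skel.setLoc] at this ⊢
    exact ⟨this.1, rfl, rfl, rfl⟩
  | removeReadersFalse h1 h2 =>
    right
    rw [State.skel_goto]
    exact SStep.removeReadersFalse (by simp [State.skel, Local.skel, h1, PC.stage]) h2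
  | removeSources h1 =>
    right
    have := SStep.removeSources (inp := inp) (j := j) (a := s.skel)
      (by simp [State.skel, Local.skel, h1, PC.stage])
    convert this using 1
    have := State.skel_goto s j .switch
    simp only [State.skel, Skel.mk.injEq, Skel.setLoc] at this ⊢
    exact ⟨this.1, rfl, rfl, rfl⟩
  | switch h1 =>
    right
    rw [State.skel_setLoc]
    exact SStep.switch (by simp [State.skel, Local.skel, h1, PC.stage])
  | output k w h1 =>
    left
    refine ⟨?_, by simp [h1, PC.stage]⟩
    rw [State.goto, State.skel_setLoc_of_eq, State.skel_forward]
    simp [Local.skel, State.loc_forward, h1, PC.stage]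
  | shift k w h1 =>
    left
    refine ⟨?_, by simp [h1, PC.stage]⟩
    rw [State.goto, State.skel_setLoc_of_eq, State.skel_setKey]
    simp [Local.skel, State.setKey, h1, PC.stage]
  | advance h1 =>
    left
    refine ⟨?_, by simp [h1, PC.stage]⟩
    rw [State.skel_setLoc_of_eq]
    simp [Local.skel]
  | expired h1 =>
    left
    refine ⟨?_, by simp [h1, PC.stage]⟩
    rw [State.goto, State.skel_setLoc_of_eq]
    simp [Local.skel, h1, PC.stage]
  | handle t h1 =>
    left
    refine ⟨?_, by simp [h1, PC.stage]⟩
    rw [State.skel_setLoc_of_eq]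
    simp [Local.skel, h1, PC.stage]
  | skip t h1 =>
    right
    rw [State.skel_setLoc]
    exact SStep.done (by simp [State.skel, Local.skel, h1, PC.stage])
  | create t ℓ S k h1 =>
    left
    refine ⟨?_, by simp [h1, PC.stage]⟩
    rw [State.goto, State.skel_setLoc_of_eq, State.skel_setKey]
    simp [Local.skel, State.setKey, h1, PC.stage]
  | compute t ℓ S k w h1 =>
    left
    refine ⟨?_, by simp [h1, PC.stage]⟩
    rw [State.goto, State.skel_setLoc_of_eq, State.skel_forward]
    simp [Local.skel, State.loc_forward, h1, PC.stage]
  | write t ℓ S k ζ h1 =>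
    left
    refine ⟨?_, by simp [h1, PC.stage]⟩
    rw [State.goto, State.skel_setLoc_of_eq, State.skel_setKey]
    simp [Local.skel, State.setKey, h1, PC.stage]
  | nextRound t ℓ h1 =>
    left
    refine ⟨?_, by simp [h1, PC.stage]⟩
    rw [State.goto, State.skel_setLoc_of_eq]
    simp [Local.skel, h1, PC.stage]
  | finish t ℓ h1 =>
    right
    rw [State.skel_setLoc]
    exact SStep.done (by simp [State.skel, Local.skel, h1, PC.stage])

end Skeleton

/-! ## The invariant of the skeleton -/

section SkeletonInvariant

variable {I : ℕ} {K P ι : Type*} [DecidableEq ι] (c₀ : Ctl K ι) (inp : ℕ → Item I P K ι)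

/-- The local variables of an instance are those of the stream at its cursor; `rd` says whether the
instance is a reader, and `ar` is its entry in the barrier. -/
structure LocOK (rd : Prop) (L : SLoc K ι) (ar : ℕ) : Prop where
  W_le : L.st = 0 → L.W ≤ wmAt c₀ inp L.pos
  -- An added reader inherits the cursor and the epoch variables, but not the watermark. Its own may
  -- be stale, but then its next item is one that triggers.
  W_eq : rd → L.st = 0 → L.W = wmAt c₀ inp L.pos ∨ Triggers c₀ inp L.pos
  W_busy : L.st ≠ 0 → L.W = wmAt c₀ inp (L.pos + 1)
  cfg_idle : rd → L.st = 0 → L.cfg = cfgAt c₀ inp L.pos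
  cfg_pre : L.st ≠ 0 → L.st < 7 → L.cfg = cfgAt c₀ inp L.pos ∧ Triggers c₀ inp L.pos
  cfg_post : L.st = 7 → L.cfg = cfgAt c₀ inp (L.pos + 1)
  is_data : L.st ≠ 0 → ∃ t, inp L.pos = .data t
  arr_le : ar ≤ L.pos + 1
  arr_idle : L.st = 0 → ar ≤ L.pos
  arr_busy : L.st ≠ 0 → Triggers c₀ inp L.pos → L.pos < ar
  st_le : L.st ≤ 7

/-- `L` is past the barrier for item `n`. -/
def SLoc.PastBarrier (L : SLoc K ι) (n : ℕ) : Prop := n < L.pos ∨ n = L.pos ∧ 2 ≤ L.st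

/-- `L` is past the point where item `g` connects or disconnects instances. -/
def SLoc.PastChange (L : SLoc K ι) (g : ℕ) : Prop :=
  g < L.pos ∨ g = L.pos ∧
    (5 ≤ L.st ∨ 3 ≤ L.st ∧ (cfgAt c₀ inp g).O ⊆ (cfgAt c₀ inp (g + 1)).O)

/-- The connected instances are those of the epoch after `N` items, up to the two moments at which
only one of the buffers has been adapted. -/
inductive Phase (a : Skel K ι) (N : ℕ) : Prop
  | stable : a.readers = (cfgAt c₀ inp N).O → a.sources = (cfgAt c₀ inp N).O →
      (∀ i, (a.loc i).st ≠ 3 ∧ (a.loc i).st ≠ 5) → Phase a N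
  | adding (r : ι) (g : ℕ) : N = g + 1 → (cfgAt c₀ inp g).O ⊆ (cfgAt c₀ inp (g + 1)).O →
      a.readers = (cfgAt c₀ inp g).O → a.sources = (cfgAt c₀ inp (g + 1)).O →
      (a.loc r).st = 3 → (a.loc r).pos = g → (∀ i, (a.loc i).st = 3 → i = r) →
      (∀ i, (a.loc i).st ≠ 5) →
      (∀ i, i ∉ a.readers → (a.loc i).st = 0 ∧ (a.loc i).pos < g) → Phase a N
  | removing (r : ι) (g : ℕ) : N = g + 1 → (cfgAt c₀ inp (g + 1)).O ⊆ (cfgAt c₀ inp g).O →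
      a.readers = (cfgAt c₀ inp (g + 1)).O → a.sources = (cfgAt c₀ inp g).O →
      (a.loc r).st = 5 → (a.loc r).pos = g → (∀ i, (a.loc i).st = 5 → i = r) →
      (∀ i, (a.loc i).st ≠ 3) → Phase a N

/-- The invariant of the skeleton: `N` is `0`, or `N - 1` is the last item for which the sets of
readers and sources have been adapted. -/
structure SInv (a : Skel K ι) (N : ℕ) : Prop where
  loc : ∀ i, LocOK c₀ inp (i ∈ a.readers) (a.loc i) (a.arrived i)
  bar : ∀ i n, Triggers c₀ inp n → (a.loc i).PastBarrier n →
    ∀ j ∈ (cfgAt c₀ inp n).O, n < a.arrived j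
  barN : ∀ n, Triggers c₀ inp n → n < N → ∀ j ∈ (cfgAt c₀ inp n).O, n < a.arrived j
  last : N = 0 ∨ ∃ g, N = g + 1 ∧ Changes c₀ inp g
  passed : ∀ i g, Changes c₀ inp g → (a.loc i).PastChange c₀ inp g → g < N
  lower : ∀ i, i ∈ a.readers ∨ (a.loc i).st ≠ 0 → N ≤ (a.loc i).pos + 1
  -- Remembers the delivery guard of an announcement until the announced change has been carried
  -- out.
  ctl : ∀ m i, N ≤ m → Announces c₀ inp m → m < (a.loc i).pos →
    ∀ i', i' ∉ a.readers → (a.loc i').st = 0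
  upper : ∀ i, i ∉ a.readers → (a.loc i).pos ≤ N ∧ ((a.loc i).st ≠ 0 → (a.loc i).pos < N)
  -- Confines the busy instances to a finite set, although there may be infinitely many instances;
  -- this matters for progress only.
  touched : ∀ i, (a.loc i).st ≠ 0 → ∃ m ≤ N, i ∈ (cfgAt c₀ inp m).O
  phase : Phase c₀ inp a N

variable {c₀ inp} {a : Skel K ι} {N : ℕ} {j : ι}

theorem LocOK.mono {rd rd' : Prop} {L : SLoc K ι} {ar : ℕ} (h : LocOK c₀ inp rd L ar)
    (hr : rd' → rd) : LocOK c₀ inp rd' L ar :=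
  { h with
    W_eq := fun h' => h.W_eq (hr h')
    cfg_idle := fun h' => h.cfg_idle (hr h') }

/-- The local test for the reconfiguration code agrees with the stream. -/
theorem LocOK.triggers_iff {rd : Prop} {L : SLoc K ι} {ar : ℕ} (h : LocOK c₀ inp rd L ar)
    (hst : L.st = 0) (hrd : rd) {t : Tup I P} (ht : inp L.pos = .data t) :
    ((L.W < max L.W t.wm ∧ L.cfg.γ < max L.W t.wm) ↔ Triggers c₀ inp L.pos) ∧
      max L.W t.wm = wmAt c₀ inp (L.pos + 1) := by
  have hc := h.cfg_idle hrd hst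
  rw [wmAt_data ht]
  rcases h.W_eq hrd hst with hW | hT
  · rw [hW, hc]
    refine ⟨⟨fun h' => ⟨t, ht, h'⟩, ?_⟩, rfl⟩
    rintro ⟨t', ht', h'⟩
    rw [ht] at ht'
    cases ht'
    exact h'
  -- The item raises the watermark of the stream to `t.wm`, hence also every smaller, stale one, and
  -- to the same value.
  · refine ⟨iff_of_true ?_ hT, ?_⟩ <;>
    · obtain ⟨t', ht', h1, h2⟩ := hT
      rw [ht] at ht'
      cases ht'
      have := h.W_le hst
      grind

theorem SInv.readers_touched (h : SInv c₀ inp a N) {i : ι} (hi : i ∈ a.readers) :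
    ∃ m ≤ N, i ∈ (cfgAt c₀ inp m).O := by
  rcases h.phase with ⟨h1, _, _⟩ | ⟨r, g, h0, _, h1, _⟩ | ⟨r, g, h0, _, h1, _⟩
  · exact ⟨N, le_rfl, h1 ▸ hi⟩
  · exact ⟨g, by omega, h1 ▸ hi⟩
  · exact ⟨g + 1, by omega, h1 ▸ hi⟩

/-- Steps of `j` that leave the readers alone. -/
theorem SInv.setLoc_of_phase (h : SInv c₀ inp a N) {L : SLoc K ι} {ar : ℕ} {src : Finset ι}
    (hr : j ∈ a.readers ∨ (a.loc j).st ≠ 0)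
    (hpos : L.pos = (a.loc j).pos ∨ L.pos = (a.loc j).pos + 1 ∧ L.st = 0)
    (hL : LocOK c₀ inp (j ∈ a.readers) L ar) (har : a.arrived j ≤ ar)
    (hphase : Phase c₀ inp ⟨Function.update a.loc j L, a.readers, src,
      Function.update a.arrived j ar⟩ N)
    (hbar : ∀ n, Triggers c₀ inp n → L.PastBarrier n → ¬ (a.loc j).PastBarrier n →
      ∀ i ∈ (cfgAt c₀ inp n).O, n < a.arrived i)
    (hpass : ∀ g, Changes c₀ inp g → L.PastChange c₀ inp g → ¬ (a.loc j).PastChange c₀ inp g →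
      g < N)
    (hctl : ∀ m, N ≤ m → Announces c₀ inp m → m < L.pos →
      m < (a.loc j).pos ∨ ∀ i, i ∉ a.readers → (a.loc i).st = 0) :
    SInv c₀ inp ⟨Function.update a.loc j L, a.readers, src, Function.update a.arrived j ar⟩ N := by
  have hj : ∀ i, i ≠ j → Function.update a.loc j L i = a.loc i := fun i hi =>
    Function.update_of_ne hi _ _
  have harr : ∀ i, a.arrived i ≤ Function.update a.arrived j ar i := by
    intro i
    by_cases hi : i = j
    · subst hi; simpa using har
    · simp [hi]
  have hple : (a.loc j).pos ≤ L.pos := by rcases hpos with h | h <;> omega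
  refine ⟨?_, ?_, ?_, h.last, ?_, ?_, ?_, ?_, ?_, hphase⟩ <;> dsimp only
  · intro i
    by_cases hi : i = j
    · subst hi; simpa using hL
    · simpa [hi] using h.loc i
  · intro i n hn hp k hk
    refine lt_of_lt_of_le ?_ (harr k)
    by_cases hi : i = j
    · subst hi
      simp only [Function.update_self] at hp
      by_cases hp' : (a.loc i).PastBarrier n
      · exact h.bar i n hn hp' k hk
      · exact hbar n hn hp hp' k hk
    · rw [hj i hi] at hp
      exact h.bar i n hn hp k hk
  · exact fun n hn hnN k hk => lt_of_lt_of_le (h.barN n hn hnN k hk) (harr k)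
  · intro i g hg hp
    by_cases hi : i = j
    · subst hi
      simp only [Function.update_self] at hp
      by_cases hp' : (a.loc i).PastChange c₀ inp g
      · exact h.passed i g hg hp'
      · exact hpass g hg hp hp'
    · rw [hj i hi] at hp
      exact h.passed i g hg hp
  · intro i hi'
    by_cases hi : i = j
    · subst hi
      have := h.lower i hr
      simp only [Function.update_self]
      omega
    · rw [hj i hi] at hi' ⊢
      exact h.lower i hi'
  · intro m i hm hA hmi i' hi'
    have hold : ∀ i, i ∉ a.readers → (a.loc i).st = 0 := by
      by_cases hi : i = j
      · subst hi
        simp only [Function.update_self] at hmi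
        rcases hctl m hm hA hmi with h' | h'
        · exact h.ctl m i hm hA h'
        · exact h'
      · rw [hj i hi] at hmi
        exact h.ctl m i hm hA hmi
    have hne : i' ≠ j := by
      rintro rfl
      exact hr.elim hi' fun h' => h' (hold i' hi')
    rw [hj i' hne]
    exact hold i' hi'
  · intro i hi'
    by_cases hi : i = j
    · subst hi
      have hb : (a.loc i).st ≠ 0 := hr.resolve_left hi'
      have := (h.upper i hi').2 hb
      simp only [Function.update_self]
      rcases hpos with h' | h'
      · exact ⟨by omega, fun _ => by omega⟩
      · exact ⟨by omega, fun h'' => absurd h'.2 h''⟩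
    · rw [hj i hi]
      exact h.upper i hi'
  · intro i hi'
    by_cases hi : i = j
    · subst hi
      exact hr.elim h.readers_touched (h.touched i)
    · rw [hj i hi] at hi'
      exact h.touched i hi'

/-- Steps of `j` that leave the buffers alone. -/
theorem SInv.setLoc (h : SInv c₀ inp a N) {L : SLoc K ι} {ar : ℕ}
    (hr : j ∈ a.readers ∨ (a.loc j).st ≠ 0)
    (hpos : L.pos = (a.loc j).pos ∨ L.pos = (a.loc j).pos + 1 ∧ L.st = 0)
    (hL : LocOK c₀ inp (j ∈ a.readers) L ar) (har : a.arrived j ≤ ar)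
    (hst : L.st ≠ 3 ∧ L.st ≠ 5) (hst' : (a.loc j).st ≠ 3 ∧ (a.loc j).st ≠ 5)
    (hbar : ∀ n, Triggers c₀ inp n → L.PastBarrier n → ¬ (a.loc j).PastBarrier n →
      ∀ i ∈ (cfgAt c₀ inp n).O, n < a.arrived i)
    (hpass : ∀ g, Changes c₀ inp g → L.PastChange c₀ inp g → ¬ (a.loc j).PastChange c₀ inp g →
      g < N)
    (hctl : ∀ m, N ≤ m → Announces c₀ inp m → m < L.pos →
      m < (a.loc j).pos ∨ ∀ i, i ∉ a.readers → (a.loc i).st = 0) :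
    SInv c₀ inp { a.setLoc j L with arrived := Function.update a.arrived j ar } N := by
  have hj : ∀ i, i ≠ j → Function.update a.loc j L i = a.loc i := fun i hi =>
    Function.update_of_ne hi _ _
  refine h.setLoc_of_phase hr hpos hL har ?_ hbar hpass hctl
  -- The phase depends on the stages only through who is at stage `3` or `5`, and `j` is there
  -- neither before nor after.
  have hne : ∀ c, (c = 3 ∨ c = 5) → ∀ i, (Function.update a.loc j L i).st = c ↔ (a.loc i).st = c := by
    intro c hc i
    by_cases hi : i = j
    · subst hi
      simp only [Function.update_self]
      omega
    · rw [hj i hi]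
  have h3 := hne 3 (by simp)
  have h5 := hne 5 (by simp)
  have hrj : ∀ r, (a.loc r).st = 3 ∨ (a.loc r).st = 5 → r ≠ j := by
    rintro r hr' rfl
    omega
  rcases h.phase with ⟨h1, h2, h4⟩ | ⟨r, g, h0, h1, h2, h4, h6, h7, h8, h9, h10⟩ |
    ⟨r, g, h0, h1, h2, h4, h6, h7, h8, h9⟩
  · refine .stable h1 h2 fun i => ?_
    simp only [ne_eq, h3, h5]
    exact h4 i
  · refine .adding r g h0 h1 h2 h4 ?_ ?_ ?_ ?_ ?_
    · simpa only [h3] using h6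
    · dsimp only
      rwa [hj r (hrj r (Or.inl h6))]
    · simpa only [h3] using h8
    · simpa only [ne_eq, h5] using h9
    · intro i hi
      have hij : i ≠ j := by
        rintro rfl
        exact hr.elim hi fun h' => h' (h10 i hi).1
      dsimp only
      rw [hj i hij]
      exact h10 i hi
  · refine .removing r g h0 h1 h2 h4 ?_ ?_ ?_ ?_
    · simpa only [h5] using h6
    · dsimp only
      rwa [hj r (hrj r (Or.inr h6))]
    · simpa only [h5] using h8
    · simpa only [ne_eq, h3] using h9

/-- When `j` is about to carry out a change of the instances which nobody has carried out yet, all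
previous ones have been completed. -/
theorem SInv.ready (h : SInv c₀ inp a N) (h2 : 2 ≤ (a.loc j).st) (h4 : (a.loc j).st ≤ 4)
    (hc : Changes c₀ inp (a.loc j).pos) (hN : N ≤ (a.loc j).pos) :
    N < (a.loc j).pos ∧ a.readers = (cfgAt c₀ inp (a.loc j).pos).O ∧
      a.sources = (cfgAt c₀ inp (a.loc j).pos).O ∧
      (∀ i, (a.loc i).st ≠ 3 ∧ (a.loc i).st ≠ 5) ∧
      (∀ i, i ∉ a.readers → (a.loc i).st = 0) ∧ j ∈ a.readers ∧
      (∀ i ∈ a.readers, (a.loc j).pos ≤ (a.loc i).pos) := by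
  -- The change has been announced after the previous one, and `j` has consumed the announcement, so
  -- the guard of its delivery is in force.
  obtain ⟨m, hm1, hm2, hm3⟩ := hc.exists_announces h.last hN
  have hidle := h.ctl m j hm1 hm3 hm2
  have hO : (cfgAt c₀ inp (a.loc j).pos).O = (cfgAt c₀ inp N).O :=
    O_eq_of_not_changes hN fun i h1 h2 h3 =>
      absurd (h.passed j i h3 (Or.inl h2)) (by omega)
  have harr : ∀ i ∈ (cfgAt c₀ inp (a.loc j).pos).O, (a.loc j).pos ≤ (a.loc i).pos := by
    intro i hi
    have := h.bar j _ hc.triggers (Or.inr ⟨rfl, h2⟩) i hi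
    have := (h.loc i).arr_le
    omega
  have hjr : j ∈ a.readers := by
    by_contra hj
    have := hidle j hj
    omega
  have hrd : ∀ r, (a.loc r).st ≠ 0 → r ∈ a.readers := fun r hr => by
    by_contra hj
    exact hr (hidle r hj)
  rcases h.phase with ⟨h1, h2, h4⟩ | ⟨r, g, h0, h1, h2, h4, h6, h7, h8, h9, h10⟩ |
      ⟨r, g, h0, h1, h2, h4, h6, h7, h8, h9⟩
  · rw [hO]
    exact ⟨by omega, h1, h2, h4, hidle, hjr, fun i hi => harr i (by rwa [hO, ← h1])⟩
  -- In both intermediate phases the instance `r` half-way through the change of item `g = N - 1`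
  -- belongs to the current epoch. The barrier then puts it at the item of `j` or later, not at `g`.
  · exfalso
    have hr := hrd r (by omega)
    rw [h2] at hr
    have := harr r (by rw [hO, h0]; exact h1 hr)
    omega
  · exfalso
    have hr := hrd r (by omega)
    rw [h2, ← h0, ← hO] at hr
    have := harr r hr
    omega

theorem SInv.initial : SInv c₀ inp
    (⟨fun _ => ⟨0, Config.initial c₀, 0, 0⟩, c₀.O, c₀.O, fun _ => 0⟩ : Skel K ι) 0 := by
  refine ⟨?_, ?_, ?_, Or.inl rfl, ?_, ?_, ?_, ?_, ?_, ?_⟩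
  · intro i
    refine ⟨?_, ?_, ?_, ?_, ?_, ?_, ?_, ?_, ?_, ?_, ?_⟩ <;> simp [wmAt, cfgAt, epochAt]
  · simp [SLoc.PastBarrier]
  · simp
  · simp [SLoc.PastChange]
  · simp
  · simp
  · simp
  · simp
  · exact .stable rfl rfl (by simp)

theorem Skel.setLoc_arrived (a : Skel K ι) (j : ι) (L : SLoc K ι) :
    ({ a.setLoc j L with arrived := Function.update a.arrived j (a.arrived j) } : Skel K ι) =
      a.setLoc j L := by
  simp [Skel.setLoc]

/-! ### Preservation of the control invariant -/

variable (hinit : c₀.Valid) (hctl : ValidReconfigs c₀ inp)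

/-- Comparable finite sets are ordered by inclusion as they are by cardinality, so the test of the
code recognizes provisioning; dually for decommissioning below. -/
theorem Triggers.card_lt_iff (hinit : c₀.Valid) (hctl : ValidReconfigs c₀ inp) {n : ℕ}
    (h : Triggers c₀ inp n) :
    (cfgAt c₀ inp n).O.card < (cfgAt c₀ inp n).ON.card ↔
      Changes c₀ inp n ∧ (cfgAt c₀ inp n).O ⊆ (cfgAt c₀ inp (n + 1)).O := by
  have hv := (cfgAt_valid hinit hctl n).2.2.2.2
  rw [h.ON_eq] at hv ⊢
  constructor
  · intro hlt
    refine ⟨fun he => by rw [he] at hlt; omega, hv.resolve_right fun hs => ?_⟩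
    have := Finset.card_le_card hs
    omega
  · rintro ⟨h1, h2⟩
    exact Finset.card_lt_card (h2.ssubset_of_ne (Ne.symm h1))

theorem Triggers.lt_card_iff (hinit : c₀.Valid) (hctl : ValidReconfigs c₀ inp) {n : ℕ}
    (h : Triggers c₀ inp n) :
    (cfgAt c₀ inp n).ON.card < (cfgAt c₀ inp n).O.card ↔
      Changes c₀ inp n ∧ (cfgAt c₀ inp (n + 1)).O ⊆ (cfgAt c₀ inp n).O := by
  have hv := (cfgAt_valid hinit hctl n).2.2.2.2
  rw [h.ON_eq] at hv ⊢
  constructor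
  · intro hlt
    refine ⟨fun he => by rw [he] at hlt; omega, hv.resolve_left fun hs => ?_⟩
    have := Finset.card_le_card hs
    omega
  · rintro ⟨h1, h2⟩
    exact Finset.card_lt_card (h2.ssubset_of_ne h1)

theorem Changes.subset_or (hinit : c₀.Valid) (hctl : ValidReconfigs c₀ inp) {n : ℕ}
    (h : Changes c₀ inp n) :
    (cfgAt c₀ inp n).O ⊆ (cfgAt c₀ inp (n + 1)).O ∨
      (cfgAt c₀ inp (n + 1)).O ⊆ (cfgAt c₀ inp n).O := by
  have hv := (cfgAt_valid hinit hctl n).2.2.2.2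
  rwa [h.triggers.ON_eq] at hv

/-- A change that adds an instance and one that removes an instance are different. -/
theorem Changes.not_both {n : ℕ} (h : Changes c₀ inp n)
    (h1 : (cfgAt c₀ inp n).O ⊆ (cfgAt c₀ inp (n + 1)).O)
    (h2 : (cfgAt c₀ inp (n + 1)).O ⊆ (cfgAt c₀ inp n).O) : False :=
  h (h2.antisymm h1)

/-- `j` is in the middle of the reconfiguration code and moves on to the next stage. -/
theorem SInv.setStage (h : SInv c₀ inp a N) {c : ℕ} (h1 : 1 ≤ (a.loc j).st)
    (h6 : (a.loc j).st < 7) (hc0 : 2 ≤ c) (hc7 : c < 7) (hst : c ≠ 3 ∧ c ≠ 5)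
    (hst' : (a.loc j).st ≠ 3 ∧ (a.loc j).st ≠ 5)
    (hbar : ∀ i ∈ (cfgAt c₀ inp (a.loc j).pos).O, (a.loc j).pos < a.arrived i)
    (hpass : Changes c₀ inp (a.loc j).pos →
      (5 ≤ c ∨ 3 ≤ c ∧
        (cfgAt c₀ inp (a.loc j).pos).O ⊆ (cfgAt c₀ inp ((a.loc j).pos + 1)).O) →
      (a.loc j).pos < N) :
    SInv c₀ inp (a.setLoc j { a.loc j with st := c }) N := by
  have hl := h.loc j
  have hb : (a.loc j).st ≠ 0 := by omega
  rw [← Skel.setLoc_arrived]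
  refine h.setLoc (Or.inr hb) (Or.inl rfl) ?_ le_rfl hst hst' ?_ ?_ ?_
  · refine ⟨?_, ?_, ?_, ?_, ?_, ?_, ?_, ?_, ?_, ?_, ?_⟩ <;> dsimp only
    · omega
    · omega
    · exact fun _ => hl.W_busy hb
    · omega
    · exact fun _ _ => hl.cfg_pre hb h6
    · omega
    · exact fun _ => hl.is_data hb
    · exact hl.arr_le
    · omega
    · exact fun _ => hl.arr_busy hb
    · omega
  · rintro n hn (hp | ⟨rfl, hp⟩) hnp i hi
    · exact absurd (Or.inl hp) hnp
    · exact hbar i hi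
  · rintro g hg (hp | ⟨rfl, hp⟩) hnp
    · exact absurd (Or.inl hp) hnp
    · exact hpass hg hp
  · exact fun m _ _ hm => Or.inl hm

include hinit hctl in
/-- The invariant is preserved by every step. -/
theorem SInv.step (h : SInv c₀ inp a N) {a' : Skel K ι} (hs : SStep inp j a a') :
    ∃ N', SInv c₀ inp a' N' := by
  have hl := h.loc j
  cases hs with
  | control c h1 h2 h3 h4 =>
    refine ⟨N, ?_⟩
    have hnt : ¬ Triggers c₀ inp (a.loc j).pos := by
      rintro ⟨t, ht, _⟩
      rw [h3] at ht
      cases ht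
    have hnc : ¬ Changes c₀ inp (a.loc j).pos := fun hc => hnt hc.triggers
    rw [← Skel.setLoc_arrived]
    refine h.setLoc (Or.inl h2) (Or.inr ⟨rfl, rfl⟩) ?_ le_rfl (by simp) (by omega) ?_ ?_ ?_
    · refine ⟨?_, ?_, ?_, ?_, ?_, ?_, ?_, ?_, ?_, ?_, ?_⟩ <;> dsimp only
      · intro _
        rw [wmAt_control h3]
        exact hl.W_le h1
      · intro _ _
        rw [wmAt_control h3]
        exact Or.inl ((hl.W_eq h2 h1).resolve_right hnt)
      · simp
      · intro _ _
        rw [cfgAt_control h3, hl.cfg_idle h2 h1]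
      · simp
      · simp
      · simp
      · have := hl.arr_le; omega
      · exact fun _ => hl.arr_le
      · simp
      · simp
    · rintro n hn (hp | ⟨rfl, hp⟩) hnp i hi
      · dsimp only at hp
        rcases Nat.lt_succ_iff_lt_or_eq.1 hp with hp | rfl
        · exact absurd (Or.inl hp) hnp
        · exact absurd hn hnt
      · simp at hp
    · rintro g hg (hp | ⟨rfl, hp⟩) hnp
      · dsimp only at hp
        rcases Nat.lt_succ_iff_lt_or_eq.1 hp with hp | rfl
        · exact absurd (Or.inl hp) hnp
        · exact absurd hg hnc
      · simp at hp
    · intro m _ hA hm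
      dsimp only at hm
      rcases Nat.lt_succ_iff_lt_or_eq.1 hm with hm | rfl
      · exact Or.inl hm
      -- The announcement is the item just consumed, and the guard of this step is what is asked
      -- for.
      · right
        obtain ⟨c', hc', hA⟩ := hA
        rw [h3] at hc'
        cases hc'
        rw [← hl.cfg_idle h2 h1] at hA
        exact h4 hA
  | trigger t h1 h2 h3 h4 =>
    refine ⟨N, ?_⟩
    obtain ⟨hT, hW⟩ := hl.triggers_iff h1 h2 h3
    have hT := hT.1 h4
    refine h.setLoc (Or.inl h2) (Or.inl rfl) ?_ ?_ (by simp) (by omega) ?_ ?_ ?_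
    · refine ⟨?_, ?_, ?_, ?_, ?_, ?_, ?_, ?_, ?_, ?_, ?_⟩ <;> dsimp only
      · simp
      · simp
      · exact fun _ => hW
      · simp
      · exact fun _ _ => ⟨hl.cfg_idle h2 h1, hT⟩
      · simp
      · exact fun _ => ⟨t, h3⟩
      · rfl
      · simp
      · simp
      · simp
    · have := hl.arr_idle h1; omega
    · rintro n hn (hp | ⟨rfl, hp⟩) hnp i hi
      · exact absurd (Or.inl hp) hnp
      · simp at hp
    · rintro g hg (hp | ⟨rfl, hp⟩) hnp
      · exact absurd (Or.inl hp) hnp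
      · simp at hp
    · exact fun m _ _ hm => Or.inl hm
  | regular t h1 h2 h3 h4 =>
    refine ⟨N, ?_⟩
    obtain ⟨hT, hW⟩ := hl.triggers_iff h1 h2 h3
    have hnt := fun h' => h4 (hT.2 h')
    rw [← Skel.setLoc_arrived]
    refine h.setLoc (Or.inl h2) (Or.inl rfl) ?_ le_rfl (by simp) (by omega) ?_ ?_ ?_
    · refine ⟨?_, ?_, ?_, ?_, ?_, ?_, ?_, ?_, ?_, ?_, ?_⟩ <;> dsimp only
      · simp
      · simp
      · exact fun _ => hW
      · simp
      · simp
      · intro _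
        rw [cfgAt_data_not_triggers h3 hnt, hl.cfg_idle h2 h1]
      · exact fun _ => ⟨t, h3⟩
      · exact hl.arr_le
      · simp
      · exact fun _ h' => absurd h' hnt
      · simp
    · rintro n hn (hp | ⟨rfl, hp⟩) hnp i hi
      · exact absurd (Or.inl hp) hnp
      · exact absurd hn hnt
    · rintro g hg (hp | ⟨rfl, hp⟩) hnp
      · exact absurd (Or.inl hp) hnp
      · exact absurd hg.triggers hnt
    · exact fun m _ _ hm => Or.inl hm
  | leaveBarrier h1 h2 =>
    refine ⟨N, h.setStage (by omega) (by omega) le_rfl (by omega) (by omega) (by omega) ?_ ?_⟩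
    · rwa [← (hl.cfg_pre (by omega) (by omega)).1]
    · omega
  | addSourcesTrue h1 h2 h3 h4 =>
    obtain ⟨hcfg, hT⟩ := hl.cfg_pre (by omega) (by omega)
    rw [hcfg] at h2 h4
    obtain ⟨hC, hsub⟩ := (hT.card_lt_iff hinit hctl).1 h2
    set n := (a.loc j).pos with hn
    rw [hT.ON_eq] at h4
    -- Had somebody else carried out this change, the instances to be added would be sources
    -- already, and the disjointness test would fail.
    have hNn : N ≤ n := by
      by_contra hcon
      have hN : N = n + 1 := by
        have := h.lower j (Or.inr (by omega))
        omega
      have hsrc : (cfgAt c₀ inp (n + 1)).O ⊆ a.sources := by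
        rcases h.phase with ⟨_, h1, _⟩ | ⟨r, g, h0, _, _, h1, _⟩ | ⟨r, g, h0, hs, _, h1, _⟩
        · rw [h1, hN]
        · rw [h1, ← h0, hN]
        · obtain rfl : n = g := by omega
          exact absurd hs fun hs => hC.not_both hsub hs
      have hemp : (cfgAt c₀ inp (n + 1)).O \ (cfgAt c₀ inp n).O = ∅ :=
        Finset.disjoint_self_iff_empty _ |>.1
          (h4.mono_right (Finset.sdiff_subset.trans hsrc))
      exact hC.not_both hsub (Finset.sdiff_eq_empty_iff_subset.1 hemp)
    obtain ⟨r1, r2, r3, r4, r5, r6, r7⟩ := h.ready (by omega) (by omega) hC hNn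
    rw [← hn] at *
    -- The ghost counter moves on: item `n` is now the last one whose change has been begun.
    refine ⟨n + 1, ?_⟩
    have hj : ∀ i, i ≠ j → Function.update a.loc j { a.loc j with st := 3 } i = a.loc i :=
      fun i hi => Function.update_of_ne hi _ _
    have hb : ∀ k ∈ (cfgAt c₀ inp n).O, n < a.arrived k :=
      h.bar j n hT (Or.inr ⟨hn, by omega⟩)
    have hbusy : ∀ i, (Function.update a.loc j { a.loc j with st := 3 } i).st ≠ 0 →
        i ∈ a.readers := by
      intro i hi
      by_cases hij : i = j
      · rwa [hij]
      · rw [hj i hij] at hi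
        by_contra hr
        exact hi (r5 i hr)
    have hpos : ∀ i, (Function.update a.loc j { a.loc j with st := 3 } i).pos = (a.loc i).pos := by
      intro i
      by_cases hij : i = j
      · subst hij; simp
      · rw [hj i hij]
    refine ⟨?_, ?_, ?_, Or.inr ⟨n, rfl, hC⟩, ?_, ?_, ?_, ?_, ?_, ?_⟩ <;> simp only [Skel.setLoc]
    · intro i
      by_cases hij : i = j
      · subst hij
        simp only [Function.update_self]
        refine ⟨?_, ?_, ?_, ?_, ?_, ?_, ?_, ?_, ?_, ?_, ?_⟩ <;> dsimp only
        · simp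
        · simp
        · exact fun _ => hl.W_busy (by omega)
        · simp
        · exact fun _ _ => ⟨hcfg, hT⟩
        · simp
        · exact fun _ => hl.is_data (by omega)
        · exact hl.arr_le
        · simp
        · exact fun _ => hl.arr_busy (by omega)
        · simp
      · rw [hj i hij]
        exact h.loc i
    · intro i m hm hp
      by_cases hij : i = j
      · subst hij
        simp only [Function.update_self] at hp
        refine h.bar i m hm ?_
        rcases hp with hp | ⟨hp, _⟩
        · exact Or.inl hp
        · exact Or.inr ⟨hp, by omega⟩
      · rw [hj i hij] at hp
        exact h.bar i m hm hp
    · intro m hm hmn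
      exact h.bar j m hm (by unfold SLoc.PastBarrier; omega)
    · intro i g hg hp
      by_cases hij : i = j
      · subst hij
        simp only [Function.update_self] at hp
        rcases hp with hp | ⟨hp, _⟩ <;> dsimp only at hp <;> omega
      · rw [hj i hij] at hp
        have := h.passed i g hg hp
        omega
    · intro i hi
      rw [hpos]
      have := r7 i (hi.elim id (hbusy i))
      omega
    -- Nobody can be beyond item `n`, since that would mean having passed a change that had not been
    -- carried out.
    · intro m i hm hA hmi
      rw [hpos] at hmi
      have := h.passed i n hC (Or.inl (by omega))
      omega
    · intro i hi
      rw [hpos]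
      have := (h.upper i hi).1
      exact ⟨by omega, fun h' => absurd (hbusy i h') hi⟩
    · intro i hi
      exact ⟨n, by omega, r2 ▸ hbusy i hi⟩
    · refine .adding j n rfl hsub r2 ?_ ?_ ?_ ?_ ?_ ?_ <;> dsimp only
      · rw [r3, hcfg, hT.ON_eq, Finset.union_sdiff_of_subset hsub]
      · simp
      · exact hpos j
      · intro i hi
        by_contra hij
        rw [hj i hij] at hi
        exact (r4 i).1 hi
      · intro i
        by_cases hij : i = j
        · subst hij; simp
        · rw [hj i hij]
          exact (r4 i).2
      · intro i hi
        have := (h.upper i hi).1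
        rw [hpos]
        refine ⟨?_, by omega⟩
        by_contra h'
        exact hi (hbusy i h')
  | addSourcesFalse h1 h2 =>
    obtain ⟨hcfg, hT⟩ := hl.cfg_pre (by omega) (by omega)
    refine ⟨N, h.setStage (by omega) (by omega) (by omega) (by omega) (by omega) (by omega)
      (h.bar j _ hT (Or.inr ⟨rfl, by omega⟩)) fun hC hp => ?_⟩
    -- Moving on after a failed test passes a provisioning change. If nobody had carried it out,
    -- `SInv.ready` would make the test succeed.
    by_contra hcon
    obtain ⟨r1, r2, r3, r4, r5, r6, r7⟩ := h.ready (by omega) (by omega) hC (by omega)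
    refine h2 ⟨?_, ?_, ?_⟩
    · rw [hcfg, hT.card_lt_iff hinit hctl]
      exact ⟨hC, (hp.resolve_left (by omega)).2⟩
    · rwa [r3, ← r2]
    · rw [r3, hcfg]
      exact Finset.sdiff_disjoint
  | addReaders h1 =>
    obtain ⟨hcfg, hT⟩ := hl.cfg_pre (by omega) (by omega)
    rw [hcfg, hT.ON_eq]
    set n := (a.loc j).pos with hn
    -- Stage `3` occurs in the phase `adding` only, and there for a single instance.
    obtain ⟨hsub, hN, hrd, hsrc, hno3, hno5, hnew⟩ : (cfgAt c₀ inp n).O ⊆ (cfgAt c₀ inp (n + 1)).O ∧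
        N = n + 1 ∧ a.readers = (cfgAt c₀ inp n).O ∧ a.sources = (cfgAt c₀ inp (n + 1)).O ∧
        (∀ i, (a.loc i).st = 3 → i = j) ∧ (∀ i, (a.loc i).st ≠ 5) ∧
        (∀ i, i ∉ a.readers → (a.loc i).st = 0 ∧ (a.loc i).pos < n) := by
      rcases h.phase with ⟨_, _, h4⟩ | ⟨r, g, h0, h1', h2, h4, h6, h7, h8, h9, h10⟩ |
        ⟨r, g, h0, _, h2, h4, h6, h7, h8, h9⟩
      · exact absurd h1 (h4 j).1
      · obtain rfl := h8 j h1
        obtain rfl : n = g := h7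
        exact ⟨h1', h0, h2, h4, h8, h9, h10⟩
      · exact absurd h1 (h9 j)
    have hjr : j ∈ a.readers := by
      by_contra hj
      have := (hnew j hj).1
      omega
    have hun : a.readers ∪ (cfgAt c₀ inp (n + 1)).O \ (cfgAt c₀ inp n).O =
        (cfgAt c₀ inp (n + 1)).O := by
      rw [hrd, Finset.union_sdiff_of_subset hsub]
    have hbar : ∀ m, Triggers c₀ inp m → m ≤ n → ∀ k ∈ (cfgAt c₀ inp m).O, m < a.arrived k :=
      fun m hm hmn => h.bar j m hm (by unfold SLoc.PastBarrier; omega)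
    rw [hun]
    set loc' : ι → SLoc K ι := fun i =>
      if i = j then ⟨(a.loc j).W, cfgAt c₀ inp n, n, 4⟩
      else if i ∈ ((cfgAt c₀ inp (n + 1)).O \ (cfgAt c₀ inp n).O) \ a.readers then
        ⟨(a.loc i).W, cfgAt c₀ inp n, n, (a.loc i).st⟩
      else a.loc i with hloc'
    have hj : loc' j = ⟨(a.loc j).W, cfgAt c₀ inp n, n, 4⟩ := by simp [loc']
    -- Every other instance is left as it is, or is an idle one that is being added and handed the
    -- item and the epoch variables of `j`.
    have hcase : ∀ i, i ≠ j → loc' i = a.loc i ∧ (i ∈ a.readers ∨ i ∉ (cfgAt c₀ inp (n + 1)).O) ∨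
        i ∈ (cfgAt c₀ inp (n + 1)).O ∧ i ∉ a.readers ∧
        loc' i = ⟨(a.loc i).W, cfgAt c₀ inp n, n, 0⟩ := by
      intro i hi
      by_cases hr : i ∈ a.readers
      · simp [loc', hi, hr]
      · have h0 := (hnew i hr).1
        have hr' := hr
        rw [hrd] at hr
        by_cases hm : i ∈ (cfgAt c₀ inp (n + 1)).O <;> simp [loc', hi, hr, hm, h0, hr']
    have hst : ∀ i, i ≠ j → (loc' i).st = (a.loc i).st := by
      intro i hi
      simp only [loc', hi, if_false]
      split <;> rfl
    refine ⟨N, ?_⟩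
    refine ⟨?_, ?_, h.barN, h.last, ?_, ?_, ?_, ?_, ?_, ?_⟩
    · intro i
      dsimp only
      by_cases hi : i = j
      · subst hi
        rw [hj]
        refine ⟨?_, ?_, ?_, ?_, ?_, ?_, ?_, ?_, ?_, ?_, ?_⟩ <;> dsimp only
        · simp
        · simp
        · exact fun _ => hl.W_busy (by omega)
        · simp
        · exact fun _ _ => ⟨rfl, hT⟩
        · simp
        · exact fun _ => hl.is_data (by omega)
        · exact hl.arr_le
        · simp
        · exact fun _ => hl.arr_busy (by omega)
        · simp
      · rcases hcase i hi with ⟨he, hm⟩ | ⟨hm, hm', he⟩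
        · rw [he]
          exact (h.loc i).mono fun hi' => hm.resolve_right fun h' => h' hi'
        · rw [he]
          obtain ⟨h0, hlt⟩ := hnew i hm'
          have hli := h.loc i
          refine ⟨?_, ?_, ?_, ?_, ?_, ?_, ?_, ?_, ?_, ?_, ?_⟩ <;> dsimp only
          · exact fun _ => (hli.W_le h0).trans (wmAt_mono hlt.le)
          -- A possibly stale watermark is admissible here because item `n` triggers.
          · exact fun _ _ => Or.inr hT
          · simp
          · exact fun _ _ => rfl
          · simp
          · simp
          · simp
          · have := hli.arr_le; omega
          · have := hli.arr_le; omega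
          · simp
          · simp
    · intro i m hm hp
      dsimp only at hp ⊢
      by_cases hi : i = j
      · subst hi
        rw [hj] at hp
        refine hbar m hm ?_
        unfold SLoc.PastBarrier at hp
        dsimp only at hp
        omega
      · rcases hcase i hi with ⟨he, _⟩ | ⟨hm', hm'', he⟩
        · rw [he] at hp
          exact h.bar i m hm hp
        · rw [he] at hp
          refine hbar m hm ?_
          unfold SLoc.PastBarrier at hp
          dsimp only at hp
          omega
    · intro i g hg hp
      dsimp only at hp
      by_cases hi : i = j
      · subst hi
        rw [hj] at hp
        unfold SLoc.PastChange at hp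
        dsimp only at hp
        omega
      · rcases hcase i hi with ⟨he, _⟩ | ⟨hm', hm'', he⟩
        · rw [he] at hp
          exact h.passed i g hg hp
        · rw [he] at hp
          unfold SLoc.PastChange at hp
          dsimp only at hp
          omega
    · intro i hi'
      dsimp only at hi' ⊢
      by_cases hi : i = j
      · subst hi
        rw [hj]
        exact hN.le
      · rcases hcase i hi with ⟨he, h'⟩ | ⟨hm', hm'', he⟩
        · rw [he] at hi' ⊢
          exact h.lower i (hi'.imp_left fun h'' => h'.resolve_right fun h3 => h3 h'')
        · rw [he]
          exact hN.le
    · intro m i hm hA hmi i' hi'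
      dsimp only at hmi hi' ⊢
      have hr' : i' ∉ a.readers := fun h' => hi' (hsub (hrd ▸ h'))
      have hij' : i' ≠ j := fun h' => hr' (h' ▸ hjr)
      rw [hst i' hij']
      exact (hnew i' hr').1
    · intro i hi'
      dsimp only at hi' ⊢
      have hr' : i ∉ a.readers := fun h' => hi' (hsub (hrd ▸ h'))
      have hij' : i ≠ j := fun h' => hr' (h' ▸ hjr)
      rcases hcase i hij' with ⟨he, _⟩ | ⟨hm', _⟩
      · rw [he]
        exact h.upper i hr'
      · exact absurd hm' hi'
    · intro i hi'
      dsimp only at hi'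
      by_cases hi : i = j
      · subst hi
        exact h.readers_touched hjr
      · rw [hst i hi] at hi'
        exact h.touched i hi'
    · refine .stable ?_ ?_ ?_ <;> dsimp only
      · rw [hN]
      · rw [hN, hsrc]
      · intro i
        by_cases hi : i = j
        · subst hi
          rw [hj]
          simp
        · rw [hst i hi]
          exact ⟨fun h' => hi (hno3 i h'), hno5 i⟩
  | removeReadersTrue h1 h2 h3 h4 =>
    obtain ⟨hcfg, hT⟩ := hl.cfg_pre (by omega) (by omega)
    rw [hcfg] at h2 h4
    obtain ⟨hC, hsub⟩ := (hT.lt_card_iff hinit hctl).1 h2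
    set n := (a.loc j).pos with hn
    rw [hT.ON_eq] at h4
    -- Had somebody else carried out this change, the instances to be removed would no longer be
    -- readers, and the inclusion test would fail.
    have hNn : N ≤ n := by
      by_contra hcon
      have hN : N = n + 1 := by
        have := h.lower j (Or.inr (by omega))
        omega
      have hsrc : a.readers ⊆ (cfgAt c₀ inp (n + 1)).O := by
        rcases h.phase with ⟨h1, _⟩ | ⟨r, g, h0, hs, _⟩ | ⟨r, g, h0, hs, h1, _⟩
        · rw [h1, hN]
        · obtain rfl : n = g := by omega
          exact absurd hs fun hs => hC.not_both hs hsub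
        · rw [h1, ← h0, hN]
      have hemp : (cfgAt c₀ inp n).O ⊆ (cfgAt c₀ inp (n + 1)).O := by
        intro i hi
        by_contra hi'
        exact hi' (hsrc (h4 (Finset.mem_sdiff.2 ⟨hi, hi'⟩)))
      exact hC.not_both hemp hsub
    obtain ⟨r1, r2, r3, r4, r5, r6, r7⟩ := h.ready (by omega) (by omega) hC hNn
    rw [← hn] at *
    refine ⟨n + 1, ?_⟩
    have hrd : a.readers \ ((a.loc j).cfg.O \ (a.loc j).cfg.ON) = (cfgAt c₀ inp (n + 1)).O := by
      rw [r2, hcfg, hT.ON_eq, Finset.sdiff_sdiff_eq_self hsub]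
    rw [hrd]
    have hrsub : (cfgAt c₀ inp (n + 1)).O ⊆ a.readers := r2 ▸ hsub
    have hj : ∀ i, i ≠ j → Function.update a.loc j { a.loc j with st := 5 } i = a.loc i :=
      fun i hi => Function.update_of_ne hi _ _
    have hb : ∀ k ∈ (cfgAt c₀ inp n).O, n < a.arrived k :=
      h.bar j n hT (Or.inr ⟨hn, by omega⟩)
    have hbusy : ∀ i, (Function.update a.loc j { a.loc j with st := 5 } i).st ≠ 0 →
        i ∈ a.readers := by
      intro i hi
      by_cases hij : i = j
      · rwa [hij]
      · rw [hj i hij] at hi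
        by_contra hr
        exact hi (r5 i hr)
    have hpos : ∀ i, (Function.update a.loc j { a.loc j with st := 5 } i).pos = (a.loc i).pos := by
      intro i
      by_cases hij : i = j
      · subst hij; simp
      · rw [hj i hij]
    -- An instance beyond item `n` would have passed a change that nobody had carried out.
    have hle : ∀ i, (a.loc i).pos ≤ n := fun i => by
      by_contra hcon
      have := h.passed i n hC (Or.inl (by omega))
      omega
    refine ⟨?_, ?_, ?_, Or.inr ⟨n, rfl, hC⟩, ?_, ?_, ?_, ?_, ?_, ?_⟩ <;> simp only [Skel.setLoc]
    · intro i
      by_cases hij : i = j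
      · subst hij
        simp only [Function.update_self]
        refine ⟨?_, ?_, ?_, ?_, ?_, ?_, ?_, ?_, ?_, ?_, ?_⟩ <;> dsimp only
        · simp
        · simp
        · exact fun _ => hl.W_busy (by omega)
        · simp
        · exact fun _ _ => ⟨hcfg, hT⟩
        · simp
        · exact fun _ => hl.is_data (by omega)
        · exact hl.arr_le
        · simp
        · exact fun _ => hl.arr_busy (by omega)
        · simp
      · rw [hj i hij]
        exact (h.loc i).mono fun h' => hrsub h'
    · intro i m hm hp
      by_cases hij : i = j
      · subst hij
        simp only [Function.update_self] at hp
        refine h.bar i m hm ?_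
        rcases hp with hp | ⟨hp, _⟩
        · exact Or.inl hp
        · exact Or.inr ⟨hp, by omega⟩
      · rw [hj i hij] at hp
        exact h.bar i m hm hp
    · intro m hm hmn
      exact h.bar j m hm (by unfold SLoc.PastBarrier; omega)
    · intro i g hg hp
      have := hle i
      unfold SLoc.PastChange at hp
      rw [hpos] at hp
      omega
    · intro i hi
      rw [hpos]
      have := r7 i (hi.elim (fun h' => hrsub h') (hbusy i))
      omega
    · intro m i hm hA hmi
      rw [hpos] at hmi
      have := hle i
      omega
    · intro i hi
      rw [hpos]
      have := hle i
      exact ⟨by omega, fun h' => by omega⟩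
    · intro i hi
      exact ⟨n, by omega, r2 ▸ hbusy i hi⟩
    · refine .removing j n rfl hsub rfl r3 ?_ ?_ ?_ ?_ <;> dsimp only
      · simp
      · exact hpos j
      · intro i hi
        by_contra hij
        rw [hj i hij] at hi
        exact (r4 i).2 hi
      · intro i
        by_cases hij : i = j
        · subst hij; simp
        · rw [hj i hij]
          exact (r4 i).1
  | removeReadersFalse h1 h2 =>
    obtain ⟨hcfg, hT⟩ := hl.cfg_pre (by omega) (by omega)
    refine ⟨N, h.setStage (by omega) (by omega) (by omega) (by omega) (by omega) (by omega)
      (h.bar j _ hT (Or.inr ⟨rfl, by omega⟩)) fun hC hp => ?_⟩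
    -- At stage `4` a provisioning change has already been passed, so that only a decommissioning
    -- one is at stake.
    by_cases hsub : (cfgAt c₀ inp (a.loc j).pos).O ⊆ (cfgAt c₀ inp ((a.loc j).pos + 1)).O
    · exact h.passed j _ hC (Or.inr ⟨rfl, Or.inr ⟨by omega, hsub⟩⟩)
    by_contra hcon
    obtain ⟨r1, r2, r3, r4, r5, r6, r7⟩ := h.ready (by omega) (by omega) hC (by omega)
    refine h2 ⟨?_, r6, ?_⟩
    · rw [hcfg, hT.lt_card_iff hinit hctl]
      exact ⟨hC, (hC.subset_or hinit hctl).resolve_left hsub⟩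
    · rw [r2, hcfg]
      exact Finset.sdiff_subset
  | removeSources h1 =>
    obtain ⟨hcfg, hT⟩ := hl.cfg_pre (by omega) (by omega)
    rw [hcfg, hT.ON_eq]
    set n := (a.loc j).pos with hn
    obtain ⟨hsub, hN, hrd, hsrc, hno5, hno3⟩ : (cfgAt c₀ inp (n + 1)).O ⊆ (cfgAt c₀ inp n).O ∧
        N = n + 1 ∧ a.readers = (cfgAt c₀ inp (n + 1)).O ∧ a.sources = (cfgAt c₀ inp n).O ∧
        (∀ i, (a.loc i).st = 5 → i = j) ∧ (∀ i, (a.loc i).st ≠ 3) := by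
      rcases h.phase with ⟨_, _, h4⟩ | ⟨r, g, h0, h1', h2, h4, h6, h7, h8, h9, h10⟩ |
        ⟨r, g, h0, h1', h2, h4, h6, h7, h8, h9⟩
      · exact absurd h1 (h4 j).2
      · exact absurd h1 (h9 j)
      · obtain rfl := h8 j h1
        obtain rfl : n = g := h7
        exact ⟨h1', h0, h2, h4, h8, h9⟩
    refine ⟨N, ?_⟩
    have := h.setLoc_of_phase (j := j) (L := { a.loc j with st := 6 }) (ar := a.arrived j)
      (src := a.sources \ ((cfgAt c₀ inp n).O \ (cfgAt c₀ inp (n + 1)).O))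
      (Or.inr (by omega)) (Or.inl rfl) ?_ le_rfl ?_ ?_ ?_ ?_
    · simp only [Function.update_eq_self] at this
      exact this
    · refine ⟨?_, ?_, ?_, ?_, ?_, ?_, ?_, ?_, ?_, ?_, ?_⟩ <;> dsimp only
      · simp
      · simp
      · exact fun _ => hl.W_busy (by omega)
      · simp
      · exact fun _ _ => ⟨hcfg, hT⟩
      · simp
      · exact fun _ => hl.is_data (by omega)
      · exact hl.arr_le
      · simp
      · exact fun _ => hl.arr_busy (by omega)
      · simp
    · refine .stable ?_ ?_ ?_ <;> dsimp only
      · rw [hrd, hN]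
      · rw [hsrc, hN, Finset.sdiff_sdiff_eq_self hsub]
      · intro i
        by_cases hi : i = j
        · subst hi
          simp
        · rw [Function.update_of_ne hi]
          exact ⟨hno3 i, fun h' => hi (hno5 i h')⟩
    · rintro m hm (hp | ⟨rfl, hp⟩) hnp i hi
      · exact absurd (Or.inl hp) hnp
      · exact absurd (Or.inr ⟨rfl, by omega⟩) hnp
    · rintro g hg (hp | ⟨rfl, hp⟩) hnp
      · exact absurd (Or.inl hp) hnp
      · exact absurd (Or.inr ⟨rfl, by omega⟩) hnp
    · exact fun m _ _ hm => Or.inl hm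
  | switch h1 =>
    refine ⟨N, ?_⟩
    obtain ⟨hcfg, hT⟩ := hl.cfg_pre (by omega) (by omega)
    rw [← Skel.setLoc_arrived]
    refine h.setLoc (Or.inr (by omega)) (Or.inl rfl) ?_ le_rfl (by simp) (by omega) ?_ ?_ ?_
    · refine ⟨?_, ?_, ?_, ?_, ?_, ?_, ?_, ?_, ?_, ?_, ?_⟩ <;> dsimp only
      · simp
      · simp
      · exact fun _ => hl.W_busy (by omega)
      · simp
      · simp
      · intro _
        rw [cfgAt_triggers hT, hcfg]
      · exact fun _ => hl.is_data (by omega)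
      · exact hl.arr_le
      · simp
      · exact fun _ => hl.arr_busy (by omega)
      · simp
    · rintro n hn (hp | ⟨rfl, hp⟩) hnp i hi
      · exact absurd (Or.inl hp) hnp
      · exact absurd (Or.inr ⟨rfl, by omega⟩) hnp
    · rintro g hg (hp | ⟨rfl, hp⟩) hnp
      · exact absurd (Or.inl hp) hnp
      · exact absurd (Or.inr ⟨rfl, by omega⟩) hnp
    · exact fun m _ _ hm => Or.inl hm
  | done h1 =>
    refine ⟨N, ?_⟩
    obtain ⟨t, ht⟩ := hl.is_data (by omega)
    rw [← Skel.setLoc_arrived]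
    refine h.setLoc (Or.inr (by omega)) (Or.inr ⟨rfl, rfl⟩) ?_ le_rfl (by simp) (by omega) ?_ ?_ ?_
    · refine ⟨?_, ?_, ?_, ?_, ?_, ?_, ?_, ?_, ?_, ?_, ?_⟩ <;> dsimp only
      · exact fun _ => (hl.W_busy (by omega)).le
      · exact fun _ _ => Or.inl (hl.W_busy (by omega))
      · simp
      · exact fun _ _ => hl.cfg_post h1
      · simp
      · simp
      · simp
      · have := hl.arr_le; omega
      · exact fun _ => hl.arr_le
      · simp
      · simp
    · rintro n hn (hp | ⟨rfl, hp⟩) hnp i hi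
      · dsimp only at hp
        rcases Nat.lt_succ_iff_lt_or_eq.1 hp with hp | rfl
        · exact absurd (Or.inl hp) hnp
        · exact absurd (Or.inr ⟨rfl, by omega⟩) hnp
      · simp at hp
    · rintro g hg (hp | ⟨rfl, hp⟩) hnp
      · dsimp only at hp
        rcases Nat.lt_succ_iff_lt_or_eq.1 hp with hp | rfl
        · exact absurd (Or.inl hp) hnp
        · exact absurd (Or.inr ⟨rfl, by omega⟩) hnp
      · simp at hp
    · intro m _ hA hm
      dsimp only at hm
      rcases Nat.lt_succ_iff_lt_or_eq.1 hm with hm | rfl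
      · exact Or.inl hm
      · obtain ⟨c', hc', hA⟩ := hA
        rw [ht] at hc'
        cases hc'

end SkeletonInvariant

/-! ## Consequences of the skeleton invariant -/

section SkeletonFacts

variable {I : ℕ} {K P ι : Type*} [DecidableEq ι] {c₀ : Ctl K ι} {inp : ℕ → Item I P K ι}
  {a a' : Skel K ι} {N : ℕ} {j : ι}

/-- Cursors never move backwards. An instance other than the acting one only moves when it is
connected. -/
theorem SInv.pos_mono (h : SInv c₀ inp a N) (hs : SStep inp j a a') (i : ι) :
    (a.loc i).pos ≤ (a'.loc i).pos := by
  have key : ∀ L : SLoc K ι, (a.loc j).pos ≤ L.pos →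
      (a.loc i).pos ≤ (Function.update a.loc j L i).pos := by
    intro L hL
    by_cases hi : i = j
    · subst hi; simpa using hL
    · simp [hi]
  cases hs with
  | addReaders h1 =>
    dsimp only
    split
    · rename_i hi; rw [hi]
    split
    · rename_i hi
      have hi := (Finset.mem_sdiff.1 hi).2
      rcases h.phase with ⟨_, _, h4⟩ | ⟨r, g, h0, _, h2, h4, h6, h7, h8, h9, h10⟩ |
        ⟨r, g, h0, _, h2, h4, h6, h7, h8, h9⟩
      · exact absurd h1 (h4 j).1
      · obtain rfl := h8 j h1
        rw [h7]
        exact (h10 i hi).2.le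
      · exact absurd h1 (h9 j)
    · exact le_rfl
  | _ => exact key _ (by simp)

theorem SInv.arrived_mono (h : SInv c₀ inp a N) (hs : SStep inp j a a') (i : ι) :
    a.arrived i ≤ a'.arrived i := by
  cases hs with
  | trigger =>
    dsimp only
    by_cases hi : i = j
    · subst hi
      simpa using (h.loc i).arr_le
    · simp [hi]
  | _ => exact le_rfl

/-- Only the acting instance moves, except for idle instances that are not connected. -/
theorem SStep.loc_eq (hs : SStep inp j a a') {i : ι} (hi : i ≠ j) (hr : i ∈ a.readers) :
    a'.loc i = a.loc i := by
  cases hs <;> simp [Skel.setLoc, hi, hr]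

theorem SStep.st_eq (hs : SStep inp j a a') {i : ι} (hi : i ≠ j) :
    (a'.loc i).st = (a.loc i).st := by
  cases hs with
  | addReaders =>
    dsimp only
    rw [if_neg hi]
    split <;> rfl
  | _ => simp [Skel.setLoc, hi]

theorem SInv.loc_eq_of_busy (h : SInv c₀ inp a N) (hs : SStep inp j a a') {i : ι} (hi : i ≠ j)
    (hb : (a.loc i).st ≠ 0) : a'.loc i = a.loc i := by
  by_cases hr : i ∈ a.readers
  · exact hs.loc_eq hi hr
  cases hs with
  | addReaders h1 =>
    exfalso
    rcases h.phase with ⟨_, _, h4⟩ | ⟨r, g, h0, _, h2, h4, h6, h7, h8, h9, h10⟩ |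
        ⟨r, g, h0, _, h2, h4, h6, h7, h8, h9⟩
    · exact absurd h1 (h4 j).1
    · exact hb (h10 i hr).1
    · exact absurd h1 (h9 j)
  | _ => simp [Skel.setLoc, hi]

/-- An instance that has passed all changes before item `n` witnesses that they were carried out, so
none of them lies between `N` and `n`. -/
theorem SInv.O_eq (h : SInv c₀ inp a N) {i : ι} {n : ℕ} (hN : N ≤ n)
    (hp : ∀ g, Changes c₀ inp g → g < n → (a.loc i).PastChange c₀ inp g) :
    (cfgAt c₀ inp n).O = (cfgAt c₀ inp N).O :=
  O_eq_of_not_changes hN fun g h1 h2 h3 => absurd (h.passed i g h3 (hp g h3 h2)) (by omega)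

/-- An instance that processes a tuple and belongs to the current epoch is connected. -/
theorem SInv.connected (h : SInv c₀ inp a N) (h7 : (a.loc j).st = 7)
    (hj : j ∈ (cfgAt c₀ inp ((a.loc j).pos + 1)).O) : j ∈ a.readers ∧ j ∈ a.sources := by
  have hO := h.O_eq (i := j) (h.lower j (Or.inr (by omega))) fun g _ hg => by
    unfold SLoc.PastChange; omega
  rw [hO] at hj
  rcases h.phase with ⟨h1, h2, h4⟩ | ⟨r, g, h0, h1, h2, h4, h6, h7, h8, h9, h10⟩ |
      ⟨r, g, h0, h1, h2, h4, h6, h7, h8, h9⟩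
  · rw [h1, h2]
    exact ⟨hj, hj⟩
  · refine ⟨?_, by rwa [h4, ← h0]⟩
    by_contra hr
    have := (h10 j hr).1
    omega
  · rw [h2, h4, ← h0]
    refine ⟨hj, ?_⟩
    rw [h0] at hj
    exact h1 hj

/-- While a member of the epoch after `n` items has not arrived at item `n`, no later change has been
carried out. -/
theorem SInv.le_of_mem (h : SInv c₀ inp a N) {n : ℕ} (hj : j ∈ (cfgAt c₀ inp n).O)
    (harr : a.arrived j ≤ n) : N ≤ n := by
  by_contra hcon
  rcases h.last with h0 | ⟨g, rfl, hg⟩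
  · omega
  obtain ⟨g', h1, h2, h3, h4⟩ := exists_first_change (by omega : n ≤ g) hg
  have := h.barN g' h3.triggers (by omega) j (h4 ▸ hj)
  omega

/-- An idle member of the epoch at its cursor holds back all later changes and has passed all
earlier ones, so its epoch is the one to which the buffers are being adapted. In the phase `adding`,
an instance that is not yet a reader would stand before `g`. -/
theorem SInv.idle_at (h : SInv c₀ inp a N) (hj : j ∈ (cfgAt c₀ inp (a.loc j).pos).O)
    (h0 : (a.loc j).st = 0) :
    N ≤ (a.loc j).pos ∧ (cfgAt c₀ inp (a.loc j).pos).O = (cfgAt c₀ inp N).O ∧ j ∈ a.readers := by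
  have hN := h.le_of_mem hj ((h.loc j).arr_idle h0)
  have hO := h.O_eq (i := j) hN fun g _ hg => Or.inl hg
  refine ⟨hN, hO, ?_⟩
  rw [hO] at hj
  rcases h.phase with ⟨h1, h2, h4⟩ | ⟨r, g, h0, h1, h2, h4, h6, h7, h8, h9, h10⟩ |
      ⟨r, g, h0, h1, h2, h4, h6, h7, h8, h9⟩
  · rwa [h1]
  · by_contra hr
    have := (h10 j hr).2
    omega
  · rwa [h2, ← h0]

theorem SInv.readers_subset (h : SInv c₀ inp a N) : a.readers ⊆ (cfgAt c₀ inp N).O := by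
  rcases h.phase with ⟨h1, h2, h4⟩ | ⟨r, g, h0, h1, h2, h4, h6, h7, h8, h9, h10⟩ |
      ⟨r, g, h0, h1, h2, h4, h6, h7, h8, h9⟩
  · rw [h1]
  · rwa [h2, h0]
  · rw [h2, h0]

theorem SInv.subset_sources (h : SInv c₀ inp a N) : (cfgAt c₀ inp N).O ⊆ a.sources := by
  rcases h.phase with ⟨h1, h2, h4⟩ | ⟨r, g, h0, h1, h2, h4, h6, h7, h8, h9, h10⟩ |
      ⟨r, g, h0, h1, h2, h4, h6, h7, h8, h9⟩
  · rw [h2]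
  · rw [h4, h0]
  · rwa [h4, h0]

/-- The instance responsible for `k` after `n` items has completed these items. -/
def Skel.Reached (c₀ : Ctl K ι) (inp : ℕ → Item I P K ι) (a : Skel K ι) (k : K) (n : ℕ) : Prop :=
  n ≤ (a.loc ((cfgAt c₀ inp n).f k)).pos

/-- Instance `i` has begun to process item `n`. -/
def SLoc.Started (L : SLoc K ι) (n : ℕ) : Prop := n < L.pos ∨ n = L.pos ∧ L.st = 7

/-- Instance `j` processes a tuple and is responsible for `k`. -/
def Skel.Active (c₀ : Ctl K ι) (inp : ℕ → Item I P K ι) (a : Skel K ι) (j : ι) (k : K) : Prop :=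
  (a.loc j).st = 7 ∧ (cfgAt c₀ inp ((a.loc j).pos + 1)).f k = j

/-! ### Succession of the instances on one key -/

section
variable (hinit : c₀.Valid) (hctl : ValidReconfigs c₀ inp)
include hinit hctl

/-- The mapping changes only at a triggering item, and there the barrier waits for all members of
the old epoch, the previous instance of `k` among them. -/
theorem SInv.reached_of_started (h : SInv c₀ inp a N) {k : K} {n : ℕ}
    (hs : (a.loc ((cfgAt c₀ inp (n + 1)).f k)).Started n) : a.Reached c₀ inp k n := by
  unfold Skel.Reached
  by_cases hT : Triggers c₀ inp n
  · have := h.bar ((cfgAt c₀ inp (n + 1)).f k) n hT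
      (by unfold SLoc.PastBarrier SLoc.Started at *; omega) _
      ((cfgAt_valid hinit hctl n).2.1 k)
    have := (h.loc ((cfgAt c₀ inp n).f k)).arr_le
    omega
  · rw [(cfgAt_not_triggers hT).2.2] at hs
    unfold SLoc.Started at hs
    omega

theorem SInv.reached_of_le (h : SInv c₀ inp a N) {k : K} {m n : ℕ} (hmn : m ≤ n)
    (hn : a.Reached c₀ inp k n) : a.Reached c₀ inp k m := by
  induction n, hmn using Nat.le_induction with
  | base => exact hn
  | succ n _ ih => exact ih (h.reached_of_started hinit hctl (Or.inl hn))

/-- Completion advances item by item, so it is not ahead of an active instance, and everything up to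
the item of that instance has been started. -/
theorem SInv.active_of_not_started (h : SInv c₀ inp a N) {k : K} {n : ℕ}
    (hj : a.Active c₀ inp j k) (hr : a.Reached c₀ inp k n) :
    (a.loc ((cfgAt c₀ inp (n + 1)).f k)).Started n := by
  obtain ⟨h7, hj⟩ := hj
  rcases lt_trichotomy n (a.loc j).pos with hlt | rfl | hlt
  · have h1 : a.Reached c₀ inp k (a.loc j).pos :=
      h.reached_of_started hinit hctl (by rw [hj]; exact Or.inr ⟨rfl, h7⟩)
    exact Or.inl (h.reached_of_le hinit hctl hlt h1)
  · rw [hj]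
    exact Or.inr ⟨rfl, h7⟩
  · have := h.reached_of_le hinit hctl hlt hr
    unfold Skel.Reached at this
    rw [hj] at this
    omega

/-- If `j` were ahead of `i`, the instance responsible after the item of `i` would have completed
that item; but this is `i` itself, which is still busy with it. -/
theorem SInv.active_pos_le (h : SInv c₀ inp a N) {i : ι} {k : K}
    (hi : a.Active c₀ inp i k) (hj : a.Active c₀ inp j k) : (a.loc j).pos ≤ (a.loc i).pos := by
  by_contra hlt
  have h1 : a.Reached c₀ inp k (a.loc j).pos :=
    h.reached_of_started hinit hctl (by rw [hj.2]; exact Or.inr ⟨rfl, hj.1⟩)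
  have := h.reached_of_le hinit hctl (by omega : (a.loc i).pos + 1 ≤ (a.loc j).pos) h1
  unfold Skel.Reached at this
  rw [hi.2] at this
  omega

/-- At any time at most one instance works on a key. -/
theorem SInv.active_unique (h : SInv c₀ inp a N) {i : ι} {k : K}
    (hi : a.Active c₀ inp i k) (hj : a.Active c₀ inp j k) : i = j := by
  have := le_antisymm (h.active_pos_le hinit hctl hi hj) (h.active_pos_le hinit hctl hj hi)
  rw [← hi.2, ← hj.2, this]

/-- When the instance responsible for `k` begins to process a tuple, the previous items have been
completed for `k`. -/
theorem SInv.reached_pos (h : SInv c₀ inp a N) {k : K} {n : ℕ} (hn : (a.loc j).pos = n)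
    (hj : (cfgAt c₀ inp (n + 1)).f k = j)
    (hT : Triggers c₀ inp n → 2 ≤ (a.loc j).st) : a.Reached c₀ inp k n := by
  unfold Skel.Reached
  by_cases hT' : Triggers c₀ inp n
  · have := h.bar j n hT' (Or.inr ⟨hn.symm, hT hT'⟩) _ ((cfgAt_valid hinit hctl n).2.1 k)
    have := (h.loc ((cfgAt c₀ inp n).f k)).arr_le
    omega
  · rw [← (cfgAt_not_triggers hT').2.2, hj, hn]

end

end SkeletonFacts

/-! ## The semantics of a single key -/

section KeySemantics

variable {I : ℕ} {K Z P Q : Type*} (op : Oper I K Z P Q)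

/-- The window sets of a key are ordered by their left boundaries, and there is at most one if the
sets slide. -/
def Oper.WF (ks : List (WSet I Z)) : Prop :=
  ks.Pairwise (fun v w => v.l < w.l) ∧ (op.WT = .single → ks.length ≤ 1)

variable {op}

/-! ### Ordered lists of window sets -/

theorem mem_insertSet {v w : WSet I Z} {ks : List (WSet I Z)} :
    v ∈ insertSet w ks ↔ v = w ∨ v ∈ ks := by
  induction ks with
  | nil => simp [insertSet]
  | cons u ks ih =>
    unfold insertSet
    split
    · simp
    · simp only [List.mem_cons, ih]
      tauto

theorem pairwise_insertSet {w : WSet I Z} {ks : List (WSet I Z)}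
    (h : ks.Pairwise (fun v w => v.l < w.l)) (hw : ∀ v ∈ ks, v.l ≠ w.l) :
    (insertSet w ks).Pairwise (fun v w => v.l < w.l) := by
  induction ks with
  | nil => simp [insertSet]
  | cons u ks ih =>
    rw [List.pairwise_cons] at h
    have hu := hw u (by simp)
    unfold insertSet
    split
    · refine List.pairwise_cons.2 ⟨?_, List.pairwise_cons.2 h⟩
      intro v hv
      rcases List.mem_cons.1 hv with rfl | hv
      · omega
      · have := h.1 v hv
        omega
    · refine List.pairwise_cons.2 ⟨?_, ih h.2 fun v hv => hw v (by simp [hv])⟩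
      intro v hv
      rcases mem_insertSet.1 hv with rfl | hv
      · omega
      · exact h.1 v hv

theorem Oper.WF.nil : op.WF [] := by simp [Oper.WF]

theorem Oper.WF.checkCreate {ks : List (WSet I Z)} (h : op.WF ks) (l : ℤ) :
    op.WF (op.checkCreate ks l) := by
  unfold Oper.checkCreate
  cases hT : op.WT with
  | single =>
    dsimp only
    split
    · simp [Oper.WF]
    · exact h
  | multi =>
    dsimp only
    split
    · exact h
    · rename_i hne
      exact ⟨pairwise_insertSet h.1 fun v hv hl => hne ⟨v, hv, hl⟩, by simp [hT]⟩

theorem Oper.mem_checkCreate {ks : List (WSet I Z)} {l : ℤ} {w : WSet I Z}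
    (h : w ∈ op.checkCreate ks l) : w ∈ ks ∨ w.l = l := by
  unfold Oper.checkCreate at h
  split at h <;> split at h
  · simp at h; simp [h]
  · exact Or.inl h
  · exact Or.inl h
  · rcases mem_insertSet.1 h with rfl | h
    · exact Or.inr rfl
    · exact Or.inl h

theorem Oper.map_l_setStates (ks : List (WSet I Z)) (l : ℤ) (ζ : Fin I → Z) :
    (op.setStates ks l ζ).map WSet.l = ks.map WSet.l := by
  unfold Oper.setStates
  split
  · cases ks <;> simp
  · rw [List.map_map]
    refine List.map_congr_left fun w _ => ?_
    simp only [Function.comp]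
    split <;> rfl

theorem Oper.WF_iff_map {ks ks' : List (WSet I Z)} (h : ks'.map WSet.l = ks.map WSet.l) :
    op.WF ks' ↔ op.WF ks := by
  have hl : ks'.length = ks.length := by simpa using congrArg List.length h
  have hp : ∀ ks : List (WSet I Z), ks.Pairwise (fun v w => v.l < w.l) ↔
      (ks.map WSet.l).Pairwise (· < ·) := fun ks => by rw [List.pairwise_map]
  rw [Oper.WF, Oper.WF, hl, hp, hp, h]

theorem Oper.WF.setStates {ks : List (WSet I Z)} (h : op.WF ks) (l : ℤ) (ζ : Fin I → Z) :
    op.WF (op.setStates ks l ζ) :=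
  (Oper.WF_iff_map (op.map_l_setStates ks l ζ)).2 h

theorem Oper.mem_setStates {ks : List (WSet I Z)} {l : ℤ} {ζ : Fin I → Z} {w : WSet I Z}
    (h : w ∈ op.setStates ks l ζ) : ∃ v ∈ ks, w.l = v.l := by
  have : w.l ∈ (op.setStates ks l ζ).map WSet.l := List.mem_map_of_mem h
  rw [op.map_l_setStates] at this
  obtain ⟨v, hv, hl⟩ := List.mem_map.1 this
  exact ⟨v, hv, hl.symm⟩

theorem Oper.WF.shiftFirst {ks : List (WSet I Z)} (h : op.WF ks) (k : K) (w : WSet I Z) :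
    op.WF (op.shiftFirst k w ks) := by
  have htail : op.WF ks.tail := ⟨h.1.sublist (List.tail_sublist _), fun hs => by
    have := h.2 hs
    simp only [List.length_tail]
    omega⟩
  unfold Oper.shiftFirst
  cases hT : op.WT with
  | multi => exact htail
  | single =>
    dsimp only
    split
    · have h1 := h.2 hT
      have : ks.tail = [] := List.eq_nil_of_length_eq_zero (by simp only [List.length_tail]; omega)
      rw [this]
      simp [insertSet, Oper.WF]
    · exact htail

theorem Oper.mem_shiftFirst {ks : List (WSet I Z)} {k : K} {v w : WSet I Z}
    (hv : v ∈ op.shiftFirst k w ks) : v ∈ ks.tail ∨ v.l = w.l + op.WA := by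
  unfold Oper.shiftFirst at hv
  split at hv
  · exact Or.inl hv
  · split at hv
    · rcases mem_insertSet.1 hv with rfl | hv
      · exact Or.inr rfl
      · exact Or.inl hv
    · exact Or.inl hv

/-- After the first set, which started at `ρ`, has been shifted, no set starts at `ρ`. -/
theorem Oper.WF.ne_of_mem_shiftFirst (hWA : 0 < op.WA) {ks : List (WSet I Z)} (h : op.WF ks) {k : K}
    {w : WSet I Z} (hw : ks.head? = some w) {v : WSet I Z} (hv : v ∈ op.shiftFirst k w ks) :
    w.l < v.l := by
  rcases op.mem_shiftFirst hv with hm | hm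
  · cases ks with
    | nil => simp at hw
    | cons u ks =>
      simp only [List.head?_cons, Option.some.injEq] at hw
      subst hw
      exact (List.pairwise_cons.1 h.1).1 v hm
  · omega

/-- This keeps an instance from getting stuck when it reads the set after `check&Create`. -/
theorem Oper.isSome_lookup_checkCreate (ks : List (WSet I Z)) (l : ℤ) :
    (op.lookup (op.checkCreate ks l) l).isSome := by
  unfold Oper.lookup Oper.checkCreate
  cases op.WT with
  | single =>
    dsimp only
    split
    · simp
    · cases ks <;> simp_all
  | multi =>
    dsimp only
    rw [List.find?_isSome]
    split
    · simpa using ‹∃ w ∈ ks, w.l = l›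
    · exact ⟨⟨l, fun _ => op.empty⟩, mem_insertSet.2 (Or.inl rfl), by simp⟩

/-! ### The expiration loop for one key -/

theorem Oper.forwardAndShift_of_head {k : K} {ρ : ℤ} {x : List (WSet I Z) × List (OutTup Q)}
    {w : WSet I Z} (hw : x.1.head? = some w) (hl : w.l = ρ) :
    op.forwardAndShift k ρ x =
      (op.shiftFirst k w x.1, x.2 ++ op.prepareOutTuples w.l (op.fO (w.insts k))) := by
  unfold Oper.forwardAndShift
  obtain ⟨ks, o⟩ := x
  cases ks with
  | nil => simp at hw
  | cons v ks =>
    simp only [List.head?_cons, Option.some.injEq] at hw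
    subst hw
    simp [hl]

theorem Oper.forwardAndShift_of_ne {k : K} {ρ : ℤ} {x : List (WSet I Z) × List (OutTup Q)}
    (h : ∀ w, x.1.head? = some w → w.l ≠ ρ) : op.forwardAndShift k ρ x = x := by
  unfold Oper.forwardAndShift
  obtain ⟨ks, o⟩ := x
  cases ks with
  | nil => rfl
  | cons v ks => simp [h v rfl]

theorem Oper.drain_of_ne {k : K} {ρ : ℤ} {x : List (WSet I Z) × List (OutTup Q)}
    (h : ∀ w, x.1.head? = some w → w.l ≠ ρ) : op.drain k ρ x = x :=
  Function.iterate_fixed (op.forwardAndShift_of_ne h) _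

/-- After one round all sets lie strictly to the right of `ρ`, so the other rounds of the iteration
are idle. -/
theorem Oper.drain_of_head (hWA : 0 < op.WA) {k : K} {ρ : ℤ}
    {x : List (WSet I Z) × List (OutTup Q)} (hx : op.WF x.1) {w : WSet I Z}
    (hw : x.1.head? = some w) (hl : w.l = ρ) :
    op.drain k ρ x =
      (op.shiftFirst k w x.1, x.2 ++ op.prepareOutTuples w.l (op.fO (w.insts k))) := by
  have hne : x.1 ≠ [] := by rintro h; simp [h] at hw
  obtain ⟨m, hm⟩ : ∃ m, x.1.length = m + 1 :=
    ⟨x.1.length - 1, by have := List.length_pos_of_ne_nil hne; omega⟩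
  rw [Oper.drain, hm, Function.iterate_succ_apply, op.forwardAndShift_of_head hw hl]
  refine Function.iterate_fixed (op.forwardAndShift_of_ne fun v hv => ?_) _
  have := hx.ne_of_mem_shiftFirst hWA hw (List.mem_of_mem_head? hv)
  omega

/-- What `drain` does, under the invariant of the window sets. -/
theorem Oper.drain_cases (hWA : 0 < op.WA) (k : K) (ρ : ℤ)
    {x : List (WSet I Z) × List (OutTup Q)} (hx : op.WF x.1) :
    (op.drain k ρ x = x ∧ ∀ w, x.1.head? = some w → w.l ≠ ρ) ∨
    ∃ w, x.1.head? = some w ∧ w.l = ρ ∧ op.drain k ρ x =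
      (op.shiftFirst k w x.1, x.2 ++ op.prepareOutTuples w.l (op.fO (w.insts k))) := by
  by_cases h : ∃ w, x.1.head? = some w ∧ w.l = ρ
  · obtain ⟨w, hw, hl⟩ := h
    exact Or.inr ⟨w, hw, hl, op.drain_of_head hWA hx hw hl⟩
  · push Not at h
    exact Or.inl ⟨op.drain_of_ne h, h⟩

variable (op) in
/-- The loop over expired window instances, from `ρ` on, for a single key. -/
noncomputable def Oper.expireKey (k : K) (W ρ : ℤ) (x : List (WSet I Z) × List (OutTup Q)) :
    List (WSet I Z) × List (OutTup Q) :=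
  -- The second condition serves termination only.
  if _h : ρ + op.WS < W ∧ 0 < op.WA then expireKey k W (ρ + op.WA) (op.drain k ρ x) else x
termination_by (W - (ρ + op.WS)).toNat
decreasing_by omega

theorem Oper.expireKey_of_lt (hWA : 0 < op.WA) {k : K} {W ρ : ℤ} (h : ρ + op.WS < W)
    (x : List (WSet I Z) × List (OutTup Q)) :
    op.expireKey k W ρ x = op.expireKey k W (ρ + op.WA) (op.drain k ρ x) := by
  rw [Oper.expireKey, dif_pos ⟨h, hWA⟩]

theorem Oper.expireKey_of_not_lt {k : K} {W ρ : ℤ} (h : ¬ ρ + op.WS < W)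
    (x : List (WSet I Z) × List (OutTup Q)) : op.expireKey k W ρ x = x := by
  rw [Oper.expireKey, dif_neg fun h' => h h'.1]

/-- Induction along the loop. -/
theorem Oper.expireKey_induction (hWA : 0 < op.WA) {k : K} {W : ℤ}
    {motive : ℤ → List (WSet I Z) × List (OutTup Q) → Prop}
    (done : ∀ ρ x, ¬ ρ + op.WS < W → motive ρ x)
    (round : ∀ ρ x, ρ + op.WS < W → motive (ρ + op.WA) (op.drain k ρ x) → motive ρ x)
    (ρ : ℤ) (x : List (WSet I Z) × List (OutTup Q)) : motive ρ x := by
  induction hm : (W - (ρ + op.WS)).toNat using Nat.strong_induction_on generalizing ρ x with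
  | _ m ih =>
    by_cases h : ρ + op.WS < W
    · exact round ρ x h (ih _ (by omega) _ _ rfl)
    · exact done ρ x h

theorem Oper.WF.drain (hWA : 0 < op.WA) {k : K} {ρ : ℤ} {x : List (WSet I Z) × List (OutTup Q)}
    (hx : op.WF x.1) : op.WF (op.drain k ρ x).1 := by
  rcases op.drain_cases hWA k ρ hx with ⟨h, _⟩ | ⟨w, _, _, h⟩ <;> rw [h]
  · exact hx
  · exact hx.shiftFirst k w

theorem Oper.prefix_forwardAndShift (k : K) (ρ : ℤ) (x : List (WSet I Z) × List (OutTup Q)) :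
    x.2 <+: (op.forwardAndShift k ρ x).2 := by
  unfold Oper.forwardAndShift
  split
  · exact List.prefix_rfl
  · split
    · exact List.prefix_append _ _
    · exact List.prefix_rfl

theorem Oper.prefix_drain (k : K) (ρ : ℤ) (x : List (WSet I Z) × List (OutTup Q)) :
    x.2 <+: (op.drain k ρ x).2 := by
  unfold Oper.drain
  generalize x.1.length = m
  induction m with
  | zero => exact List.prefix_rfl
  | succ m ih =>
    rw [Function.iterate_succ_apply']
    exact ih.trans (op.prefix_forwardAndShift k ρ _)

theorem Oper.prefix_expireKey (hWA : 0 < op.WA) (k : K) (W ρ : ℤ)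
    (x : List (WSet I Z) × List (OutTup Q)) : x.2 <+: (op.expireKey k W ρ x).2 := by
  induction ρ, x using Oper.expireKey_induction (k := k) (W := W) hWA with
  | done ρ x h => rw [op.expireKey_of_not_lt h]
  | round ρ x h ih =>
    rw [op.expireKey_of_lt hWA h]
    exact (op.prefix_drain k ρ x).trans ih

theorem Oper.WF.expireKey (hWA : 0 < op.WA) {k : K} {W ρ : ℤ}
    {x : List (WSet I Z) × List (OutTup Q)} (hx : op.WF x.1) :
    op.WF (op.expireKey k W ρ x).1 := by
  induction ρ, x using Oper.expireKey_induction (k := k) (W := W) hWA with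
  | done ρ x h => rwa [op.expireKey_of_not_lt h]
  | round ρ x h ih =>
    rw [op.expireKey_of_lt hWA h]
    exact ih (hx.drain hWA)

theorem Oper.WF.head_le {ks : List (WSet I Z)} (h : op.WF ks) {v w : WSet I Z}
    (hv : ks.head? = some v) (hw : w ∈ ks) : v.l ≤ w.l := by
  cases ks with
  | nil => simp at hv
  | cons u ks =>
    simp only [List.head?_cons, Option.some.injEq] at hv
    subst hv
    rcases List.mem_cons.1 hw with rfl | hw
    · rfl
    · exact ((List.pairwise_cons.1 h.1).1 w hw).le

theorem add_le_of_dvd {d a b : ℤ} (ha : d ∣ a) (hb : d ∣ b) (hab : a < b) : a + d ≤ b := by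
  have := Int.le_of_dvd (by omega) (Int.dvd_sub hb ha)
  omega

/-- Draining clears the boundary `ρ`, and among multiples of `WA` being greater than `ρ` means being
at least `ρ + WA`. -/
theorem Oper.drain_bounds (hWA : 0 < op.WA) {k : K} {ρ : ℤ} (hρ : op.WA ∣ ρ)
    {x : List (WSet I Z) × List (OutTup Q)} (hx : op.WF x.1)
    (hl : ∀ w ∈ x.1, op.WA ∣ w.l ∧ ρ ≤ w.l) :
    ∀ w ∈ (op.drain k ρ x).1, op.WA ∣ w.l ∧ ρ + op.WA ≤ w.l := by
  rcases op.drain_cases hWA k ρ hx with ⟨h, hne⟩ | ⟨v, hv, hvl, h⟩ <;> rw [h] <;> intro w hw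
  · refine ⟨(hl w hw).1, add_le_of_dvd hρ (hl w hw).1 ?_⟩
    have hnil : x.1 ≠ [] := List.ne_nil_of_mem hw
    obtain ⟨u, hu⟩ : ∃ u, x.1.head? = some u := ⟨_, List.head?_eq_some_head hnil⟩
    have h1 := hne u hu
    have h2 := (hl u (List.mem_of_mem_head? hu)).2
    have h3 := hx.head_le hu hw
    omega
  · have hlt := hx.ne_of_mem_shiftFirst hWA hv hw
    have hd : op.WA ∣ w.l := by
      rcases op.mem_shiftFirst hw with hw | hw
      · exact (hl w (List.mem_of_mem_tail hw)).1
      · rw [hw, hvl]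
        exact Int.dvd_add hρ (Int.dvd_refl _)
    exact ⟨hd, add_le_of_dvd hρ hd (by omega)⟩

/-- The sets that are left are not expired. -/
theorem Oper.expireKey_bounds (hWA : 0 < op.WA) {k : K} {W ρ : ℤ} (hρ : op.WA ∣ ρ)
    {x : List (WSet I Z) × List (OutTup Q)} (hx : op.WF x.1)
    (hl : ∀ w ∈ x.1, op.WA ∣ w.l ∧ ρ ≤ w.l) :
    ∀ w ∈ (op.expireKey k W ρ x).1, op.WA ∣ w.l ∧ ρ ≤ w.l ∧ W ≤ w.l + op.WS := by
  induction ρ, x using Oper.expireKey_induction (k := k) (W := W) hWA with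
  | done ρ x h =>
    rw [op.expireKey_of_not_lt h]
    intro w hw
    have := hl w hw
    exact ⟨this.1, this.2, by omega⟩
  | round ρ x h ih =>
    rw [op.expireKey_of_lt hWA h]
    intro w hw
    have := ih (Int.dvd_add hρ (Int.dvd_refl _)) (hx.drain hWA) (op.drain_bounds hWA hρ hx hl) w hw
    exact ⟨this.1, by omega, this.2.2⟩

/-- All sets lie at or beyond the end of the skipped stretch, so each skipped round finds nothing at
its `ρ`. -/
theorem Oper.expireKey_add (hWA : 0 < op.WA) {k : K} {W ρ : ℤ} (n : ℕ)
    {x : List (WSet I Z) × List (OutTup Q)} (hl : ∀ w ∈ x.1, ρ + n * op.WA ≤ w.l) :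
    op.expireKey k W ρ x = op.expireKey k W (ρ + n * op.WA) x := by
  induction n with
  | zero => simp
  | succ n ih =>
    have hstep : ∀ w ∈ x.1, ρ + n * op.WA < w.l := fun w hw => by
      have := hl w hw
      push_cast at this
      nlinarith
    rw [ih fun w hw => (hstep w hw).le]
    have he : ρ + ((n + 1 : ℕ) : ℤ) * op.WA = ρ + n * op.WA + op.WA := by push_cast; ring
    rw [he]
    by_cases h : ρ + n * op.WA + op.WS < W
    · rw [op.expireKey_of_lt hWA h, op.drain_of_ne]
      intro w hw
      exact (hstep w (List.mem_of_mem_head? hw)).ne'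
    · rw [op.expireKey_of_not_lt h, op.expireKey_of_not_lt (by omega)]

/-- The result of the loop does not depend on where it starts. -/
theorem Oper.expireKey_congr (hWA : 0 < op.WA) {k : K} {W ρ ρ' : ℤ} (hρ : op.WA ∣ ρ)
    (hρ' : op.WA ∣ ρ') {x : List (WSet I Z) × List (OutTup Q)}
    (hl : ∀ w ∈ x.1, ρ ≤ w.l ∧ ρ' ≤ w.l) :
    op.expireKey k W ρ x = op.expireKey k W ρ' x := by
  wlog h : ρ ≤ ρ' generalizing ρ ρ'
  · exact (this hρ' hρ (fun w hw => (hl w hw).symm) (by omega)).symm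
  obtain ⟨c, hc⟩ := Int.dvd_sub hρ' hρ
  have hc0 : 0 ≤ c := by
    by_contra hneg
    have : op.WA * c < 0 := Int.mul_neg_of_pos_of_neg hWA (by omega)
    omega
  have he : ρ' = ρ + c.toNat * op.WA := by
    rw [Int.toNat_of_nonneg hc0, mul_comm]
    omega
  rw [he]
  exact op.expireKey_add hWA _ fun w hw => he ▸ (hl w hw).2

/-! ### The update loop for one key, and admissible values of `ρ` -/

variable (op) in
/-- The rounds `m, m + 1, …` of the update loop. -/
noncomputable def Oper.updateFrom (k : K) (t : Tup I P) (m : ℕ)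
    (x : List (WSet I Z) × List (OutTup Q)) : List (WSet I Z) × List (OutTup Q) :=
  (List.range' m (op.numWin t - m)).foldl (op.updateKey k t) x

theorem Oper.updateFrom_of_lt {k : K} {t : Tup I P} {m : ℕ} (h : m < op.numWin t)
    (x : List (WSet I Z) × List (OutTup Q)) :
    op.updateFrom k t m x = op.updateFrom k t (m + 1) (op.updateKey k t x m) := by
  have : op.numWin t - m = op.numWin t - (m + 1) + 1 := by omega
  rw [Oper.updateFrom, this, List.range'_succ]
  rfl

theorem Oper.updateFrom_of_not_lt {k : K} {t : Tup I P} {m : ℕ} (h : ¬ m < op.numWin t)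
    (x : List (WSet I Z) × List (OutTup Q)) : op.updateFrom k t m x = x := by
  have : op.numWin t - m = 0 := by omega
  rw [Oper.updateFrom, this]
  rfl

theorem Oper.numWin_pos (t : Tup I P) : 0 < op.numWin t := by
  unfold Oper.numWin
  split <;> omega

theorem Oper.prefix_updateKey (k : K) (t : Tup I P) (x : List (WSet I Z) × List (OutTup Q))
    (ℓ : ℕ) : x.2 <+: (op.updateKey k t x ℓ).2 := by
  simp only [Oper.updateKey]
  split
  · exact List.prefix_rfl
  · exact List.prefix_append _ _

theorem Oper.prefix_updateFrom (k : K) (t : Tup I P) (m : ℕ)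
    (x : List (WSet I Z) × List (OutTup Q)) : x.2 <+: (op.updateFrom k t m x).2 := by
  unfold Oper.updateFrom
  generalize List.range' m (op.numWin t - m) = L
  induction L generalizing x with
  | nil => exact List.prefix_rfl
  | cons ℓ L ih => exact (op.prefix_updateKey k t x ℓ).trans (ih _)

theorem Oper.WF.updateKey {k : K} {t : Tup I P} {x : List (WSet I Z) × List (OutTup Q)}
    (hx : op.WF x.1) (ℓ : ℕ) : op.WF (op.updateKey k t x ℓ).1 := by
  simp only [Oper.updateKey]
  split
  · exact hx.checkCreate _
  · exact (hx.checkCreate _).setStates _ _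

theorem Oper.mem_updateKey {k : K} {t : Tup I P} {x : List (WSet I Z) × List (OutTup Q)} {ℓ : ℕ}
    {w : WSet I Z} (hw : w ∈ (op.updateKey k t x ℓ).1) :
    (∃ v ∈ x.1, w.l = v.l) ∨ w.l = op.winL t ℓ := by
  simp only [Oper.updateKey] at hw
  split at hw
  · rcases op.mem_checkCreate hw with h | h
    · exact Or.inl ⟨w, h, rfl⟩
    · exact Or.inr h
  · obtain ⟨v, hv, hl⟩ := op.mem_setStates hw
    rcases op.mem_checkCreate hv with h | h
    · exact Or.inl ⟨v, h, hl⟩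
    · exact Or.inr (hl.trans h)

/-- The update loop brings in no left boundaries but values of `winL`, so a property that these
share is kept. -/
theorem Oper.updateFrom_inv {p : ℤ → Prop} {k : K} {t : Tup I P} (hp : ∀ ℓ, p (op.winL t ℓ))
    (m : ℕ) {x : List (WSet I Z) × List (OutTup Q)} (hx : op.WF x.1) (hl : ∀ w ∈ x.1, p w.l) :
    op.WF (op.updateFrom k t m x).1 ∧ ∀ w ∈ (op.updateFrom k t m x).1, p w.l := by
  unfold Oper.updateFrom
  generalize List.range' m (op.numWin t - m) = L
  induction L generalizing x with
  | nil => exact ⟨hx, hl⟩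
  | cons ℓ L ih =>
    refine ih (hx.updateKey ℓ) fun w hw => ?_
    rcases op.mem_updateKey hw with ⟨v, hv, h⟩ | h
    · exact h ▸ hl v hv
    · exact h ▸ hp ℓ

open Classical in
variable (op) in
/-- `handleInputTuple(t)` for a single key. -/
noncomputable def Oper.handleKey (k : K) (t : Tup I P) (x : List (WSet I Z) × List (OutTup Q)) :
    List (WSet I Z) × List (OutTup Q) :=
  if k ∈ op.fMK t then op.updateFrom k t 0 x else x

theorem Oper.prefix_handleKey (k : K) (t : Tup I P) (x : List (WSet I Z) × List (OutTup Q)) :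
    x.2 <+: (op.handleKey k t x).2 := by
  unfold Oper.handleKey
  split
  · exact op.prefix_updateFrom k t 0 x
  · exact List.prefix_rfl

variable (op) in
/-- A value of `ρ` that is not greater than the left boundary of any window instance that is not
expired at watermark `W`. -/
def Oper.RhoOK (W ρ : ℤ) : Prop :=
  op.WA ∣ ρ ∧ ∀ l, op.WA ∣ l → 0 ≤ l → W ≤ l + op.WS → ρ ≤ l

theorem Oper.RhoOK.mono {W W' ρ : ℤ} (h : op.RhoOK W ρ) (hW : W ≤ W') : op.RhoOK W' ρ :=
  ⟨h.1, fun l h1 h2 h3 => h.2 l h1 h2 (hW.trans h3)⟩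

/-- The boundary `ρ` itself is expired, so boundaries that are not expired are greater than `ρ`, and
by divisibility at least `ρ + WA`. -/
theorem Oper.RhoOK.add {W ρ : ℤ} (h : op.RhoOK W ρ) (hlt : ρ + op.WS < W) :
    op.RhoOK W (ρ + op.WA) :=
  ⟨Int.dvd_add h.1 (Int.dvd_refl _), fun _ h1 _ h3 => add_le_of_dvd h.1 h1 (by omega)⟩

theorem Oper.RhoOK.min {W ρ ρ' : ℤ} (h : op.RhoOK W ρ) (h' : op.WA ∣ ρ') :
    op.RhoOK W (min ρ ρ') := by
  refine ⟨?_, fun l h1 h2 h3 => (min_le_left _ _).trans (h.2 l h1 h2 h3)⟩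
  rcases min_choice ρ ρ' with h'' | h'' <;> rw [h'']
  · exact h.1
  · exact h'

theorem Oper.dvd_earliestWinL (t : Tup I P) : op.WA ∣ op.earliestWinL t := Int.dvd_mul_left _ _

/-- The expiration loop, key by key. -/
theorem Oper.expireRound_iterate (hWA : 0 < op.WA) (m : ℕ) (r : Ref I K Z Q)
    (hm : (r.W - (r.ρ + op.WS)).toNat ≤ m) (hr : op.RhoOK r.W r.ρ) :
    (op.expireRound^[m] r).W = r.W ∧ op.RhoOK r.W (op.expireRound^[m] r).ρ ∧
      ∀ k, ((op.expireRound^[m] r).σ k, (op.expireRound^[m] r).outs k) =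
        op.expireKey k r.W r.ρ (r.σ k, r.outs k) := by
  induction m generalizing r with
  | zero =>
    refine ⟨rfl, hr, fun k => ?_⟩
    rw [op.expireKey_of_not_lt (by omega)]
    rfl
  | succ m ih =>
    rw [Function.iterate_succ_apply]
    by_cases h : r.ρ + op.WS < r.W
    · obtain ⟨h1, h2, h3⟩ := ih (op.expireRound r)
        (by simp only [Oper.expireRound, if_pos h]; omega)
        (by simp only [Oper.expireRound, if_pos h]; exact hr.add h)
      simp only [Oper.expireRound, if_pos h] at h1 h2 h3 ⊢
      refine ⟨h1, h2, fun k => ?_⟩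
      rw [h3 k, op.expireKey_of_lt hWA h]
    · have he : op.expireRound r = r := if_neg h
      rw [he]
      exact ih r (by omega) hr

/-! ### The reference semantics key by key -/

variable {ι : Type*}

/-- The reference state of a key after `n` items. -/
noncomputable def refKey (op : Oper I K Z P Q) (inp : ℕ → Item I P K ι) (n : ℕ) (k : K) :
    List (WSet I Z) × List (OutTup Q) :=
  ((refAt op inp n).σ k, (refAt op inp n).outs k)

theorem refKey_control {inp : ℕ → Item I P K ι} {n : ℕ} {c : Ctl K ι} (h : inp n = .control c)
    (k : K) : refKey op inp (n + 1) k = refKey op inp n k := by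
  simp [refKey, refAt, h]

variable {c₀ : Ctl K ι} {inp : ℕ → Item I P K ι}

/-- A running maximum that starts at `0` is `0` or attained; being attained makes the assumption on
conveyed watermarks applicable. -/
theorem exists_wm_eq (c₀ : Ctl K ι) (inp : ℕ → Item I P K ι) (n : ℕ) :
    wmAt c₀ inp n = 0 ∨ ∃ m t, m < n ∧ inp m = .data t ∧ wmAt c₀ inp n = t.wm := by
  induction n with
  | zero => exact Or.inl rfl
  | succ n ih =>
    have hprev : wmAt c₀ inp (n + 1) = wmAt c₀ inp n → wmAt c₀ inp (n + 1) = 0 ∨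
        ∃ m t, m < n + 1 ∧ inp m = .data t ∧ wmAt c₀ inp (n + 1) = t.wm := by
      intro h
      rw [h]
      exact ih.imp_right fun ⟨m, t, h1, h2, h3⟩ => ⟨m, t, by omega, h2, h3⟩
    cases hi : inp n with
    | control c => exact hprev (wmAt_control hi)
    | data t =>
      have := wmAt_data (c₀ := c₀) hi
      rcases max_choice (wmAt c₀ inp n) t.wm with h | h
      · exact hprev (this.trans h)
      · exact Or.inr ⟨n, t, by omega, hi, this.trans h⟩

section
variable (hWA : 0 < op.WA) (hWS : op.WA ≤ op.WS) (hwm : Watermarked inp)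
  (hstart : ∀ n t, inp n = .data t → (op.fMK t).Nonempty → 0 ≤ op.earliestWinL t)
include hWA hWS hwm hstart

/-- No tuple falls in an expired window. -/
theorem wmAt_le_earliestWinL {n : ℕ} {t : Tup I P} (ht : inp n = .data t)
    (hk : (op.fMK t).Nonempty) :
    0 ≤ op.earliestWinL t ∧ wmAt c₀ inp (n + 1) ≤ op.earliestWinL t + op.WS := by
  have h0 := hstart n t ht hk
  have h1 : t.τ - op.WS < op.earliestWinL t := Int.lt_ediv_add_one_mul_self _ hWA
  have h2 : 0 ≤ t.τ := by
    have : (-1 : ℤ) ≤ (t.τ - op.WS) / op.WA := by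
      by_contra hneg
      have : op.earliestWinL t < 0 := Int.mul_neg_of_neg_of_pos (by omega) hWA
      omega
    have := (Int.le_ediv_iff_mul_le hWA).1 this
    omega
  refine ⟨h0, ?_⟩
  rcases exists_wm_eq c₀ inp (n + 1) with h | ⟨m, u, hm, hu, h⟩
  · omega
  -- The watermark is at most `t.τ`, which is smaller than the right boundary of the earliest window
  -- of `t`.
  · have := (hwm m n u t (by omega) hu ht).2
    omega

/-- The sets that the reference keeps start at multiples of `WA` that are neither negative nor
expired. This is the class of boundaries that `RhoOK` puts at or after `ρ`, so that the next
expiration loop misses none of them, whichever admissible `ρ` it starts from. -/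
theorem refAt_inv (n : ℕ) :
    (refAt op inp n).W = wmAt c₀ inp n ∧ op.RhoOK (wmAt c₀ inp n) (refAt op inp n).ρ ∧
      ∀ k, op.WF (refKey op inp n k).1 ∧
        ∀ w ∈ (refKey op inp n k).1, op.WA ∣ w.l ∧ 0 ≤ w.l ∧ wmAt c₀ inp n ≤ w.l + op.WS := by
  induction n with
  | zero =>
    refine ⟨rfl, ⟨Int.dvd_zero _, fun l _ h _ => h⟩, fun k => ⟨Oper.WF.nil, ?_⟩⟩
    simp [refKey, refAt]
  | succ n ih =>
    obtain ⟨hW, hρ, hk⟩ := ih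
    cases hi : inp n with
    | control c =>
      simp only [refKey_control hi, wmAt_control hi]
      simp only [refAt, hi]
      exact ⟨hW, hρ, hk⟩
    | data t =>
      set r : Ref I K Z Q := { refAt op inp n with W := max (refAt op inp n).W t.wm } with hr
      have hrW : r.W = wmAt c₀ inp (n + 1) := by
        rw [wmAt_data hi, ← hW]
      have hrρ : op.RhoOK r.W r.ρ := hρ.mono (by rw [hrW]; exact wmAt_le_succ n)
      obtain ⟨h1, h2, h3⟩ := op.expireRound_iterate hWA _ r le_rfl hrρ
      have hkey : ∀ k, refKey op inp (n + 1) k =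
          op.handleKey k t (op.expireKey k r.W r.ρ (refKey op inp n k)) := by
        intro k
        rw [show refKey op inp n k = (r.σ k, r.outs k) from rfl, ← h3 k]
        simp only [refKey, refAt, hi, Oper.processSN, Oper.handleInput, Oper.handleKey,
          Oper.updateFrom, Nat.sub_zero, ← List.range_eq_range']
        split <;> rfl
      have hρ' : (refAt op inp (n + 1)).ρ = if (op.fMK t).Nonempty then
          min (op.expireRound^[(r.W - (r.ρ + op.WS)).toNat] r).ρ (op.earliestWinL t) else
          (op.expireRound^[(r.W - (r.ρ + op.WS)).toNat] r).ρ := by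
        simp only [refAt, hi]
        rfl
      have hW' : (refAt op inp (n + 1)).W = (op.expireRound^[(r.W - (r.ρ + op.WS)).toNat] r).W := by
        simp only [refAt, hi]
        rfl
      refine ⟨by rw [hW', h1, hrW], ?_, fun k => ?_⟩
      · rw [hρ', ← hrW]
        split
        · exact h2.min (op.dvd_earliestWinL t)
        · exact h2
      · rw [hkey k]
        have hb : ∀ w ∈ (refKey op inp n k).1, op.WA ∣ w.l ∧ r.ρ ≤ w.l := fun w hw => by
          obtain ⟨e1, e2, e3⟩ := (hk k).2 w hw
          exact ⟨e1, hρ.2 w.l e1 e2 e3⟩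
        have hb0 : ∀ w ∈ (refKey op inp n k).1, op.WA ∣ w.l ∧ 0 ≤ w.l := fun w hw =>
          ⟨((hk k).2 w hw).1, ((hk k).2 w hw).2.1⟩
        have hwf : op.WF (op.expireKey k r.W r.ρ (refKey op inp n k)).1 := (hk k).1.expireKey hWA
        have hbd : ∀ w ∈ (op.expireKey k r.W r.ρ (refKey op inp n k)).1,
            op.WA ∣ w.l ∧ 0 ≤ w.l ∧ wmAt c₀ inp (n + 1) ≤ w.l + op.WS := by
          intro w hw
          obtain ⟨e1, _, e3⟩ := op.expireKey_bounds hWA hρ.1 (hk k).1 hb w hw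
          refine ⟨e1, ?_, hrW ▸ e3⟩
          -- Starting from `0` gives the same result and shows that the boundaries stay
          -- non-negative; `RhoOK` does not bound `ρ` from below.
          rw [op.expireKey_congr hWA hρ.1 (Int.dvd_zero op.WA)
            fun w hw => ⟨(hb w hw).2, (hb0 w hw).2⟩] at hw
          exact (op.expireKey_bounds hWA (Int.dvd_zero _) (hk k).1 hb0 w hw).2.1
        unfold Oper.handleKey
        split
        · rename_i hmem
          obtain ⟨e1, e2⟩ := wmAt_le_earliestWinL (c₀ := c₀) hWA hWS hwm hstart hi ⟨k, hmem⟩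
          refine op.updateFrom_inv (p := fun l => op.WA ∣ l ∧ 0 ≤ l ∧
            wmAt c₀ inp (n + 1) ≤ l + op.WS) (fun ℓ => ?_) 0 hwf hbd
          have : 0 ≤ (ℓ : ℤ) * op.WA := by positivity
          unfold Oper.winL
          exact ⟨Int.dvd_add (op.dvd_earliestWinL t) (Int.dvd_mul_left _ _), by omega, by omega⟩
        · exact ⟨hwf, hbd⟩

/-- The effect of a regular tuple on a key can be computed with any admissible value of `ρ`. -/
theorem refKey_data {n : ℕ} {t : Tup I P} (ht : inp n = .data t) {ρ : ℤ}
    (hρ : op.RhoOK (wmAt c₀ inp n) ρ) (k : K) :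
    refKey op inp (n + 1) k =
      op.handleKey k t (op.expireKey k (wmAt c₀ inp (n + 1)) ρ (refKey op inp n k)) := by
  obtain ⟨hW, hρ', hk⟩ := refAt_inv (c₀ := c₀) hWA hWS hwm hstart n
  set r : Ref I K Z Q := { refAt op inp n with W := max (refAt op inp n).W t.wm } with hr
  have hrW : r.W = wmAt c₀ inp (n + 1) := by
    rw [wmAt_data ht, ← hW]
  obtain ⟨h1, h2, h3⟩ := op.expireRound_iterate hWA _ r le_rfl
    (hρ'.mono (by rw [hrW]; exact wmAt_le_succ n))
  have hkey : refKey op inp (n + 1) k =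
      op.handleKey k t (op.expireKey k r.W r.ρ (refKey op inp n k)) := by
    rw [show refKey op inp n k = (r.σ k, r.outs k) from rfl, ← h3 k]
    simp only [refKey, refAt, ht, Oper.processSN, Oper.handleInput, Oper.handleKey,
      Oper.updateFrom, Nat.sub_zero, ← List.range_eq_range']
    split <;> rfl
  rw [hkey, hrW]
  congr 1
  refine op.expireKey_congr hWA hρ'.1 hρ.1 fun w hw => ?_
  obtain ⟨e1, e2, e3⟩ := (hk k).2 w hw
  exact ⟨hρ'.2 _ e1 e2 e3, hρ.2 _ e1 e2 e3⟩

/-- The statement does not determine `c₀`, which only names the watermark function used in the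
proof. -/
theorem refKey_prefix_succ (n : ℕ) (k : K) (c₀ : Ctl K ι) :
    (refKey op inp n k).2 <+: (refKey op inp (n + 1) k).2 := by
  cases hi : inp n with
  | control c => rw [refKey_control hi]
  | data t =>
    have := (refAt_inv (c₀ := c₀) hWA hWS hwm hstart n).2.1
    rw [refKey_data (c₀ := c₀) hWA hWS hwm hstart hi this]
    exact (op.prefix_expireKey hWA k _ _ _).trans (op.prefix_handleKey k t _)

theorem refKey_prefix {m n : ℕ} (hmn : m ≤ n) (k : K) (c₀ : Ctl K ι) :
    (refKey op inp m k).2 <+: (refKey op inp n k).2 := by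
  induction n, hmn using Nat.le_induction with
  | base => exact List.prefix_rfl
  | succ n _ ih => exact ih.trans (refKey_prefix_succ hWA hWS hwm hstart n k c₀)

end

end KeySemantics

/-! ## The invariant of the shared state -/

section DataInvariant

variable {I : ℕ} {K Z P Q ι : Type*} [DecidableEq K] [DecidableEq ι]

/-- What remains to be done for key `k` by an instance that processes `t`, as a function of the
current window sets and outputs of the key. -/
noncomputable def Oper.remain (op : Oper I K Z P Q) (t : Tup I P) (W ρ : ℤ) (k : K) :
    PC I K Z → List (WSet I Z) × List (OutTup Q) → List (WSet I Z) × List (OutTup Q)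
  | .expire, x => op.handleKey k t (op.expireKey k W ρ x)
  -- The results of `w` have been forwarded already; what is left is the shift and the loop from the
  -- same `ρ` on.
  | .shift k' w, x =>
      if k' = k then op.handleKey k t (op.expireKey k W ρ (op.shiftFirst k w x.1, x.2))
      else op.handleKey k t (op.expireKey k W ρ x)
  | .handle, x => op.handleKey k t x
  -- A key of the tuple that is no longer in `S` has had its round `ℓ` and continues with round `ℓ +
  -- 1`.
  | .update ℓ S, x =>
      if k ∈ op.fMK t then op.updateFrom k t (if k ∈ S then ℓ else ℓ + 1) x else x
  | .read ℓ S k', x =>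
      if k' = k then
        op.updateFrom k t (ℓ + 1)
          (match op.lookup x.1 (op.winL t ℓ) with
          | none => x
          | some w => (op.setStates x.1 (op.winL t ℓ) (op.fU (w.insts k) t).1,
              x.2 ++ op.prepareOutTuples w.l (op.fU (w.insts k) t).2))
      else if k ∈ op.fMK t then op.updateFrom k t (if k ∈ S then ℓ else ℓ + 1) x else x
  | .write ℓ S k' ζ, x =>
      if k' = k then op.updateFrom k t (ℓ + 1) (op.setStates x.1 (op.winL t ℓ) ζ, x.2)
      else if k ∈ op.fMK t then op.updateFrom k t (if k ∈ S then ℓ else ℓ + 1) x else x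
  | _, x => x

/-- The work that is left only appends outputs. Hence, during an item, the outputs of a key are a
prefix of those of the reference after the item. -/
theorem Oper.prefix_remain {op : Oper I K Z P Q} (hWA : 0 < op.WA) (t : Tup I P) (W ρ : ℤ) (k : K)
    (pc : PC I K Z) (x : List (WSet I Z) × List (OutTup Q)) :
    x.2 <+: (op.remain t W ρ k pc x).2 := by
  have hE : ∀ y : List (WSet I Z) × List (OutTup Q),
      y.2 <+: (op.handleKey k t (op.expireKey k W ρ y)).2 := fun y =>
    (op.prefix_expireKey hWA k W ρ y).trans (op.prefix_handleKey k t _)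
  have hU : ∀ m, x.2 <+: (if k ∈ op.fMK t then op.updateFrom k t m x else x).2 := by
    intro m
    split
    · exact op.prefix_updateFrom k t m x
    · exact List.prefix_rfl
  cases pc with
  | expire => exact hE x
  | shift k' w =>
    simp only [Oper.remain]
    split
    · exact hE (op.shiftFirst k w x.1, x.2)
    · exact hE x
  | handle => exact op.prefix_handleKey k t x
  | update ℓ S => exact hU _
  | read ℓ S k' =>
    simp only [Oper.remain]
    split
    · refine List.IsPrefix.trans ?_ (op.prefix_updateFrom k t _ _)
      split
      · exact List.prefix_rfl
      · exact List.prefix_append _ _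
    · exact hU _
  | write ℓ S k' ζ =>
    simp only [Oper.remain]
    split
    · exact op.prefix_updateFrom k t (ℓ + 1) (op.setStates x.1 (op.winL t ℓ) ζ, x.2)
    · exact hU _
  | _ => exact List.prefix_rfl

/-- The loop variables of instance `i` are consistent with its tuple and with the shared state. -/
def Local.LoopOK (op : Oper I K Z P Q) (inp : ℕ → Item I P K ι) (σ : K → List (WSet I Z)) (i : ι)
    (L : Local I K Z ι) : Prop :=
  match L.pc with
  | .shift k w => L.cfg.f k = i ∧ (σ k).head? = some w ∧ w.l = L.ρ
  | .update ℓ S => ∀ t, inp L.pos = .data t →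
      ℓ < op.numWin t ∧ ∀ k ∈ S, k ∈ op.fMK t ∧ L.cfg.f k = i
  | .read ℓ S k => ∀ t, inp L.pos = .data t →
      ℓ < op.numWin t ∧ (∀ k ∈ S, k ∈ op.fMK t ∧ L.cfg.f k = i) ∧
        (k ∈ op.fMK t ∧ L.cfg.f k = i ∧ k ∉ S) ∧ (op.lookup (σ k) (op.winL t ℓ)).isSome
  | .write ℓ S k _ => ∀ t, inp L.pos = .data t →
      ℓ < op.numWin t ∧ (∀ k ∈ S, k ∈ op.fMK t ∧ L.cfg.f k = i) ∧
        (k ∈ op.fMK t ∧ L.cfg.f k = i ∧ k ∉ S)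
  | _ => True

/-- The loop variables look at the shared state only at keys for which the instance is responsible,
so work on other keys cannot invalidate them. -/
theorem Local.LoopOK.congr {op : Oper I K Z P Q} {inp : ℕ → Item I P K ι}
    {σ σ' : K → List (WSet I Z)} {i : ι} {L : Local I K Z ι} (h : L.LoopOK op inp σ i)
    (hσ : L.pc.stage = 7 → ∀ k, L.cfg.f k = i → σ' k = σ k) :
    L.LoopOK op inp σ' i := by
  unfold Local.LoopOK at *
  split at h
  · rename_i heq
    rw [hσ (by rw [heq]; rfl) _ h.1]
    exact h
  · exact h
  · rename_i heq
    intro t ht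
    have := h t ht
    rw [hσ (by rw [heq]; rfl) _ this.2.2.1.2.1]
    exact this
  · exact h
  · trivial

theorem Local.LoopOK.of_stage_ne {op : Oper I K Z P Q} {inp : ℕ → Item I P K ι}
    {σ : K → List (WSet I Z)} {i : ι} {L : Local I K Z ι} (h : L.pc.stage ≠ 7) :
    L.LoopOK op inp σ i := by
  unfold Local.LoopOK
  split <;> first | trivial | (rename_i heq; rw [heq] at h; exact absurd rfl h)

variable (op : Oper I K Z P Q) (c₀ : Ctl K ι) (inp : ℕ → Item I P K ι)

/-- The window sets and outputs of a key. -/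
def State.key (s : State I K Z Q ι) (k : K) : List (WSet I Z) × List (OutTup Q) :=
  (s.σ k, s.outs k)

/-- The invariant of the shared state. -/
structure DInv (s : State I K Z Q ι) : Prop where
  rho : ∀ i, (s.loc i).pc.stage ≠ 7 → op.RhoOK (wmAt c₀ inp (s.loc i).pos) (s.loc i).ρ
  rho' : ∀ i, (s.loc i).pc.stage = 7 → op.RhoOK (wmAt c₀ inp ((s.loc i).pos + 1)) (s.loc i).ρ
  loops : ∀ i, (s.loc i).LoopOK op inp s.σ i
  wf : ∀ k, op.WF (s.σ k)
  -- Needed for progress: at one value of `ρ` only finitely many keys have to be handled.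
  fin : {k | s.σ k ≠ []}.Finite
  -- The two conditions below cover a key between two items and a key within an item.
  start : ∀ n k, s.skel.Reached c₀ inp k n →
    ¬ (s.skel.loc ((cfgAt c₀ inp (n + 1)).f k)).Started n → s.key k = refKey op inp n k
  prog : ∀ i k t, s.skel.Active c₀ inp i k → inp (s.loc i).pos = .data t →
    op.remain t (wmAt c₀ inp ((s.loc i).pos + 1)) (s.loc i).ρ k (s.loc i).pc (s.key k) =
      refKey op inp ((s.loc i).pos + 1) k ∧
    (refKey op inp (s.loc i).pos k).2 <+: s.outs k

variable {op c₀ inp} {s s' : State I K Z Q ι} {N N' : ℕ} {j : ι}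

theorem DInv.initial : DInv op c₀ inp (State.initial c₀ : State I K Z Q ι) := by
  refine ⟨?_, ?_, ?_, ?_, ?_, ?_, ?_⟩
  · intro i _
    exact ⟨Int.dvd_zero _, fun l _ h _ => h⟩
  · simp [State.initial, PC.stage]
  · exact fun i => Local.LoopOK.of_stage_ne (by simp [State.initial, PC.stage])
  · exact fun k => Oper.WF.nil
  · simp [State.initial]
  · intro n k h _
    have : n = 0 := Nat.le_zero.1 h
    subst this
    rfl
  · rintro i k t ⟨h, _⟩
    simp [State.initial, State.skel, Local.skel, PC.stage] at h

theorem SInv.cfg_f (h : SInv c₀ inp s.skel N) (h7 : (s.loc j).pc.stage = 7) {k : K} :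
    s.skel.Active c₀ inp j k ↔ (s.loc j).cfg.f k = j := by
  have : (s.loc j).cfg = cfgAt c₀ inp ((s.loc j).pos + 1) := (h.loc j).cfg_post h7
  rw [this]
  exact ⟨fun h' => h'.2, fun h' => ⟨h7, h'⟩⟩

section
variable (hinit : c₀.Valid) (hctl : ValidReconfigs c₀ inp)
include hinit hctl

/-- Steps that only work on keys of the acting instance. -/
theorem DInv.internal (hS : SInv c₀ inp s.skel N) (h : DInv op c₀ inp s)
    (h7 : (s.loc j).pc.stage = 7) (hsk : s'.skel = s.skel)
    (hloc : ∀ i, i ≠ j → s'.loc i = s.loc i)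
    (hframe : ∀ k, s'.key k = s.key k ∨ s.skel.Active c₀ inp j k)
    (hrho : op.RhoOK (wmAt c₀ inp ((s.loc j).pos + 1)) (s'.loc j).ρ)
    (hloop : ∀ t, inp (s.loc j).pos = .data t → (s'.loc j).LoopOK op inp s'.σ j)
    (hwf : ∀ k, op.WF (s'.σ k)) (hfin : {k | s'.σ k ≠ []}.Finite)
    (hprog : ∀ k t, s.skel.Active c₀ inp j k → inp (s.loc j).pos = .data t →
      op.remain t (wmAt c₀ inp ((s.loc j).pos + 1)) (s'.loc j).ρ k (s'.loc j).pc (s'.key k) =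
        op.remain t (wmAt c₀ inp ((s.loc j).pos + 1)) (s.loc j).ρ k (s.loc j).pc (s.key k) ∧
      s.outs k <+: s'.outs k) :
    DInv op c₀ inp s' := by
  have hskl : ∀ i, (s'.loc i).skel = (s.loc i).skel := fun i =>
    congrFun (congrArg Skel.loc hsk) i
  have hpos : ∀ i, (s'.loc i).pos = (s.loc i).pos := fun i => congrArg SLoc.pos (hskl i)
  have hst : ∀ i, (s'.loc i).pc.stage = (s.loc i).pc.stage := fun i => congrArg SLoc.st (hskl i)
  obtain ⟨t₀, ht₀⟩ := (hS.loc j).is_data (show (s.loc j).pc.stage ≠ 0 by omega)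
  refine ⟨?_, ?_, ?_, hwf, hfin, ?_, ?_⟩
  · intro i hi
    by_cases hij : i = j
    · subst hij
      rw [hst] at hi
      exact absurd h7 hi
    · rw [hloc i hij] at hi ⊢
      exact h.rho i hi
  · intro i hi
    by_cases hij : i = j
    · subst hij
      rw [hpos]
      exact hrho
    · rw [hloc i hij] at hi ⊢
      exact h.rho' i hi
  · intro i
    by_cases hij : i = j
    · subst hij
      exact hloop t₀ ht₀
    · rw [hloc i hij]
      refine (h.loops i).congr fun hi7 k hk => ?_
      rcases hframe k with hf | hf
      · exact congrArg Prod.fst hf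
      · exact absurd (hS.active_unique hinit hctl ((hS.cfg_f hi7).2 hk) hf) hij
  · intro n k hr hns
    rw [hsk] at hr hns
    rcases hframe k with hf | hf
    · rw [hf]
      exact h.start n k hr hns
    -- While `j` is active on `k`, every item reached for `k` has been started, so nothing is
    -- claimed here.
    · exact absurd (hS.active_of_not_started hinit hctl hf hr) hns
  · intro i k t ha ht
    rw [hsk] at ha
    rw [hpos] at ht ⊢
    by_cases hij : i = j
    · subst hij
      obtain ⟨h1, h2⟩ := hprog k t ha ht
      obtain ⟨h3, h4⟩ := h.prog i k t ha ht
      exact ⟨h1.trans h3, h4.trans h2⟩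
    · rcases hframe k with hf | hf
      · have hf' : s'.outs k = s.outs k := congrArg Prod.snd hf
        rw [hloc i hij, hf, hf']
        exact h.prog i k t ha ht
      · exact absurd (hS.active_unique hinit hctl ha hf) hij

omit [DecidableEq K] in
-- A member of the epoch after `n` items gets to item `n` only by completing item `n - 1`. Being
-- added cannot take it there: this moves a cursor to the item `g` of the change, and if `n ≤ g`, a
-- member that has not arrived at item `n` would have held that change back.
theorem SInv.pos_of_reached {a a' : Skel K ι} (hS : SInv c₀ inp a N) (hs : SStep inp j a a')
    {b : ι} {n : ℕ} (hb : b ∈ (cfgAt c₀ inp n).O) (h1 : (a.loc b).pos < n)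
    (h2 : n ≤ (a'.loc b).pos) :
    b = j ∧ n = (a.loc j).pos + 1 ∧ (a'.loc j).pos = (a.loc j).pos + 1 := by
  have key : ∀ L : SLoc K ι, a'.loc = Function.update a.loc j L → L.pos ≤ (a.loc j).pos + 1 →
      b = j ∧ n = (a.loc j).pos + 1 ∧ (a'.loc j).pos = (a.loc j).pos + 1 := by
    intro L hL hp
    rw [hL] at h2 ⊢
    by_cases hbj : b = j
    · subst hbj
      rw [Function.update_self] at h2 ⊢
      exact ⟨rfl, by omega, by omega⟩
    · rw [Function.update_of_ne hbj] at h2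
      omega
  cases hs with
  | addReaders h3 =>
    exfalso
    have hN : N = (a.loc j).pos + 1 ∧ ∀ i, i ∉ a.readers → (a.loc i).st = 0 := by
      rcases hS.phase with ⟨_, _, h4⟩ | ⟨r, g, h0, _, _, _, h6, h7, h8, h9, h10⟩ |
        ⟨r, g, h0, _, _, h4, h6, h7, h8, h9⟩
      · exact absurd h3 (h4 j).1
      · obtain rfl := h8 j h3
        exact ⟨by omega, fun i hi => (h10 i hi).1⟩
      · exact absurd h3 (h9 j)
    dsimp only at h2
    split at h2
    · rename_i hbj
      subst hbj
      dsimp only at h2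
      omega
    split at h2
    · rename_i hi
      have hidle := hN.2 b (Finset.mem_sdiff.1 hi).2
      have := hS.le_of_mem hb ((hS.loc b).arr_idle hidle |>.trans h1.le)
      dsimp only at h2
      omega
    · omega
  | _ => exact key _ rfl (by simp)

omit [DecidableEq K] hinit hctl in
theorem SStep.started_mono {a a' : Skel K ι} (hS : SInv c₀ inp a N) (hs : SStep inp j a a') {i : ι}
    {n : ℕ} (h : (a.loc i).Started n) : (a'.loc i).Started n := by
  have hpos := hS.pos_mono hs i
  rcases h with h | ⟨rfl, h⟩
  · exact Or.inl (by omega)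
  · by_cases hij : i = j
    · subst hij
      cases hs with
      | done => exact Or.inl (by simp [Skel.setLoc])
      | _ => omega
    · rw [hS.loc_eq_of_busy hs hij (by omega)]
      exact Or.inr ⟨rfl, h⟩

/-- Steps of the skeleton, which leave the shared state alone. -/
theorem DInv.external (hS : SInv c₀ inp s.skel N) (h : DInv op c₀ inp s)
    (hs : SStep inp j s.skel s'.skel)
    (hkey : ∀ k, s'.key k = s.key k)
    (hρ : ∀ i, (s'.loc i).ρ = (s.loc i).ρ)
    (hloc : ∀ i, (s'.loc i).pc.stage = 7 → s'.loc i = s.loc i ∨ i = j ∧ (s'.loc i).pc = .expire ∧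
      (s.loc i).pc.stage ≠ 7 ∧ (s'.loc i).pos = (s.loc i).pos ∧
      (Triggers c₀ inp (s.loc i).pos → 2 ≤ (s.loc i).pc.stage))
    (hdone : (s'.loc j).pos = (s.loc j).pos + 1 → ∀ k,
      (cfgAt c₀ inp ((s.loc j).pos + 1)).f k = j →
      s.key k = refKey op inp ((s.loc j).pos + 1) k)
    -- This is `refKey_data`, taken as a hypothesis to keep the assumptions on the stream out of
    -- this argument.
    (hdata : ∀ n t ρ k, inp n = .data t → op.RhoOK (wmAt c₀ inp n) ρ → refKey op inp (n + 1) k =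
      op.handleKey k t (op.expireKey k (wmAt c₀ inp (n + 1)) ρ (refKey op inp n k))) :
    DInv op c₀ inp s' := by
  have hσ : s'.σ = s.σ := funext fun k => congrArg Prod.fst (hkey k)
  have ho : s'.outs = s.outs := funext fun k => congrArg Prod.snd (hkey k)
  have hpos : ∀ i, (s.loc i).pos ≤ (s'.loc i).pos := hS.pos_mono hs
  refine ⟨?_, ?_, ?_, hσ ▸ h.wf, hσ ▸ h.fin, ?_, ?_⟩
  · intro i hi
    rw [hρ]
    by_cases h7 : (s.loc i).pc.stage = 7
    · have hlt : (s.loc i).pos + 1 ≤ (s'.loc i).pos := by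
        have := hs.started_mono hS (i := i) (n := (s.loc i).pos) (Or.inr ⟨rfl, h7⟩)
        rcases this with this | ⟨_, this⟩
        · exact this
        · exact absurd this hi
      exact (h.rho' i h7).mono (wmAt_mono hlt)
    · exact (h.rho i h7).mono (wmAt_mono (hpos i))
  · intro i hi
    rcases hloc i hi with he | ⟨_, _, h7, hp, _⟩
    · rw [he] at hi ⊢
      exact h.rho' i hi
    · rw [hρ, hp]
      exact (h.rho i h7).mono (wmAt_le_succ _)
  · intro i
    by_cases hi : (s'.loc i).pc.stage = 7
    · rcases hloc i hi with he | ⟨_, he, _⟩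
      · rw [he, hσ]
        exact h.loops i
      · simp [Local.LoopOK, he]
    · exact Local.LoopOK.of_stage_ne hi
  · intro n k hr hns
    rw [hkey]
    have hns' : ¬ (s.skel.loc ((cfgAt c₀ inp (n + 1)).f k)).Started n := fun h' =>
      hns (hs.started_mono hS h')
    by_cases hr' : s.skel.Reached c₀ inp k n
    · exact h.start n k hr' hns'
    · obtain ⟨hb, hn, hp⟩ := hS.pos_of_reached hinit hctl hs ((cfgAt_valid hinit hctl n).2.1 k)
        (not_le.1 hr') hr
      rw [hn] at hb ⊢
      exact hdone hp k hb
  · intro i k t ha ht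
    rw [hkey, ho]
    rcases hloc i ha.1 with he | ⟨rfl, he, h7, hp, hT⟩
    · rw [he] at ht ⊢
      refine h.prog i k t ?_ ht
      have h1 : s'.skel.loc i = s.skel.loc i := congrArg Local.skel he
      unfold Skel.Active at ha ⊢
      rwa [h1] at ha
    · have hf : (cfgAt c₀ inp ((s.loc i).pos + 1)).f k = i := by
        have := ha.2
        rwa [show (s'.skel.loc i).pos = (s.loc i).pos from hp] at this
      -- The instance is about to begin the item, which the key has reached by virtue of the barrier
      -- or the unchanged mapping and which nobody has started for it.
      have hst := h.start (s.loc i).pos k (hS.reached_pos hinit hctl rfl hf hT) (by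
        rw [hf]
        rintro (h' | ⟨_, h'⟩)
        · exact lt_irrefl _ h'
        · exact h7 h')
      rw [hp] at ht ⊢
      rw [hρ, he, hst, hdata _ t _ k ht (h.rho i h7)]
      refine ⟨rfl, ?_⟩
      rw [← hst]
      exact List.prefix_rfl

end

end DataInvariant

/-! ### Preservation of the data invariant -/

section DataSteps

variable {I : ℕ} {K Z P Q ι : Type*} [DecidableEq K] [DecidableEq ι]
variable {op : Oper I K Z P Q} {c₀ : Ctl K ι} {inp : ℕ → Item I P K ι}
variable {s s' : State I K Z Q ι} {N : ℕ} {j : ι}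

theorem State.loc_goto (s : State I K Z Q ι) (j i : ι) (pc : PC I K Z) :
    (s.goto j pc).loc i = if i = j then { s.loc j with pc := pc } else s.loc i :=
  Function.update_apply _ _ _ _

theorem State.loc_setLoc (s : State I K Z Q ι) (j i : ι) (L : Local I K Z ι) :
    (s.setLoc j L).loc i = if i = j then L else s.loc i :=
  Function.update_apply _ _ _ _

theorem State.key_goto (s : State I K Z Q ι) (j : ι) (pc : PC I K Z) (k : K) :
    (s.goto j pc).key k = s.key k := rfl

theorem State.σ_goto (s : State I K Z Q ι) (j : ι) (pc : PC I K Z) : (s.goto j pc).σ = s.σ := rfl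

theorem State.outs_goto (s : State I K Z Q ι) (j : ι) (pc : PC I K Z) :
    (s.goto j pc).outs = s.outs := rfl

/-- This separates the steps within a tuple, which leave the skeleton alone, from its completion,
the only skeleton step from stage `7`. -/
theorem SStep.st_eq_zero {a a' : Skel K ι} (hs : SStep inp j a a') (h7 : (a.loc j).st = 7) :
    (a'.loc j).st = 0 := by
  cases hs with
  | done => simp [Skel.setLoc]
  | _ => omega

theorem State.key_forward (s : State I K Z Q ι) {j : ι} (hj : j ∈ s.sources) (k k' : K)
    (o : List (OutTup Q)) :
    (s.forward j k o).key k' = if k' = k then (s.σ k, s.outs k ++ o) else s.key k' := by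
  simp only [State.forward, if_pos hj, State.key, Function.update_apply]
  split
  · rename_i h; subst h; rfl
  · rfl

theorem State.σ_forward (s : State I K Z Q ι) (j : ι) (k : K) (o : List (OutTup Q)) :
    (s.forward j k o).σ = s.σ := by
  unfold State.forward
  split <;> rfl

theorem State.key_setKey (s : State I K Z Q ι) (k k' : K) (ks : List (WSet I Z)) :
    (s.setKey k ks).key k' = if k' = k then (ks, s.outs k) else s.key k' := by
  simp only [State.key, State.setKey, Function.update_apply]
  split
  · rename_i h; subst h; rfl
  · rfl

theorem State.finite_setKey {s : State I K Z Q ι} (h : {k | s.σ k ≠ []}.Finite) (k : K)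
    (ks : List (WSet I Z)) : {k' | (s.setKey k ks).σ k' ≠ []}.Finite := by
  refine (h.insert k).subset fun k' hk' => ?_
  by_cases hk : k' = k
  · exact Or.inl hk
  · right
    simpa [State.setKey, hk] using hk'

theorem State.wf_setKey {s : State I K Z Q ι} (h : ∀ k, op.WF (s.σ k)) {k : K}
    {ks : List (WSet I Z)} (hks : op.WF ks) (k' : K) : op.WF ((s.setKey k ks).σ k') := by
  simp only [State.setKey, Function.update_apply]
  split
  · exact hks
  · exact h k'

section
variable (hinit : c₀.Valid) (hctl : ValidReconfigs c₀ inp) (hWA : 0 < op.WA)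
include hinit

/-- Without this, `forward` could be without effect and outputs could be lost. -/
theorem SInv.mem_O (hctl : ValidReconfigs c₀ inp) (hS : SInv c₀ inp s.skel N) {k : K}
    (ha : s.skel.Active c₀ inp j k) : j ∈ s.readers ∧ j ∈ s.sources := by
  refine hS.connected ha.1 ?_
  have := (cfgAt_valid hinit hctl ((s.skel.loc j).pos + 1)).2.1 k
  rwa [ha.2] at this

include hctl hWA

/-- The invariant of the shared state is preserved by every step. -/
theorem DInv.step (hS : SInv c₀ inp s.skel N) (h : DInv op c₀ inp s)
    (hst : Step op inp j s s')
    (hdata : ∀ n t ρ k, inp n = .data t → op.RhoOK (wmAt c₀ inp n) ρ → refKey op inp (n + 1) k =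
      op.handleKey k t (op.expireKey k (wmAt c₀ inp (n + 1)) ρ (refKey op inp n k))) :
    DInv op c₀ inp s' := by
  have hl := h.loops j
  have hskel := hst.skel
  have hpc : ∀ pc, (s.loc j).pc = pc → (s.loc j).pc.stage = pc.stage := fun pc h => by rw [h]
  have hact : (s.loc j).pc.stage = 7 → ∀ k, (s.loc j).cfg.f k = j → s.skel.Active c₀ inp j k :=
    fun h7 k => (hS.cfg_f h7).2
  have hrho := h.rho' j
  cases hst with
  | control c h1 h2 h3 h4 =>
    have hs := hskel.resolve_left (by rw [hpc _ h1]; simp [PC.stage])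
    have hnt : ¬ Triggers c₀ inp (s.loc j).pos := by
      rintro ⟨t, ht, _⟩
      rw [h3] at ht
      cases ht
    refine h.external hinit hctl hS hs (fun _ => rfl) ?_ ?_ ?_ hdata
    · intro i
      rw [State.loc_setLoc]
      split
      · rename_i hi; rw [hi]
      · rfl
    · intro i
      rw [State.loc_setLoc]
      split
      · rename_i hi; simp [h1, PC.stage]
      · exact fun _ => Or.inl rfl
    · intro _ k hk
      rw [refKey_control h3]
      refine h.start _ k (hS.reached_pos hinit hctl rfl hk fun h' => absurd h' hnt) ?_
      rw [hk]
      rintro (h' | ⟨_, h'⟩)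
      · exact lt_irrefl _ h'
      · rw [show (s.skel.loc j).st = (s.loc j).pc.stage from rfl, hpc _ h1] at h'
        simp [PC.stage] at h'
  | trigger t h1 h2 h3 h4 =>
    have hs := hskel.resolve_left (by rw [hpc _ h1]; simp [PC.stage])
    refine h.external hinit hctl hS hs (fun _ => rfl) ?_ ?_ ?_ hdata
    · intro i
      dsimp only
      rw [State.loc_setLoc]
      split
      · rename_i hi; rw [hi]
      · rfl
    · intro i
      dsimp only
      rw [State.loc_setLoc]
      split
      · rename_i hi; simp [PC.stage]
      · exact fun _ => Or.inl rfl
    · dsimp only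
      rw [State.loc_setLoc]
      simp
  | regular t h1 h2 h3 h4 =>
    have hs := hskel.resolve_left (by rw [hpc _ h1]; simp [PC.stage])
    have hnt := mt ((hS.loc j).triggers_iff (hpc _ h1) h2 h3).1.2 h4
    refine h.external hinit hctl hS hs (fun _ => rfl) ?_ ?_ ?_ hdata
    · intro i
      rw [State.loc_setLoc]
      split
      · rename_i hi; rw [hi]
      · rfl
    · intro i
      rw [State.loc_setLoc]
      split
      · rename_i hi
        subst hi
        exact fun _ => Or.inr ⟨rfl, rfl, by rw [hpc _ h1]; simp [PC.stage], rfl,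
          fun h' => absurd h' hnt⟩
      · exact fun _ => Or.inl rfl
    · rw [State.loc_setLoc]
      simp
  | switch h1 =>
    have hs := hskel.resolve_left (by rw [hpc _ h1]; simp [PC.stage])
    refine h.external hinit hctl hS hs (fun _ => rfl) ?_ ?_ ?_ hdata
    · intro i
      rw [State.loc_setLoc]
      split
      · rename_i hi; rw [hi]
      · rfl
    · intro i
      rw [State.loc_setLoc]
      split
      · rename_i hi
        subst hi
        exact fun _ => Or.inr ⟨rfl, rfl, by rw [hpc _ h1]; simp [PC.stage], rfl,
          fun _ => by rw [hpc _ h1]; simp [PC.stage]⟩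
      · exact fun _ => Or.inl rfl
    · rw [State.loc_setLoc]
      simp
  | addReaders h1 =>
    have hs := hskel.resolve_left (by rw [hpc _ h1]; simp [PC.stage])
    have hidle : ∀ i, i ∉ s.readers → (s.loc i).pc.stage = 0 := by
      have h3 : (s.skel.loc j).st = 3 := hpc _ h1
      rcases hS.phase with ⟨_, _, h4⟩ | ⟨r, g, _, _, _, _, _, _, _, _, h10⟩ |
        ⟨r, g, _, _, _, h4, h6, h7, h8, h9⟩
      · exact absurd h3 (h4 j).1
      · exact fun i hi => (h10 i hi).1
      · exact absurd h3 (h9 j)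
    have hlocj : ∀ S, ((s.addReaders j S).goto j .removeReaders).loc j =
        { s.loc j with pc := .removeReaders } := by
      intro S
      rw [State.loc_goto, if_pos rfl]
      simp only [State.addReaders]
      split <;> rfl
    refine h.external hinit hctl hS hs (fun _ => rfl) ?_ ?_ ?_ hdata
    · intro i
      by_cases hi : i = j
      · rw [hi, hlocj]
      · rw [State.loc_goto, if_neg hi]
        simp only [State.addReaders]
        split <;> rfl
    · intro i
      by_cases hi : i = j
      · rw [hi, hlocj]
        simp [PC.stage]
      · rw [State.loc_goto, if_neg hi]
        simp only [State.addReaders]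
        split
        · rename_i hm
          have := hidle i (Finset.mem_sdiff.1 hm).2
          simp [this]
        · exact fun _ => Or.inl rfl
    · rw [hlocj]
      simp
  | leaveBarrier h1 _ | addSourcesTrue h1 _ | addSourcesFalse h1 _ | removeReadersTrue h1 _
  | removeReadersFalse h1 _ | removeSources h1 =>
    have hs := hskel.resolve_left (by rw [hpc _ h1]; simp [PC.stage])
    refine h.external hinit hctl hS hs (fun _ => rfl) ?_ ?_ ?_ hdata
    · intro i
      try dsimp only
      rw [State.loc_goto]
      split
      · rename_i hi; rw [hi]
      · rfl
    · intro i
      try dsimp only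
      rw [State.loc_goto]
      split
      · rename_i hi; simp [PC.stage]
      · exact fun _ => Or.inl rfl
    · try dsimp only
      rw [State.loc_goto]
      simp
  | skip t h1 h2 h3 =>
    have hs := hskel.resolve_left fun ⟨h', _⟩ => by
      have := congrArg (fun a => (a.loc j).pos) h'
      simp [State.skel, Local.skel, State.loc_setLoc] at this
    refine h.external hinit hctl hS hs (fun _ => rfl) ?_ ?_ ?_ hdata
    · intro i
      rw [State.loc_setLoc]
      split
      · rename_i hi; rw [hi]
      · rfl
    · intro i
      rw [State.loc_setLoc]
      split
      · rename_i hi; simp [PC.stage]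
      · exact fun _ => Or.inl rfl
    · intro _ k hk
      have h7 : (s.loc j).pc.stage = 7 := hpc _ h1
      have ha : s.skel.Active c₀ inp j k := ⟨h7, hk⟩
      have := (h.prog j k t ha h2).1
      rw [h1] at this
      rw [← this]
      have hf := (hS.cfg_f h7).1 ha
      simp only [Oper.remain, Oper.handleKey]
      rw [if_neg fun hm => h3 ⟨k, hm, hf⟩]
  | finish t ℓ h1 h2 h3 =>
    have hs := hskel.resolve_left fun ⟨h', _⟩ => by
      have := congrArg (fun a => (a.loc j).pos) h'
      simp [State.skel, Local.skel, State.loc_setLoc] at this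
    refine h.external hinit hctl hS hs (fun _ => rfl) ?_ ?_ ?_ hdata
    · intro i
      rw [State.loc_setLoc]
      split
      · rename_i hi; rw [hi]
      · rfl
    · intro i
      rw [State.loc_setLoc]
      split
      · rename_i hi; simp [PC.stage]
      · exact fun _ => Or.inl rfl
    · intro _ k hk
      have ha : s.skel.Active c₀ inp j k := ⟨hpc _ h1, hk⟩
      have := (h.prog j k t ha h2).1
      rw [h1] at this
      rw [← this]
      simp only [Oper.remain, Finset.notMem_empty, if_false]
      rw [op.updateFrom_of_not_lt h3, ite_self]
  | output k w h1 h2 h3 h4 h5 =>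
    have h7 : (s.loc j).pc.stage = 7 := hpc _ h1
    have hk := hact h7 k h5
    have hj := (hS.mem_O hinit hctl hk).2
    have hkey := s.key_forward hj k (o := op.prepareOutTuples w.l (op.fO (w.insts k)))
    have hlocj : ((s.forward j k (op.prepareOutTuples w.l (op.fO (w.insts k)))).goto j
        (.shift k w)).loc j = { s.loc j with pc := .shift k w } := by
      rw [State.loc_goto, if_pos rfl, State.loc_forward]
    refine h.internal hinit hctl hS h7 (hskel.resolve_right fun hs => ?_).1 ?_ ?_ ?_ ?_ ?_ ?_ ?_
    · have := hs.st_eq_zero h7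
      simp only [State.skel, hlocj] at this
      simp [Local.skel, PC.stage] at this
    · intro i hi
      rw [State.loc_goto, if_neg hi, State.loc_forward]
    · intro k'
      by_cases hk' : k' = k
      · subst hk'; exact Or.inr hk
      · left
        rw [State.key_goto, hkey, if_neg hk']
    · rw [hlocj]
      exact hrho h7
    · intro t _
      rw [hlocj]
      exact ⟨h5, by rw [State.σ_goto, State.σ_forward]; exact h3, h4⟩
    · rw [State.σ_goto, State.σ_forward]
      exact h.wf
    · rw [State.σ_goto, State.σ_forward]
      exact h.fin
    · intro k' t ha ht
      rw [hlocj, State.key_goto, hkey, h1, State.outs_goto]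
      have hout : s.outs k' <+: (s.forward j k (op.prepareOutTuples w.l (op.fO (w.insts k)))).outs k' := by
        have := congrArg Prod.snd (hkey k')
        simp only [State.key] at this
        rw [this]
        split
        · rename_i hk'; subst hk'; exact List.prefix_append _ _
        · exact List.prefix_rfl
      refine ⟨?_, hout⟩
      by_cases hk' : k' = k
      · subst hk'
        simp only [Oper.remain, if_true]
        have hW : (s.loc j).W = wmAt c₀ inp ((s.loc j).pos + 1) :=
          (hS.loc j).W_busy (show (s.loc j).pc.stage ≠ 0 by omega)
        rw [hW] at h2
        -- Unfold the round at `ρ` on both sides. Before the step it forwards the results of `w` and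
        -- shifts `w`; after the step the results are forwarded, `w` is shifted first, and the round
        -- itself finds only sets beyond `ρ`.
        rw [op.expireKey_of_lt hWA h2, op.expireKey_of_lt hWA h2 (s.key k'),
          op.drain_of_head hWA (x := s.key k') (h.wf k') h3 h4, op.drain_of_ne]
        · rfl
        · intro v hv
          have := (h.wf k').ne_of_mem_shiftFirst hWA h3 (List.mem_of_mem_head? hv)
          omega
      · simp only [Oper.remain, if_neg hk', if_neg (Ne.symm hk')]
  | shift k w h1 =>
    have h7 : (s.loc j).pc.stage = 7 := hpc _ h1
    have hl : (s.loc j).cfg.f k = j ∧ (s.σ k).head? = some w ∧ w.l = (s.loc j).ρ := by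
      simpa only [Local.LoopOK, h1] using hl
    have hk := hact h7 k hl.1
    have hkey := s.key_setKey k (ks := op.shiftFirst k w (s.σ k))
    have hlocj : ((s.setKey k (op.shiftFirst k w (s.σ k))).goto j .expire).loc j =
        { s.loc j with pc := .expire } := by
      rw [State.loc_goto, if_pos rfl]
      rfl
    refine h.internal hinit hctl hS h7 (hskel.resolve_right fun hs => ?_).1 ?_ ?_ ?_ ?_ ?_ ?_ ?_
    · have := hs.st_eq_zero h7
      simp only [State.skel, hlocj] at this
      simp [Local.skel, PC.stage] at this
    · intro i hi
      rw [State.loc_goto, if_neg hi]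
      rfl
    · intro k'
      by_cases hk' : k' = k
      · subst hk'; exact Or.inr hk
      · left
        rw [State.key_goto, hkey, if_neg hk']
    · rw [hlocj]
      exact hrho h7
    · intro t _
      rw [hlocj]
      trivial
    · rw [State.σ_goto]
      exact State.wf_setKey h.wf ((h.wf k).shiftFirst k w)
    · rw [State.σ_goto]
      exact State.finite_setKey h.fin _ _
    · intro k' t ha ht
      rw [hlocj, State.key_goto, hkey, h1, State.outs_goto]
      refine ⟨?_, List.prefix_rfl⟩
      by_cases hk' : k' = k
      · subst hk'
        simp only [Oper.remain, if_true]
        rfl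
      · simp only [Oper.remain, if_neg hk', if_neg (Ne.symm hk')]
  | advance h1 h2 h3 =>
    have h7 : (s.loc j).pc.stage = 7 := hpc _ h1
    have hW : (s.loc j).W = wmAt c₀ inp ((s.loc j).pos + 1) :=
      (hS.loc j).W_busy (show (s.loc j).pc.stage ≠ 0 by omega)
    rw [hW] at h2
    refine h.internal hinit hctl hS h7 (hskel.resolve_right fun hs => ?_).1 ?_
      (fun k => Or.inl rfl) ?_ ?_ h.wf h.fin ?_
    · have := hs.st_eq_zero h7
      simp [State.skel, State.loc_setLoc, Local.skel, PC.stage, h1] at this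
    · intro i hi
      rw [State.loc_setLoc, if_neg hi]
    · rw [State.loc_setLoc, if_pos rfl]
      exact (hrho h7).add h2
    · intro t _
      rw [State.loc_setLoc, if_pos rfl]
      simp [Local.LoopOK, h1]
    · intro k t ha ht
      rw [State.loc_setLoc, if_pos rfl]
      refine ⟨?_, List.prefix_rfl⟩
      dsimp only
      rw [h1]
      simp only [Oper.remain]
      -- No key of `j` has a set at `ρ`, so the round is idle for each of them.
      rw [op.expireKey_of_lt hWA h2 (s.key k), op.drain_of_ne (x := s.key k)]
      · rfl
      · exact fun w hw hwl => h3 ⟨k, w, hw, hwl, (hS.cfg_f h7).1 ha⟩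
  | expired h1 h2 =>
    have h7 : (s.loc j).pc.stage = 7 := hpc _ h1
    have hW : (s.loc j).W = wmAt c₀ inp ((s.loc j).pos + 1) :=
      (hS.loc j).W_busy (show (s.loc j).pc.stage ≠ 0 by omega)
    rw [hW] at h2
    refine h.internal hinit hctl hS h7 (hskel.resolve_right fun hs => ?_).1 ?_
      (fun k => Or.inl rfl) ?_ ?_ h.wf h.fin ?_
    · have := hs.st_eq_zero h7
      simp [State.skel, State.loc_goto, Local.skel, PC.stage] at this
    · intro i hi
      rw [State.loc_goto, if_neg hi]
    · rw [State.loc_goto, if_pos rfl]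
      exact hrho h7
    · intro t _
      rw [State.loc_goto, if_pos rfl]
      trivial
    · intro k t ha ht
      rw [State.loc_goto, if_pos rfl, h1]
      refine ⟨?_, List.prefix_rfl⟩
      simp only [Oper.remain]
      rw [op.expireKey_of_not_lt h2]
      rfl
  | handle t h1 h2 h3 =>
    have h7 : (s.loc j).pc.stage = 7 := hpc _ h1
    refine h.internal hinit hctl hS h7 (hskel.resolve_right fun hs => ?_).1 ?_
      (fun k => Or.inl rfl) ?_ ?_ h.wf h.fin ?_
    · have := hs.st_eq_zero h7
      simp [State.skel, State.loc_setLoc, Local.skel, PC.stage] at this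
    · intro i hi
      rw [State.loc_setLoc, if_neg hi]
    · rw [State.loc_setLoc, if_pos rfl]
      exact (hrho h7).min (op.dvd_earliestWinL t)
    · intro t' ht'
      rw [h2] at ht'
      cases ht'
      rw [State.loc_setLoc, if_pos rfl]
      intro t' ht'
      dsimp only at ht'
      rw [h2] at ht'
      cases ht'
      exact ⟨op.numWin_pos t, fun k hk => Finset.mem_filter.1 hk⟩
    · intro k t' ha ht'
      rw [h2] at ht'
      cases ht'
      rw [State.loc_setLoc, if_pos rfl, h1]
      refine ⟨?_, List.prefix_rfl⟩
      have hf := (hS.cfg_f h7).1 ha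
      by_cases hk : k ∈ op.fMK t
      · simp only [Oper.remain, Oper.handleKey, hk, if_true, Finset.mem_filter, hf, and_self]
        rfl
      · simp only [Oper.remain, Oper.handleKey, hk, if_false]
        rfl
  | create t ℓ S k h1 h2 h3 =>
    have h7 : (s.loc j).pc.stage = 7 := hpc _ h1
    have hl : ℓ < op.numWin t ∧ ∀ k ∈ S, k ∈ op.fMK t ∧ (s.loc j).cfg.f k = j := by
      simp only [Local.LoopOK, h1] at hl
      exact hl t h2
    have hk := hact h7 k (hl.2 k h3).2
    have hkey := s.key_setKey k (ks := op.checkCreate (s.σ k) (op.winL t ℓ))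
    have hlocj : ((s.setKey k (op.checkCreate (s.σ k) (op.winL t ℓ))).goto j
        (.read ℓ (S.erase k) k)).loc j = { s.loc j with pc := .read ℓ (S.erase k) k } := by
      rw [State.loc_goto, if_pos rfl]
      rfl
    refine h.internal hinit hctl hS h7 (hskel.resolve_right fun hs => ?_).1 ?_ ?_ ?_ ?_ ?_ ?_ ?_
    · have := hs.st_eq_zero h7
      simp only [State.skel, hlocj] at this
      simp [Local.skel, PC.stage] at this
    · intro i hi
      rw [State.loc_goto, if_neg hi]
      rfl
    · intro k'
      by_cases hk' : k' = k
      · subst hk'; exact Or.inr hk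
      · left
        rw [State.key_goto, hkey, if_neg hk']
    · rw [hlocj]
      exact hrho h7
    · intro t' _
      rw [hlocj]
      intro t'' ht'
      dsimp only at ht'
      rw [h2] at ht'
      cases ht'
      refine ⟨hl.1, fun k' hk' => hl.2 k' (Finset.mem_of_mem_erase hk'),
        ⟨(hl.2 k h3).1, (hl.2 k h3).2, Finset.notMem_erase k S⟩, ?_⟩
      simpa [State.σ_goto, State.setKey] using op.isSome_lookup_checkCreate (s.σ k) (op.winL t ℓ)
    · rw [State.σ_goto]
      exact State.wf_setKey h.wf ((h.wf k).checkCreate _)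
    · rw [State.σ_goto]
      exact State.finite_setKey h.fin _ _
    · intro k' t' ha ht'
      rw [h2] at ht'
      cases ht'
      rw [hlocj, State.key_goto, hkey, h1, State.outs_goto]
      refine ⟨?_, List.prefix_rfl⟩
      by_cases hk' : k' = k
      · subst hk'
        simp only [Oper.remain, if_true, h3, (hl.2 k' h3).1]
        rw [op.updateFrom_of_lt hl.1]
        congr 1
      · simp only [Oper.remain, if_neg (Ne.symm hk'), Finset.mem_erase, ne_eq, hk',
          not_false_eq_true, true_and, if_false]
  | compute t ℓ S k w h1 h2 h3 =>
    have h7 : (s.loc j).pc.stage = 7 := hpc _ h1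
    have hl : ℓ < op.numWin t ∧ (∀ k ∈ S, k ∈ op.fMK t ∧ (s.loc j).cfg.f k = j) ∧
        (k ∈ op.fMK t ∧ (s.loc j).cfg.f k = j ∧ k ∉ S) ∧
        (op.lookup (s.σ k) (op.winL t ℓ)).isSome := by
      simp only [Local.LoopOK, h1] at hl
      exact hl t h2
    have hk := hact h7 k hl.2.2.1.2.1
    have hj := (hS.mem_O hinit hctl hk).2
    have hkey := s.key_forward hj k (o := op.prepareOutTuples w.l (op.fU (w.insts k) t).2)
    have hlocj : ((s.forward j k (op.prepareOutTuples w.l (op.fU (w.insts k) t).2)).goto j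
        (.write ℓ S k (op.fU (w.insts k) t).1)).loc j =
          { s.loc j with pc := .write ℓ S k (op.fU (w.insts k) t).1 } := by
      rw [State.loc_goto, if_pos rfl, State.loc_forward]
    refine h.internal hinit hctl hS h7 (hskel.resolve_right fun hs => ?_).1 ?_ ?_ ?_ ?_ ?_ ?_ ?_
    · have := hs.st_eq_zero h7
      simp only [State.skel, hlocj] at this
      simp [Local.skel, PC.stage] at this
    · intro i hi
      rw [State.loc_goto, if_neg hi, State.loc_forward]
    · intro k'
      by_cases hk' : k' = k
      · subst hk'; exact Or.inr hk
      · left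
        rw [State.key_goto, hkey, if_neg hk']
    · rw [hlocj]
      exact hrho h7
    · intro t' _
      rw [hlocj]
      intro t'' ht'
      dsimp only at ht'
      rw [h2] at ht'
      cases ht'
      exact ⟨hl.1, hl.2.1, hl.2.2.1⟩
    · rw [State.σ_goto, State.σ_forward]
      exact h.wf
    · rw [State.σ_goto, State.σ_forward]
      exact h.fin
    · intro k' t' ha ht'
      rw [h2] at ht'
      cases ht'
      rw [hlocj, State.key_goto, hkey, h1, State.outs_goto]
      have hout : s.outs k' <+: (s.forward j k
          (op.prepareOutTuples w.l (op.fU (w.insts k) t).2)).outs k' := by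
        have := congrArg Prod.snd (hkey k')
        simp only [State.key] at this
        rw [this]
        split
        · rename_i hk'; subst hk'; exact List.prefix_append _ _
        · exact List.prefix_rfl
      refine ⟨?_, hout⟩
      by_cases hk' : k' = k
      · subst hk'
        simp only [Oper.remain, if_true, State.key, h3]
      · simp only [Oper.remain, if_neg hk', if_neg (Ne.symm hk')]
  | write t ℓ S k ζ h1 h2 =>
    have h7 : (s.loc j).pc.stage = 7 := hpc _ h1
    have hl : ℓ < op.numWin t ∧ (∀ k ∈ S, k ∈ op.fMK t ∧ (s.loc j).cfg.f k = j) ∧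
        (k ∈ op.fMK t ∧ (s.loc j).cfg.f k = j ∧ k ∉ S) := by
      simp only [Local.LoopOK, h1] at hl
      exact hl t h2
    have hk := hact h7 k hl.2.2.2.1
    have hkey := s.key_setKey k (ks := op.setStates (s.σ k) (op.winL t ℓ) ζ)
    have hlocj : ((s.setKey k (op.setStates (s.σ k) (op.winL t ℓ) ζ)).goto j
        (.update ℓ S)).loc j = { s.loc j with pc := .update ℓ S } := by
      rw [State.loc_goto, if_pos rfl]
      rfl
    refine h.internal hinit hctl hS h7 (hskel.resolve_right fun hs => ?_).1 ?_ ?_ ?_ ?_ ?_ ?_ ?_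
    · have := hs.st_eq_zero h7
      simp only [State.skel, hlocj] at this
      simp [Local.skel, PC.stage] at this
    · intro i hi
      rw [State.loc_goto, if_neg hi]
      rfl
    · intro k'
      by_cases hk' : k' = k
      · subst hk'; exact Or.inr hk
      · left
        rw [State.key_goto, hkey, if_neg hk']
    · rw [hlocj]
      exact hrho h7
    · intro t' _
      rw [hlocj]
      intro t'' ht'
      dsimp only at ht'
      rw [h2] at ht'
      cases ht'
      exact ⟨hl.1, hl.2.1⟩
    · rw [State.σ_goto]
      exact State.wf_setKey h.wf ((h.wf k).setStates _ _)
    · rw [State.σ_goto]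
      exact State.finite_setKey h.fin _ _
    · intro k' t' ha ht'
      rw [h2] at ht'
      cases ht'
      rw [hlocj, State.key_goto, hkey, h1, State.outs_goto]
      refine ⟨?_, List.prefix_rfl⟩
      by_cases hk' : k' = k
      · subst hk'
        simp only [Oper.remain, if_true, hl.2.2.1, hl.2.2.2.2, if_false]
        rfl
      · simp only [Oper.remain, if_neg hk', if_neg (Ne.symm hk')]
  | nextRound t ℓ h1 h2 h3 =>
    have h7 : (s.loc j).pc.stage = 7 := hpc _ h1
    refine h.internal hinit hctl hS h7 (hskel.resolve_right fun hs => ?_).1 ?_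
      (fun k => Or.inl rfl) ?_ ?_ h.wf h.fin ?_
    · have := hs.st_eq_zero h7
      simp [State.skel, State.loc_goto, Local.skel, PC.stage] at this
    · intro i hi
      rw [State.loc_goto, if_neg hi]
    · rw [State.loc_goto, if_pos rfl]
      exact hrho h7
    · intro t' _
      rw [State.loc_goto, if_pos rfl]
      intro t'' ht'
      dsimp only at ht'
      rw [h2] at ht'
      cases ht'
      exact ⟨h3, fun k hk => Finset.mem_filter.1 hk⟩
    · intro k t' ha ht'
      rw [h2] at ht'
      cases ht'
      rw [State.loc_goto, if_pos rfl, h1]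
      refine ⟨?_, List.prefix_rfl⟩
      have hf := (hS.cfg_f h7).1 ha
      by_cases hk : k ∈ op.fMK t
      · simp only [Oper.remain, hk, if_true, Finset.mem_filter, hf, and_self, Finset.notMem_empty,
          if_false]
        rfl
      · simp only [Oper.remain, hk, if_false]
        rfl

end
end DataSteps

/-! ## Safety -/

section Safety

variable {I : ℕ} {K Z P Q ι : Type*} [DecidableEq K] [DecidableEq ι]
variable {op : Oper I K Z P Q} {c₀ : Ctl K ι} {inp : ℕ → Item I P K ι}
variable {s s' : State I K Z Q ι} {N : ℕ} {j : ι}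

/-- Even with infinitely many instances the cursors stay bounded in every reachable state, so that
for each key some item has not been reached. -/
theorem SStep.pos_le {a a' : Skel K ι} (hs : SStep inp j a a') {B : ℕ}
    (hB : ∀ i, (a.loc i).pos ≤ B) (i : ι) : (a'.loc i).pos ≤ B + 1 := by
  have hj := hB j
  have hi := hB i
  have key : ∀ L : SLoc K ι, L.pos ≤ (a.loc j).pos + 1 →
      (Function.update a.loc j L i).pos ≤ B + 1 := by
    intro L hL
    by_cases h : i = j
    · subst h; rw [Function.update_self]; omega
    · rw [Function.update_of_ne h]; omega
  cases hs with
  | addReaders =>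
    dsimp only
    split
    · dsimp only; omega
    split
    · dsimp only; omega
    · omega
  | _ => exact key _ (by simp)

theorem DInv.active_of_updating (hS : SInv c₀ inp s.skel N) (h : DInv op c₀ inp s) {k : K}
    (hu : s.Updating j k) : s.skel.Active c₀ inp j k := by
  have hl := h.loops j
  have hpc : ∀ pc, (s.loc j).pc = pc → (s.loc j).pc.stage = pc.stage := fun pc h => by rw [h]
  rcases hu with ⟨w, hw⟩ | ⟨ℓ, S, hw⟩ | ⟨ℓ, S, ζ, hw⟩
  · simp only [Local.LoopOK, hw] at hl
    exact (hS.cfg_f (hpc _ hw)).2 hl.1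
  · obtain ⟨t, ht⟩ := (hS.loc j).is_data (by
      show (s.loc j).pc.stage ≠ 0
      rw [hw]; simp [PC.stage])
    simp only [Local.LoopOK, hw] at hl
    exact (hS.cfg_f (hpc _ hw)).2 (hl t ht).2.2.1.2.1
  · obtain ⟨t, ht⟩ := (hS.loc j).is_data (by
      show (s.loc j).pc.stage ≠ 0
      rw [hw]; simp [PC.stage])
    simp only [Local.LoopOK, hw] at hl
    exact (hS.cfg_f (hpc _ hw)).2 (hl t ht).2.2.2.1

/-- A step changes at most the keys that the acting instance is responsible for. -/
theorem DInv.key_eq_or_active (hS : SInv c₀ inp s.skel N) (h : DInv op c₀ inp s)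
    (hst : Step op inp j s s') (k : K) : s'.key k = s.key k ∨ s.skel.Active c₀ inp j k := by
  have hfw : ∀ (k' : K) o pc, ((s.forward j k' o).goto j pc).key k = s.key k ∨ k = k' := by
    intro k' o pc
    rw [State.key_goto]
    by_cases hj : j ∈ s.sources
    · rw [s.key_forward hj]
      by_cases hk : k = k'
      · exact Or.inr hk
      · exact Or.inl (if_neg hk)
    · left
      rw [State.forward, if_neg hj]
  have hset : ∀ (k' : K) ks pc, ((s.setKey k' ks).goto j pc).key k = s.key k ∨ k = k' := by
    intro k' ks pc
    rw [State.key_goto, s.key_setKey]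
    by_cases hk : k = k'
    · exact Or.inr hk
    · exact Or.inl (if_neg hk)
  have hl := h.loops j
  cases hst with
  | output k' w h1 h2 h3 h4 h5 =>
    refine (hfw k' _ _).imp_right ?_
    rintro rfl
    exact (hS.cfg_f (by rw [h1]; rfl)).2 h5
  | shift k' w h1 =>
    refine (hset k' _ _).imp_right ?_
    rintro rfl
    exact h.active_of_updating hS (Or.inl ⟨w, h1⟩)
  | create t ℓ S k' h1 h2 h3 =>
    refine (hset k' _ _).imp_right ?_
    rintro rfl
    simp only [Local.LoopOK, h1] at hl
    exact (hS.cfg_f (by rw [h1]; rfl)).2 ((hl t h2).2 k h3).2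
  | compute t ℓ S k' w h1 h2 h3 =>
    refine (hfw k' _ _).imp_right ?_
    rintro rfl
    exact h.active_of_updating hS (Or.inr (Or.inl ⟨ℓ, S, h1⟩))
  | write t ℓ S k' ζ h1 h2 =>
    refine (hset k' _ _).imp_right ?_
    rintro rfl
    exact h.active_of_updating hS (Or.inr (Or.inr ⟨ℓ, S, ζ, h1⟩))
  | _ => exact Or.inl rfl

section
variable (hinit : c₀.Valid) (hctl : ValidReconfigs c₀ inp)
include hinit hctl

/-- An instance idle at item `n` has not arrived at its barrier, so a successor on `k` cannot have
started the item. Without a trigger, the successor is the idle instance itself. -/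
theorem DInv.key_eq (hS : SInv c₀ inp s.skel N) (h : DInv op c₀ inp s) {n : ℕ} {k : K}
    (hk : (cfgAt c₀ inp n).f k = j) (hd : s.DoneWith j n) : s.key k = refKey op inp n k := by
  obtain ⟨h0, hp⟩ := hd
  refine h.start n k (by unfold Skel.Reached; rw [hk]; exact hp.ge) fun hstart => ?_
  have hst : (s.skel.loc j).st = 0 := by
    show (s.loc j).pc.stage = 0
    rw [h0]
    rfl
  have hp : (s.skel.loc j).pos = n := hp
  by_cases hT : Triggers c₀ inp n
  · have h1 := hS.bar ((cfgAt c₀ inp (n + 1)).f k) n hT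
      (by unfold SLoc.PastBarrier SLoc.Started at *; omega) j
      (hk ▸ (cfgAt_valid hinit hctl n).2.1 k)
    have := (hS.loc j).arr_idle hst
    omega
  · rw [(cfgAt_not_triggers hT).2.2, hk] at hstart
    unfold SLoc.Started at hstart
    omega

variable (hWA : 0 < op.WA) (hWS : op.WA ≤ op.WS) (hwm : Watermarked inp)
  (hstart : ∀ n t, inp n = .data t → (op.fMK t).Nonempty → 0 ≤ op.earliestWinL t)

include hWA in
/-- The outputs of a key lie between those of the reference before and after the item that is next
for the key. -/
theorem DInv.outs_between (hS : SInv c₀ inp s.skel N) (h : DInv op c₀ inp s)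
    (hpre : ∀ n k, (refKey op inp n k).2 <+: (refKey op inp (n + 1) k).2)
    {B : ℕ} (hB : ∀ i, (s.loc i).pos ≤ B) (k : K) :
    ∃ n, ¬ s.skel.Reached c₀ inp k (n + 1) ∧
      (refKey op inp n k).2 <+: s.outs k ∧ s.outs k <+: (refKey op inp (n + 1) k).2 := by
  classical
  -- The cursors are bounded by `B`, so nobody has completed `B + 1` items; the least `n` found has
  -- itself been reached.
  have hex : ∃ n, ¬ s.skel.Reached c₀ inp k (n + 1) := ⟨B, fun h' => by
    have h' : B + 1 ≤ (s.loc ((cfgAt c₀ inp (B + 1)).f k)).pos := h'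
    have := hB ((cfgAt c₀ inp (B + 1)).f k)
    omega⟩
  set n := Nat.find hex with hn
  have hnr : ¬ s.skel.Reached c₀ inp k (n + 1) := Nat.find_spec hex
  have hr : s.skel.Reached c₀ inp k n := by
    rcases Nat.eq_zero_or_pos n with h0 | h0
    · rw [h0]; exact Nat.zero_le _
    · have := Nat.find_min hex (m := n - 1) (by omega)
      rw [not_not, Nat.sub_add_cancel h0] at this
      exact this
  refine ⟨n, hnr, ?_⟩
  by_cases hst : (s.skel.loc ((cfgAt c₀ inp (n + 1)).f k)).Started n
  · rcases hst with hst | ⟨hp, h7⟩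
    · exact absurd hst hnr
    · have ha : s.skel.Active c₀ inp ((cfgAt c₀ inp (n + 1)).f k) k := ⟨h7, by rw [← hp]⟩
      obtain ⟨t, ht⟩ := (hS.loc ((cfgAt c₀ inp (n + 1)).f k)).is_data (by omega)
      obtain ⟨h1, h2⟩ := h.prog _ k t ha ht
      have hp' : (s.loc ((cfgAt c₀ inp (n + 1)).f k)).pos = n := hp.symm
      rw [hp'] at h1 h2
      refine ⟨h2, ?_⟩
      rw [← h1]
      exact op.prefix_remain hWA t _ _ k _ (s.key k)
  · have hkey : s.key k = refKey op inp n k := h.start n k hr hst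
    have hkey : s.outs k = (refKey op inp n k).2 := congrArg Prod.snd hkey
    rw [hkey]
    exact ⟨List.prefix_rfl, hpre n k⟩

include hWA hWS hwm hstart

/-- The invariants hold in every reachable state. -/
theorem inv_of_reachable (hr : Reachable op c₀ inp s) :
    (∃ N, SInv c₀ inp s.skel N) ∧ DInv op c₀ inp s ∧ ∃ B, ∀ i, (s.loc i).pos ≤ B := by
  induction hr with
  | refl => exact ⟨⟨0, SInv.initial⟩, DInv.initial, 0, fun _ => le_rfl⟩
  | tail _ hst ih =>
    obtain ⟨⟨N, hS⟩, hD, B, hB⟩ := ih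
    obtain ⟨j, hst⟩ := hst
    refine ⟨?_, hD.step hinit hctl hWA hS hst
      fun n t ρ k ht hρ => refKey_data hWA hWS hwm hstart ht hρ k, ?_⟩
    · rcases hst.skel with ⟨he, _⟩ | hs
      · exact ⟨N, he ▸ hS⟩
      · exact hS.step hinit hctl hs
    · rcases hst.skel with ⟨he, _⟩ | hs
      · refine ⟨B, fun i => ?_⟩
        have : (_ : ℕ) = _ := congrArg (fun a => (a.loc i).pos) he
        exact this.le.trans (hB i)
      · exact ⟨B + 1, hs.pos_le hB⟩

theorem updates_exclusive (hr : Reachable op c₀ inp s) :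
    (∀ i j k, s.Updating i k → s.Updating j k → i = j) ∧
      (∀ j s' k, Step op inp j s s' → s'.σ k ≠ s.σ k ∨ s'.outs k ≠ s.outs k →
        (epochAt c₀ inp ((s.loc j).pos + 1)).2.f k = j ∧
        j ∈ s.readers ∧ j ∈ s.sources ∧ ∀ i, i ≠ j → ¬ s.Updating i k) := by
  obtain ⟨⟨N, hS⟩, hD, -⟩ := inv_of_reachable hinit hctl hWA hWS hwm hstart hr
  refine ⟨fun i j k hi hj => hS.active_unique hinit hctl (hD.active_of_updating hS hi)
    (hD.active_of_updating hS hj), fun j s' k hst hne => ?_⟩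
  have ha := (hD.key_eq_or_active hS hst k).resolve_left fun he => by
    simp only [State.key, Prod.mk.injEq] at he
    tauto
  obtain ⟨h1, h2⟩ := hS.mem_O hinit hctl ha
  exact ⟨ha.2, h1, h2, fun i hi hu =>
    hi (hS.active_unique hinit hctl (hD.active_of_updating hS hu) ha)⟩

theorem state_consistent (hr : Reachable op c₀ inp s) :
    (∀ n k j, (epochAt c₀ inp n).2.f k = j → s.DoneWith j n →
        s.σ k = (refAt op inp n).σ k ∧ s.outs k = (refAt op inp n).outs k) ∧
      (∀ k, ∃ n, s.outs k <+: (refAt op inp n).outs k) := by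
  obtain ⟨⟨N, hS⟩, hD, B, hB⟩ := inv_of_reachable hinit hctl hWA hWS hwm hstart hr
  refine ⟨fun n k j hk hd => ?_, fun k => ?_⟩
  · exact Prod.mk.inj (hD.key_eq hinit hctl hS hk hd)
  · obtain ⟨n, _, _, h⟩ := hD.outs_between hinit hctl hWA hS
      (fun n k => refKey_prefix_succ hWA hWS hwm hstart n k c₀) hB k
    exact ⟨n + 1, h⟩

theorem connections_consistent (hr : Reachable op c₀ inp s) (n : ℕ) :
    (∀ j ∈ (epochAt c₀ inp n).2.O, s.DoneWith j n →
        s.readers ⊆ (epochAt c₀ inp n).2.O ∧ (epochAt c₀ inp n).2.O ⊆ s.sources) ∧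
      ((∀ i, (s.loc i).pc = .idle) → (∀ j ∈ (epochAt c₀ inp n).2.O, (s.loc j).pos = n) →
        s.readers = (epochAt c₀ inp n).2.O ∧ s.sources = (epochAt c₀ inp n).2.O) := by
  obtain ⟨⟨N, hS⟩, hD, -⟩ := inv_of_reachable hinit hctl hWA hWS hwm hstart hr
  have hO : ∀ j ∈ (epochAt c₀ inp n).2.O, s.DoneWith j n →
      (epochAt c₀ inp n).2.O = (cfgAt c₀ inp N).O := by
    rintro j hj ⟨h0, rfl⟩
    exact (hS.idle_at hj (PC.stage_eq_zero.2 h0)).2.1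
  refine ⟨fun j hj hd => ?_, fun hidle hpos => ?_⟩
  · rw [hO j hj hd]
    exact ⟨hS.readers_subset, hS.subset_sources⟩
  · obtain ⟨j, hj⟩ := (cfgAt_valid hinit hctl n).1
    rw [hO j hj ⟨hidle j, hpos j hj⟩]
    have hst : ∀ i, (s.skel.loc i).st = 0 := fun i => PC.stage_eq_zero.2 (hidle i)
    -- Each of the two intermediate phases contains a busy instance.
    rcases hS.phase with ⟨h1, h2, h4⟩ | ⟨r, g, h0, h1, h2, h4, h6, h7, h8, h9, h10⟩ |
      ⟨r, g, h0, h1, h2, h4, h6, h7, h8, h9⟩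
    · exact ⟨h1, h2⟩
    · have := hst r; omega
    · have := hst r; omega

end

end Safety

/-! ## Progress of a single instance -/

section Progress

variable {I : ℕ} {K Z P Q ι : Type*} [DecidableEq K] [DecidableEq ι]
variable {op : Oper I K Z P Q} {c₀ : Ctl K ι} {inp : ℕ → Item I P K ι}
variable {s s' : State I K Z Q ι} {N : ℕ} {j : ι}

/-- Only `addReaders` writes into the variables of other instances, and only into those of idle ones
that are not connected. -/
theorem SInv.step_loc_eq (hS : SInv c₀ inp s.skel N) (hst : Step op inp j s s') {i : ι}
    (hi : i ≠ j) (hb : i ∈ s.readers ∨ (s.loc i).pc.stage ≠ 0) : s'.loc i = s.loc i := by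
  cases hst with
  | addReaders h1 =>
    rw [State.loc_goto, if_neg hi]
    simp only [State.addReaders]
    refine if_neg fun hm => ?_
    have hr := (Finset.mem_sdiff.1 hm).2
    have h3 : (s.skel.loc j).st = 3 := by
      show (s.loc j).pc.stage = 3
      rw [h1]; rfl
    rcases hS.phase with ⟨_, _, h4⟩ | ⟨r, g, h0, _, h2, h4, h6, h7, h8, h9, h10⟩ |
        ⟨r, g, h0, _, h2, h4, h6, h7, h8, h9⟩
    · exact (h4 j).1 h3
    · exact hb.resolve_left hr (h10 i hr).1
    · exact h9 j h3
  | _ => simp [State.loc_goto, State.loc_setLoc, hi, State.loc_forward, State.setKey]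

/-- The keys whose first set `j` still has to process at the current value of `ρ`. -/
def State.heads (s : State I K Z Q ι) (j : ι) : Set K :=
  {k | (s.loc j).cfg.f k = j ∧ ∃ w, (s.σ k).head? = some w ∧ w.l = (s.loc j).ρ}

theorem DInv.finite_heads (h : DInv op c₀ inp s) (j : ι) : (s.heads j).Finite :=
  h.fin.subset fun k hk => by
    obtain ⟨_, w, hw, _⟩ := hk
    intro h0
    simp [h0] at hw

/-- The number of rounds of the update loop for an item. -/
def Oper.rounds (op : Oper I K Z P Q) : Item I P K ι → ℕ
  | .data t => op.numWin t
  | .control _ => 0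

variable (op inp) in
/-- A bound for the work that is left for the tuple that `j` processes. -/
noncomputable def State.work (s : State I K Z Q ι) (j : ι) : ℕ ×ₗ ℕ ×ₗ ℕ :=
  match (s.loc j).pc with
  | .idle => toLex (0, toLex (0, 0))
  | .barrier => toLex (9, toLex (0, 0))
  | .addSources => toLex (8, toLex (0, 0))
  | .addReaders => toLex (7, toLex (0, 0))
  | .removeReaders => toLex (6, toLex (0, 0))
  | .removeSources => toLex (5, toLex (0, 0))
  | .switch => toLex (4, toLex (0, 0))
  -- Each key with a set at `ρ` counts twice, for reading and for shifting this set.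
  | .expire =>
      toLex (3, toLex (((s.loc j).W - ((s.loc j).ρ + op.WS)).toNat, 2 * (s.heads j).ncard))
  | .shift k _ =>
      toLex (3, toLex (((s.loc j).W - ((s.loc j).ρ + op.WS)).toNat,
        2 * (s.heads j \ {k}).ncard + 1))
  | .handle => toLex (2, toLex (0, 0))
  -- Each key that is left counts three times, for creating, computing and writing.
  | .update ℓ S => toLex (1, toLex (op.rounds (inp (s.loc j).pos) - ℓ, 3 * S.card))
  | .read ℓ S _ => toLex (1, toLex (op.rounds (inp (s.loc j).pos) - ℓ, 3 * S.card + 2))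
  | .write ℓ S _ _ => toLex (1, toLex (op.rounds (inp (s.loc j).pos) - ℓ, 3 * S.card + 1))

theorem lex_lt_iff {a b c a' b' c' : ℕ} :
    (toLex (a, toLex (b, c)) : ℕ ×ₗ ℕ ×ₗ ℕ) < toLex (a', toLex (b', c')) ↔
      a < a' ∨ a = a' ∧ (b < b' ∨ b = b' ∧ c < c') := by
  simp [Prod.Lex.toLex_lt_toLex]

/-- A step of a busy instance completes its tuple or reduces the work that is left. -/
theorem DInv.work_lt (hWA : 0 < op.WA) (h : DInv op c₀ inp s)
    (hb : (s.loc j).pc.stage ≠ 0) (hst : Step op inp j s s') :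
    ((s'.loc j).pc.stage = 0 ∧ (s'.loc j).pos = (s.loc j).pos + 1) ∨
      -- The bound `2` says that the barrier lies behind, so that `exists_done` can iterate without
      -- any further assumption on it.
      (2 ≤ (s'.loc j).pc.stage ∧ (s'.loc j).pos = (s.loc j).pos ∧
        s'.work op inp j < s.work op inp j) := by
  have hl := h.loops j
  cases hst with
  | control c h1 | trigger t h1 | regular t h1 => simp [h1, PC.stage] at hb
  | leaveBarrier h1 _ | addSourcesTrue h1 _ | addSourcesFalse h1 _ | removeReadersTrue h1 _
  | removeReadersFalse h1 _ | removeSources h1 =>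
    right
    simp [State.work, State.loc_goto, PC.stage, h1, Prod.Lex.toLex_lt_toLex]
  | addReaders h1 =>
    right
    have hloc : (((s.addReaders j ((s.loc j).cfg.ON \ (s.loc j).cfg.O)).goto j .removeReaders).loc j) =
        { s.loc j with pc := .removeReaders } := by
      rw [State.loc_goto, if_pos rfl]
      simp only [State.addReaders]
      split <;> rfl
    simp only [State.work, hloc, h1]
    exact ⟨by simp [PC.stage], trivial, by simp [lex_lt_iff]⟩
  | switch h1 =>
    right
    simp [State.work, State.loc_setLoc, PC.stage, h1, Prod.Lex.toLex_lt_toLex]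
  | skip t h1 | finish t ℓ h1 =>
    left
    simp [State.loc_setLoc, PC.stage]
  | output k w h1 h2 h3 h4 h5 =>
    right
    set o := op.prepareOutTuples w.l (op.fO (w.insts k))
    have hloc : ((s.forward j k o).goto j (.shift k w)).loc j =
        { s.loc j with pc := .shift k w } := by
      rw [State.loc_goto, if_pos rfl, State.loc_forward]
    have hheads : ((s.forward j k o).goto j (.shift k w)).heads j = s.heads j := by
      simp only [State.heads, hloc, State.σ_goto, State.σ_forward]
    have hk : k ∈ s.heads j := ⟨h5, w, h3, h4⟩
    have := Set.ncard_sdiff_singleton_lt_of_mem hk (h.finite_heads j)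
    simp only [State.work, hheads, hloc, h1]
    exact ⟨by simp [PC.stage], trivial, lex_lt_iff.2 (Or.inr ⟨rfl, Or.inr ⟨rfl, by omega⟩⟩)⟩
  | shift k w h1 =>
    right
    have hl : (s.loc j).cfg.f k = j ∧ (s.σ k).head? = some w ∧ w.l = (s.loc j).ρ := by
      simpa only [Local.LoopOK, h1] using hl
    have hloc : ((s.setKey k (op.shiftFirst k w (s.σ k))).goto j .expire).loc j =
        { s.loc j with pc := .expire } := by
      rw [State.loc_goto, if_pos rfl]
      rfl
    -- After the shift all sets of `k` lie beyond `ρ`, so `k` drops out.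
    have hheads : ((s.setKey k (op.shiftFirst k w (s.σ k))).goto j .expire).heads j ⊆
        s.heads j \ {k} := by
      rintro k' ⟨hf, v, hv, hvl⟩
      rw [hloc] at hf hvl
      rw [State.σ_goto] at hv
      have hne : k' ≠ k := by
        rintro rfl
        simp only [State.setKey, Function.update_self] at hv
        have := (h.wf k').ne_of_mem_shiftFirst hWA hl.2.1 (List.mem_of_mem_head? hv)
        have := hl.2.2
        dsimp only at hvl
        omega
      refine ⟨⟨hf, v, ?_, hvl⟩, hne⟩
      simpa [State.setKey, hne] using hv
    have := Set.ncard_le_ncard hheads ((h.finite_heads j).subset Set.sdiff_subset)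
    simp only [State.work, hloc, h1]
    exact ⟨by simp [PC.stage], trivial, lex_lt_iff.2 (Or.inr ⟨rfl, Or.inr ⟨rfl, by omega⟩⟩)⟩
  | advance h1 h2 h3 =>
    right
    simp only [State.work, State.loc_setLoc, if_true, h1]
    refine ⟨by simp [PC.stage], trivial, lex_lt_iff.2 (Or.inr ⟨rfl, Or.inl ?_⟩)⟩
    omega
  | expired h1 h2 =>
    right
    simp [State.work, State.loc_goto, PC.stage, h1, Prod.Lex.toLex_lt_toLex]
  | handle t h1 h2 h3 =>
    right
    simp [State.work, State.loc_setLoc, PC.stage, h1, Prod.Lex.toLex_lt_toLex]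
  | create t ℓ S k h1 h2 h3 =>
    right
    have := Finset.card_erase_lt_of_mem h3
    simp only [State.work, State.loc_goto, if_true, h1, State.setKey]
    exact ⟨by simp [PC.stage], trivial, lex_lt_iff.2 (Or.inr ⟨rfl, Or.inr ⟨rfl, by omega⟩⟩)⟩
  | compute t ℓ S k w h1 h2 h3 =>
    right
    simp only [State.work, State.loc_goto, if_true, h1, State.loc_forward]
    exact ⟨by simp [PC.stage], trivial, lex_lt_iff.2 (Or.inr ⟨rfl, Or.inr ⟨rfl, by omega⟩⟩)⟩
  | write t ℓ S k ζ h1 h2 =>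
    right
    simp only [State.work, State.loc_goto, if_true, h1, State.setKey]
    exact ⟨by simp [PC.stage], trivial, lex_lt_iff.2 (Or.inr ⟨rfl, Or.inr ⟨rfl, by omega⟩⟩)⟩
  | nextRound t ℓ h1 h2 h3 =>
    right
    simp only [State.work, State.loc_goto, if_true, h1, h2, Oper.rounds]
    exact ⟨by simp [PC.stage], trivial, lex_lt_iff.2 (Or.inr ⟨rfl, Or.inl (by omega)⟩)⟩

/-- A busy instance can always take a step, unless it waits at the barrier. -/
theorem DInv.enabled (hS : SInv c₀ inp s.skel N) (h : DInv op c₀ inp s)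
    (hb : (s.loc j).pc.stage ≠ 0)
    (hbar : (s.loc j).pc.stage = 1 → ∀ i ∈ (s.loc j).cfg.O, (s.loc j).pos < s.arrived i) :
    ∃ s', Step op inp j s s' := by
  obtain ⟨t, ht⟩ := (hS.loc j).is_data hb
  have ht : inp (s.loc j).pos = .data t := ht
  have hl := h.loops j
  cases hpc : (s.loc j).pc with
  | idle => simp [hpc, PC.stage] at hb
  | barrier => exact ⟨_, .leaveBarrier s hpc (hbar (by rw [hpc]; rfl))⟩
  | addSources =>
    by_cases hc : (s.loc j).cfg.O.card < (s.loc j).cfg.ON.card ∧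
        s.CanAddSources j ((s.loc j).cfg.ON \ (s.loc j).cfg.O)
    · exact ⟨_, .addSourcesTrue s hpc hc⟩
    · exact ⟨_, .addSourcesFalse s hpc hc⟩
  | addReaders => exact ⟨_, .addReaders s hpc⟩
  | removeReaders =>
    by_cases hc : (s.loc j).cfg.ON.card < (s.loc j).cfg.O.card ∧
        s.CanRemoveReaders j ((s.loc j).cfg.O \ (s.loc j).cfg.ON)
    · exact ⟨_, .removeReadersTrue s hpc hc⟩
    · exact ⟨_, .removeReadersFalse s hpc hc⟩
  | removeSources => exact ⟨_, .removeSources s hpc⟩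
  | switch => exact ⟨_, .switch s hpc⟩
  | expire =>
    by_cases h1 : (s.loc j).ρ + op.WS < (s.loc j).W
    · by_cases h2 : ∃ k w, (s.σ k).head? = some w ∧ w.l = (s.loc j).ρ ∧ (s.loc j).cfg.f k = j
      · obtain ⟨k, w, hw, hwl, hk⟩ := h2
        exact ⟨_, .output s k w hpc h1 hw hwl hk⟩
      · exact ⟨_, .advance s hpc h1 h2⟩
    · exact ⟨_, .expired s hpc h1⟩
  | shift k w => exact ⟨_, .shift s k w hpc⟩
  | handle =>
    by_cases hc : ∃ k ∈ op.fMK t, (s.loc j).cfg.f k = j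
    · exact ⟨_, .handle s t hpc ht hc⟩
    · exact ⟨_, .skip s t hpc ht hc⟩
  | update ℓ S =>
    rcases S.eq_empty_or_nonempty with rfl | ⟨k, hk⟩
    · by_cases hc : ℓ + 1 < op.numWin t
      · exact ⟨_, .nextRound s t ℓ hpc ht hc⟩
      · exact ⟨_, .finish s t ℓ hpc ht hc⟩
    · exact ⟨_, .create s t ℓ S k hpc ht hk⟩
  | read ℓ S k =>
    simp only [Local.LoopOK, hpc] at hl
    obtain ⟨w, hw⟩ := Option.isSome_iff_exists.1 (hl t ht).2.2.2
    exact ⟨_, .compute s t ℓ S k w hpc ht hw⟩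
  | write ℓ S k ζ => exact ⟨_, .write s t ℓ S k ζ hpc ht⟩

/-- An idle reader whose next item is a regular tuple can take a step. -/
theorem exists_step_of_data (h0 : (s.loc j).pc.stage = 0) (hr : j ∈ s.readers) {t : Tup I P}
    (ht : inp (s.loc j).pos = .data t) : ∃ s', Step op inp j s s' := by
  have h0 := PC.stage_eq_zero.1 h0
  by_cases hc : (s.loc j).W < max (s.loc j).W t.wm ∧ (s.loc j).cfg.γ < max (s.loc j).W t.wm
  · exact ⟨_, .trigger s t h0 hr ht hc⟩
  · exact ⟨_, .regular s t h0 hr ht hc⟩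

theorem Step.of_idle (hst : Step op inp j s s') (h0 : (s.loc j).pc.stage = 0) :
    ((∃ c, inp (s.loc j).pos = .control c) ∧ (s'.loc j).pos = (s.loc j).pos + 1) ∨
      (s'.loc j).pc.stage ≠ 0 ∧ (s'.loc j).pos = (s.loc j).pos := by
  have h0 := PC.stage_eq_zero.1 h0
  cases hst <;> simp_all [State.loc_setLoc, PC.stage]

/-! ### Fair runs: every busy instance moves on -/

section
variable {run : ℕ → State I K Z Q ι} {act : ℕ → Option ι}
variable (hinit : c₀.Valid) (hctl : ValidReconfigs c₀ inp)
variable (hinv : ∀ T, (∃ N, SInv c₀ inp (run T).skel N) ∧ DInv op c₀ inp (run T))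
variable (hrun : IsRun op c₀ inp run act) (hfair : IsFair op inp run act)

theorem IsRun.step (hrun : IsRun op c₀ inp run act) {T : ℕ} (h : act T = some j) :
    Step op inp j (run T) (run (T + 1)) := by
  rcases hrun.2 T with ⟨h', _⟩ | ⟨i, h', hs⟩
  · rw [h] at h'; cases h'
  · rw [h] at h'; cases h'; exact hs

include hinv hrun

theorem pos_mono_run (i : ι) : Monotone fun T => ((run T).loc i).pos := by
  refine monotone_nat_of_le_succ fun T => ?_
  rcases hrun.2 T with ⟨_, h⟩ | ⟨k, _, h⟩
  · rw [h]
  · obtain ⟨⟨N, hS⟩, _⟩ := hinv T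
    rcases h.skel with ⟨he, _⟩ | hs
    · have : (_ : ℕ) = _ := congrArg (fun a => (a.loc i).pos) he
      exact this.ge
    · exact hS.pos_mono hs i

theorem arrived_mono_run (i : ι) : Monotone fun T => (run T).arrived i := by
  refine monotone_nat_of_le_succ fun T => ?_
  rcases hrun.2 T with ⟨_, h⟩ | ⟨k, _, h⟩
  · rw [h]
  · obtain ⟨⟨N, hS⟩, _⟩ := hinv T
    rcases h.skel with ⟨he, _⟩ | hs
    · have : (_ : ℕ) = _ := congrArg (fun a => a.arrived i) he
      exact this.ge
    · exact hS.arrived_mono hs i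

include hinit hctl hfair

/-- An instance that can take a step as long as its local variables do not change takes one. -/
theorem exists_act {T : ℕ}
    (hen : ∀ T' ≥ T, (run T').loc j = (run T).loc j →
      (j ∈ (run T').readers ∨ ((run T').loc j).pc.stage ≠ 0) ∧ ∃ s', Step op inp j (run T') s') :
    ∃ T' ≥ T, act T' = some j ∧ (run T').loc j = (run T).loc j ∧
      ∀ k, (run T).skel.Active c₀ inp j k → (run T').key k = (run T).key k := by
  -- As long as `j` does not act, its local variables are frozen, so that `hen` keeps it enabled and
  -- weak fairness applies.
  have hconst : ∀ T' ≥ T, (∀ T'', T ≤ T'' → T'' < T' → act T'' ≠ some j) →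
      (run T').loc j = (run T).loc j ∧
        ∀ k, (run T).skel.Active c₀ inp j k → (run T').key k = (run T).key k := by
    intro T' hT'
    induction T', hT' using Nat.le_induction with
    | base => exact fun _ => ⟨rfl, fun _ _ => rfl⟩
    | succ T' hT' ih =>
      intro hna
      obtain ⟨ih, ihk⟩ := ih fun T'' h1 h2 => hna T'' h1 (by omega)
      rcases hrun.2 T' with ⟨_, h⟩ | ⟨i, hi, h⟩
      · rw [h]; exact ⟨ih, ihk⟩
      · have hij : i ≠ j := by
          rintro rfl
          exact hna T' hT' (by omega) hi
        obtain ⟨⟨N, hS⟩, hD⟩ := hinv T'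
        refine ⟨(hS.step_loc_eq h hij.symm (hen T' hT' ih).1).trans ih, fun k hk => ?_⟩
        rw [← ihk k hk]
        refine (hD.key_eq_or_active hS h k).resolve_right fun ha => hij ?_
        refine hS.active_unique hinit hctl ha ?_
        unfold Skel.Active at hk ⊢
        rwa [show (run T').skel.loc j = (run T).skel.loc j from congrArg Local.skel ih]
  have hex : ∃ T', T ≤ T' ∧ act T' = some j := by
    by_contra hcon
    push Not at hcon
    obtain ⟨T', h1, h2⟩ := hfair j T fun T' hT' =>
      (hen T' hT' (hconst T' hT' fun T'' h1 _ => hcon T'' h1).1).2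
    exact hcon T' h1 h2
  classical
  obtain ⟨h1, h2⟩ := hconst (Nat.find hex) (Nat.find_spec hex).1 fun T'' h1 h2 h3 =>
    Nat.find_min hex h2 ⟨h1, h3⟩
  exact ⟨Nat.find hex, (Nat.find_spec hex).1, (Nat.find_spec hex).2, h1, h2⟩

/-- A busy instance completes its tuple, if the barrier opens. -/
theorem exists_done (hWA : 0 < op.WA) {T : ℕ} (hb : ((run T).loc j).pc.stage ≠ 0)
    (hbar : ((run T).loc j).pc.stage = 1 →
      ∀ i ∈ ((run T).loc j).cfg.O, ((run T).loc j).pos < (run T).arrived i) :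
    ∃ T' ≥ T, ((run T').loc j).pc.stage = 0 ∧
      ((run T').loc j).pos = ((run T).loc j).pos + 1 := by
  induction hm : (run T).work op inp j using WellFoundedLT.induction generalizing T with
  | _ m ih =>
    obtain ⟨T₁, hT₁, hact, hloc, hkey⟩ := exists_act hinit hctl hinv hrun hfair (T := T) (j := j) (by
      intro T' hT' hloc
      rw [hloc]
      obtain ⟨⟨N, hS⟩, hD⟩ := hinv T'
      refine ⟨Or.inr hb, hD.enabled hS (by rwa [hloc]) ?_⟩
      rw [hloc]
      exact fun h1 i hi => lt_of_lt_of_le (hbar h1 i hi) (arrived_mono_run hinv hrun i hT'))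
    obtain ⟨⟨N, hS⟩, hD⟩ := hinv T₁
    -- The measure sees the shared state only at keys of `j`, which nobody else touches in the
    -- meantime.
    have hwork : (run T₁).work op inp j = (run T).work op inp j := by
      have hheads : ((run T).loc j).pc.stage = 7 → (run T₁).heads j = (run T).heads j := by
        intro h7
        ext k
        simp only [State.heads, hloc, Set.mem_ofPred_eq]
        refine and_congr_right fun hf => ?_
        obtain ⟨⟨N, hS⟩, _⟩ := hinv T
        have : (run T₁).σ k = (run T).σ k := congrArg Prod.fst (hkey k ((hS.cfg_f h7).2 hf))
        rw [this]
      unfold State.work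
      rw [hloc]
      cases hpc : ((run T).loc j).pc with
      | expire => simp only [hheads (by rw [hpc]; rfl)]
      | shift k w => simp only [hheads (by rw [hpc]; rfl)]
      | _ => rfl
    rcases hD.work_lt hWA (by rwa [hloc]) (hrun.step hact) with ⟨h0, hp⟩ | ⟨h2, hp, hlt⟩
    · exact ⟨T₁ + 1, by omega, h0, by rw [hp, hloc]⟩
    · rw [hwork, hm] at hlt
      obtain ⟨T', hT', h0, hp'⟩ := ih _ hlt (T := T₁ + 1) (by omega) (by omega) rfl
      exact ⟨T', by omega, h0, by rw [hp', hp, hloc]⟩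

/-- An idle instance that stays connected gets its next item, if this is a regular tuple. -/
theorem exists_busy {T : ℕ} (h0 : ((run T).loc j).pc.stage = 0) {t : Tup I P}
    (ht : inp ((run T).loc j).pos = .data t)
    (hr : ∀ T' ≥ T, (run T').loc j = (run T).loc j → j ∈ (run T').readers) :
    ∃ T' ≥ T, ((run T').loc j).pc.stage ≠ 0 ∧ ((run T').loc j).pos = ((run T).loc j).pos := by
  obtain ⟨T₁, hT₁, hact, hloc, -⟩ := exists_act hinit hctl hinv hrun hfair (T := T) (j := j)
    (fun T' hT' hloc => ⟨Or.inl (hr T' hT' hloc),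
      exists_step_of_data (by rwa [hloc]) (hr T' hT' hloc) (by rwa [hloc])⟩)
  rcases (hrun.step hact).of_idle (by rwa [hloc]) with ⟨⟨c, hc⟩, _⟩ | ⟨h1, h2⟩
  · rw [hloc, ht] at hc
    cases hc
  · exact ⟨T₁ + 1, by omega, h1, by rw [h2, hloc]⟩

end

end Progress

/-! ## Liveness -/

section Liveness

variable {I : ℕ} {K Z P Q ι : Type*} [DecidableEq K] [DecidableEq ι]
variable {op : Oper I K Z P Q} {c₀ : Ctl K ι} {inp : ℕ → Item I P K ι}
variable {a a' : Skel K ι} {s s' : State I K Z Q ι} {N N' : ℕ} {j : ι}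

theorem Step.mem_readers_of_idle (h : Step op inp j s s') (h0 : (s.loc j).pc.stage = 0) :
    j ∈ s.readers := by
  have h0 := PC.stage_eq_zero.1 h0
  cases h <;> simp_all

/-- As long as a member of the current epoch is idle at an item, nobody is disconnected. -/
theorem SInv.readers_subset_of_step (hS : SInv c₀ inp a N) (hS' : SInv c₀ inp a' N') {r : ι}
    (hs : SStep inp r a a') (hj : j ∈ (cfgAt c₀ inp (a.loc j).pos).O)
    (h0' : (a'.loc j).st = 0) (hp : (a'.loc j).pos = (a.loc j).pos) : a.readers ⊆ a'.readers := by
  cases hs with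
  | addReaders => exact Finset.subset_union_left
  | removeReadersTrue h1 h2 h3 h4 =>
    exfalso
    have hidle := hS'.idle_at (by rw [hp]; exact hj) h0'
    rw [hp] at hidle
    obtain ⟨hcfg, hT⟩ := (hS.loc r).cfg_pre (by omega) (by omega)
    rcases hS'.phase with ⟨_, _, h⟩ | ⟨r', g, _, _, _, _, _, _, _, h, _⟩ |
      ⟨r', g, h0, hsub, h2', h4', h6, h7, h8, h9⟩
    · have := (h r).2
      simp [Skel.setLoc] at this
    · have := h r
      simp [Skel.setLoc] at this
    · have hr := h8 r (by simp [Skel.setLoc])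
      subst hr
      have hg : (a.loc r).pos = g := by simpa [Skel.setLoc] using h7
      have hC : Changes c₀ inp g := by
        rcases hS'.last with h | ⟨g', h, hC⟩
        · omega
        · obtain rfl : g = g' := by omega
          exact hC
      -- Already before the step `j` is beyond the change of item `g`. So this change has been
      -- carried out, and `r` cannot find the instances to be removed among the readers.
      have hlt := hS.passed j g hC (Or.inl (by omega))
      have hle := hS.lower r (Or.inl h3)
      have hN : N = g + 1 := by omega
      have hrd := hS.readers_subset
      rw [hcfg, hT.ON_eq, hg] at h4
      rw [hN] at hrd
      refine hC.not_both (fun i hi => ?_) hsub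
      by_contra hi'
      exact hi' (hrd (h4 (Finset.mem_sdiff.2 ⟨hi, hi'⟩)))
  | _ => exact Finset.Subset.refl _

/-- An instance that is added by item `n` has been handed this item, or is about to be. -/
theorem SInv.pos_or_adding (hS : SInv c₀ inp a N) {n : ℕ} (hn : n < N)
    (hj : j ∈ (cfgAt c₀ inp (n + 1)).O) :
    n ≤ (a.loc j).pos ∨ ∃ r, (a.loc r).st = 3 ∧ (a.loc r).pos = n := by
  by_contra hcon
  push Not at hcon
  obtain ⟨hlt, hno⟩ := hcon
  have harr := (hS.loc j).arr_le
  have hN := hS.le_of_mem hj (by omega)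
  obtain rfl : N = n + 1 := by omega
  rcases hS.phase with ⟨h1, h2, h4⟩ | ⟨r, g, h0, h1, h2, h4, h6, h7, h8, h9, h10⟩ |
      ⟨r, g, h0, h1, h2, h4, h6, h7, h8, h9⟩
  · have := hS.lower j (Or.inl (h1 ▸ hj))
    omega
  · exact hno r h6 (by omega)
  · obtain rfl : n = g := by omega
    have := hS.lower j (Or.inl (h2 ▸ hj))
    omega

/-- An instance that has not arrived at item `n + 1` prevents all changes after item `n`, so `N = n
+ 1`; and in the phase `adding` an instance outside the readers still stands before item `n`. -/
theorem SInv.reader_of_added (hS : SInv c₀ inp a N) {n : ℕ} (hn : n < N)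
    (hj : j ∈ (cfgAt c₀ inp (n + 1)).O) (h0 : (a.loc j).st = 0) (hp : (a.loc j).pos = n) :
    j ∈ a.readers := by
  have harr := (hS.loc j).arr_idle h0
  have hN := hS.le_of_mem hj (by omega)
  obtain rfl : N = n + 1 := by omega
  rcases hS.phase with ⟨h1, h2, h4⟩ | ⟨r, g, h, h1, h2, h4, h6, h7, h8, h9, h10⟩ |
      ⟨r, g, h, h1, h2, h4, h6, h7, h8, h9⟩
  · rwa [h1]
  · by_contra hr
    have := (h10 j hr).2
    omega
  · rwa [h2, ← h]

theorem exists_forall_mem {α : Type*} (S : Finset α) {p : ℕ → α → Prop}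
    (hp : ∀ x, ∀ T T', T ≤ T' → p T x → p T' x) (T₀ : ℕ) (h : ∀ x ∈ S, ∃ T, p T x) :
    ∃ T ≥ T₀, ∀ x ∈ S, p T x := by
  classical
  induction S using Finset.induction_on with
  | empty => exact ⟨T₀, le_rfl, by simp⟩
  | insert x S _ ih =>
    obtain ⟨T, hT, hS⟩ := ih fun y hy => h y (Finset.mem_insert_of_mem hy)
    obtain ⟨T', hT'⟩ := h x (Finset.mem_insert_self x S)
    refine ⟨max T T', by omega, fun y hy => ?_⟩
    rcases Finset.mem_insert.1 hy with rfl | hy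
    · exact hp _ _ _ (le_max_right _ _) hT'
    · exact hp _ _ _ (le_max_left _ _) (hS y hy)

/-! ### Every item is eventually completed -/

section
variable {run : ℕ → State I K Z Q ι} {act : ℕ → Option ι}
variable (hinit : c₀.Valid) (hctl : ValidReconfigs c₀ inp) (hWA : 0 < op.WA)
variable (hinv : ∀ T, (∃ N, SInv c₀ inp (run T).skel N) ∧ DInv op c₀ inp (run T))
variable (hrun : IsRun op c₀ inp run act) (hfair : IsFair op inp run act)
include hinit hctl hWA hinv hrun hfair

/-- Members of the epoch take a control tuple that they have reached. -/
theorem exists_pos_lt_of_control {n : ℕ} {c : Ctl K ι} (hc : inp n = .control c)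
    (hj : j ∈ (cfgAt c₀ inp n).O) {T₀ : ℕ} (hpos : n ≤ ((run T₀).loc j).pos) :
    ∃ T, n < ((run T).loc j).pos := by
  -- Suppose that `j` stays at item `n` forever. Then nobody gets disconnected any more and the busy
  -- disconnected instances finish, so that from some time on the guard holds and fairness forces
  -- `j` to move.
  by_contra hcon
  push Not at hcon
  have hp : ∀ T ≥ T₀, ((run T).loc j).pos = n := fun T hT =>
    le_antisymm (hcon T) (hpos.trans (pos_mono_run hinv hrun j hT))
  have h0 : ∀ T ≥ T₀, ((run T).loc j).pc.stage = 0 := by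
    intro T hT
    by_contra hb
    obtain ⟨⟨N, hS⟩, hD⟩ := hinv T
    obtain ⟨t, ht⟩ := (hS.loc j).is_data hb
    rw [show ((run T).skel.loc j).pos = n from hp T hT, hc] at ht
    cases ht
  have hidle : ∀ T ≥ T₀, ∀ N, SInv c₀ inp (run T).skel N → N ≤ n ∧ j ∈ (run T).readers := by
    intro T hT N hS
    have hp' : ((run T).skel.loc j).pos = n := hp T hT
    have := hS.idle_at (j := j) (by rwa [hp']) (h0 T hT)
    exact ⟨hp' ▸ this.1, this.2.2⟩
  -- This is the guard for a single instance. It persists, since connections are kept and an idle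
  -- instance outside the readers gets no item.
  set good : ℕ → ι → Prop := fun T i =>
    i ∈ (run (T₀ + T)).readers ∨ ((run (T₀ + T)).loc i).pc.stage = 0
  have hgood : ∀ i, ∀ T T', T ≤ T' → good T i → good T' i := by
    intro i T T' hTT hg
    induction T', hTT using Nat.le_induction with
    | base => exact hg
    | succ T' _ ih =>
      obtain ⟨⟨N, hS⟩, hD⟩ := hinv (T₀ + T')
      obtain ⟨⟨N', hS'⟩, hD'⟩ := hinv (T₀ + T' + 1)
      rcases hrun.2 (T₀ + T') with ⟨_, h⟩ | ⟨k, hk, h⟩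
      · simp only [good, ← add_assoc, h]
        exact ih
      · rcases h.skel with ⟨he, _⟩ | hs
        · have h1 : (run (T₀ + T' + 1)).readers = (run (T₀ + T')).readers :=
            congrArg Skel.readers he
          have h2 : ((run (T₀ + T' + 1)).loc i).pc.stage = ((run (T₀ + T')).loc i).pc.stage :=
            congrArg (fun a => (a.loc i).st) he
          simp only [good, ← add_assoc, h1, h2]
          exact ih
        · have hp1 := hp (T₀ + T') (by omega)
          have hp2 := hp (T₀ + T' + 1) (by omega)
          have hsub : (run (T₀ + T')).readers ⊆ (run (T₀ + T' + 1)).readers :=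
            hS.readers_subset_of_step hS' hs (j := j)
              (by rwa [show ((run (T₀ + T')).skel.loc j).pos = n from hp1])
              (h0 (T₀ + T' + 1) (by omega)) (hp2.trans hp1.symm)
          by_cases hr : i ∈ (run (T₀ + T')).readers
          · exact Or.inl (hsub hr)
          · right
            have hi := ih.resolve_left hr
            have hik : i ≠ k := by
              rintro rfl
              exact hr (h.mem_readers_of_idle hi)
            exact (hs.st_eq hik).trans hi
  -- The finite union contains every instance that can be busy while `j` waits, by `touched` and `N
  -- ≤ n`, so that one time serves all of them.
  obtain ⟨T₁, -, hT₁⟩ := exists_forall_mem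
    ((Finset.range (n + 1)).biUnion fun m => (cfgAt c₀ inp m).O) (p := good) hgood 0 (by
      intro i _
      by_contra hbad
      push Not at hbad
      have hbad0 := hbad 0
      simp only [good, not_or] at hbad0
      obtain ⟨⟨N, hS⟩, hD⟩ := hinv (T₀ + 0)
      -- A busy disconnected instance processes an item before `N`. If this item has a barrier, all
      -- members have arrived there by `barN`, so the instance can finish.
      have hup : ((run (T₀ + 0)).loc i).pos < N := (hS.upper i hbad0.1).2 hbad0.2
      have hlow : N ≤ ((run (T₀ + 0)).loc i).pos + 1 := hS.lower i (Or.inr hbad0.2)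
      obtain ⟨T', hT', h0', _⟩ := exists_done hinit hctl hinv hrun hfair hWA hbad0.2 (by
        intro h1 k hk
        obtain ⟨hcfg, hT⟩ := (hS.loc i).cfg_pre hbad0.2 (by
          rw [show ((run (T₀ + 0)).skel.loc i).st = 1 from h1]; omega)
        exact hS.barN _ hT hup k (by
          have hcfg : ((run (T₀ + 0)).loc i).cfg = _ := hcfg
          rwa [hcfg] at hk))
      refine hbad (T' - T₀) (Or.inr ?_)
      rwa [show T₀ + (T' - T₀) = T' by omega])
  have hguard : ∀ T ≥ T₀ + T₁, ∀ i, i ∉ (run T).readers → ((run T).loc i).pc = .idle := by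
    intro T hT i hi
    by_contra hb
    have hb : ((run T).loc i).pc.stage ≠ 0 := fun h => hb (PC.stage_eq_zero.1 h)
    obtain ⟨⟨N, hS⟩, hD⟩ := hinv T
    obtain ⟨m, hm, him⟩ := hS.touched i hb
    have hN := (hidle T (by omega) N hS).1
    have := hgood i T₁ (T - T₀) (by omega)
      (hT₁ i (Finset.mem_biUnion.2 ⟨m, Finset.mem_range.2 (by omega), him⟩))
    simp only [good, show T₀ + (T - T₀) = T by omega] at this
    exact this.elim hi hb
  obtain ⟨T, hT, hact⟩ := hfair j (T₀ + T₁) (by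
    intro T hT
    obtain ⟨⟨N, hS⟩, hD⟩ := hinv T
    exact ⟨_, .control (run T) c (PC.stage_eq_zero.1 (h0 T (by omega)))
      (hidle T (by omega) N hS).2 (by rwa [hp T (by omega)]) fun _ => hguard T hT⟩)
  rcases (hrun.step hact).of_idle (h0 T (by omega)) with ⟨_, h⟩ | ⟨h, _⟩
  · rw [hp T (by omega), hp (T + 1) (by omega)] at h
    omega
  · exact h (h0 (T + 1) (by omega))

/-- An instance that has reached a regular tuple and is or stays connected completes it, if the
barrier opens. -/
theorem exists_pos_lt_of_data {n : ℕ} {t : Tup I P} (ht : inp n = .data t) {T₀ : ℕ}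
    (hpos : n ≤ ((run T₀).loc j).pos)
    (hr : ∀ T ≥ T₀, ((run T).loc j).pos = n → ((run T).loc j).pc.stage = 0 → j ∈ (run T).readers)
    (hbar : Triggers c₀ inp n → ∀ i ∈ (cfgAt c₀ inp n).O, n < (run T₀).arrived i) :
    ∃ T, n < ((run T).loc j).pos := by
  by_cases hlt : n < ((run T₀).loc j).pos
  · exact ⟨T₀, hlt⟩
  have hp : ((run T₀).loc j).pos = n := by omega
  obtain ⟨T₁, hT₁, hb, hp₁⟩ : ∃ T ≥ T₀, ((run T).loc j).pc.stage ≠ 0 ∧ ((run T).loc j).pos = n := by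
    by_cases h0 : ((run T₀).loc j).pc.stage = 0
    · obtain ⟨T, hT, hb, hp'⟩ := exists_busy hinit hctl hinv hrun hfair h0 (t := t) (by rwa [hp])
        fun T' hT' hloc => hr T' hT' (by rw [hloc, hp]) (by rwa [hloc])
      exact ⟨T, hT, hb, hp'.trans hp⟩
    · exact ⟨T₀, le_rfl, h0, hp⟩
  obtain ⟨⟨N, hS⟩, hD⟩ := hinv T₁
  obtain ⟨T, hT, _, hp'⟩ := exists_done hinit hctl hinv hrun hfair hWA hb (by
    intro h1 i hi
    obtain ⟨hcfg, hTr⟩ := (hS.loc j).cfg_pre hb (by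
      rw [show ((run T₁).skel.loc j).st = 1 from h1]; omega)
    have hcfg : ((run T₁).loc j).cfg = cfgAt c₀ inp ((run T₁).loc j).pos := hcfg
    have hTr : Triggers c₀ inp ((run T₁).loc j).pos := hTr
    rw [hp₁] at hTr hcfg ⊢
    rw [hcfg] at hi
    exact lt_of_lt_of_le (hbar hTr i hi) (arrived_mono_run hinv hrun i hT₁))
  exact ⟨T, by omega⟩

/-- Every item is completed by all members of the epoch that it belongs to. -/
theorem exists_all_done (n : ℕ) : ∃ T, ∀ j ∈ (cfgAt c₀ inp n).O, n ≤ ((run T).loc j).pos := by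
  have hmono : ∀ m (i : ι) T T', T ≤ T' → m ≤ ((run T).loc i).pos → m ≤ ((run T').loc i).pos :=
    fun m i T T' hT h => h.trans (pos_mono_run hinv hrun i hT)
  induction n with
  | zero => exact ⟨0, fun _ _ => Nat.zero_le _⟩
  | succ n ih =>
    obtain ⟨T₀, hT₀⟩ := ih
    have hmem : ∀ j ∈ (cfgAt c₀ inp n).O, ∀ T, ((run T).loc j).pos = n →
        ((run T).loc j).pc.stage = 0 → j ∈ (run T).readers := by
      intro j hj T hp h0
      obtain ⟨⟨N, hS⟩, hD⟩ := hinv T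
      exact (hS.idle_at (j := j)
        (by rwa [show ((run T).skel.loc j).pos = n from hp]) h0).2.2
    suffices h : ∀ j ∈ (cfgAt c₀ inp (n + 1)).O, ∃ T, n + 1 ≤ ((run T).loc j).pos by
      obtain ⟨T, _, hT⟩ := exists_forall_mem _ (p := fun T i => n + 1 ≤ ((run T).loc i).pos)
        (hmono (n + 1)) 0 h
      exact ⟨T, hT⟩
    cases hi : inp n with
    | control c =>
      have hnt : ¬ Triggers c₀ inp n := by
        rintro ⟨t, ht, _⟩
        rw [hi] at ht
        cases ht
      intro j hj
      rw [(cfgAt_not_triggers hnt).2.1] at hj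
      exact exists_pos_lt_of_control hinit hctl hWA hinv hrun hfair hi hj (hT₀ j hj)
    | data t =>
      by_cases hTr : Triggers c₀ inp n
      -- Members of the old epoch stay connected until they begin the item, so all of them arrive.
      -- The barrier then stays open, for them and for the instances added by the item.
      · obtain ⟨T₁, hT₁, harr⟩ := exists_forall_mem (cfgAt c₀ inp n).O
          (p := fun T i => n < (run T).arrived i)
          (fun i T T' hT h => lt_of_lt_of_le h (arrived_mono_run hinv hrun i hT)) T₀ (by
            intro j hj
            by_cases hlt : n < ((run T₀).loc j).pos
            · obtain ⟨⟨N, hS⟩, hD⟩ := hinv T₀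
              exact ⟨T₀, hS.bar j n hTr (Or.inl hlt) j hj⟩
            have hp : ((run T₀).loc j).pos = n := by
              have := hT₀ j hj
              omega
            obtain ⟨T, hb, hp'⟩ : ∃ T, ((run T).loc j).pc.stage ≠ 0 ∧
                ((run T).loc j).pos = n := by
              by_cases h0 : ((run T₀).loc j).pc.stage = 0
              · obtain ⟨T, _, hb, hp'⟩ := exists_busy hinit hctl hinv hrun hfair h0 (t := t)
                  (by rwa [hp]) fun T' hT' hloc =>
                    hmem j hj T' (by rw [hloc, hp]) (by rwa [hloc])
                exact ⟨T, hb, hp'.trans hp⟩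
              · exact ⟨T₀, h0, hp⟩
            obtain ⟨⟨N, hS⟩, hD⟩ := hinv T
            have := (hS.loc j).arr_busy hb
            rw [show ((run T).skel.loc j).pos = n from hp'] at this
            exact ⟨T, this hTr⟩)
        have hold : ∀ j ∈ (cfgAt c₀ inp n).O, ∃ T, n + 1 ≤ ((run T).loc j).pos := fun j hj =>
          exists_pos_lt_of_data hinit hctl hWA hinv hrun hfair hi
            (hmono n j T₀ T₁ hT₁ (hT₀ j hj)) (fun T _ => hmem j hj T) fun _ => harr
        intro j hj
        by_cases hjo : j ∈ (cfgAt c₀ inp n).O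
        · exact hold j hjo
        have hC : Changes c₀ inp n := fun h => hjo (h ▸ hj)
        obtain ⟨T₂, hT₂, hdone⟩ := exists_forall_mem _
          (p := fun T i => n + 1 ≤ ((run T).loc i).pos) (hmono (n + 1)) T₁ hold
        obtain ⟨o, ho⟩ := (cfgAt_valid hinit hctl n).1
        -- An old member beyond item `n` witnesses that the change has been carried out.
        have hN : ∀ T ≥ T₂, ∀ N, SInv c₀ inp (run T).skel N → n < N := fun T hT N hS =>
          hS.passed o n hC (Or.inl (hmono (n + 1) o T₂ T hT (hdone o ho)))
        obtain ⟨T₃, hT₃, hp₃⟩ : ∃ T ≥ T₂, n ≤ ((run T).loc j).pos := by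
          obtain ⟨⟨N, hS⟩, hD⟩ := hinv T₂
          rcases hS.pos_or_adding (hN T₂ le_rfl N hS) hj with h | ⟨r, hr3, hrp⟩
          · exact ⟨T₂, le_rfl, h⟩
          have hr3 : ((run T₂).loc r).pc.stage = 3 := hr3
          have hrp : ((run T₂).loc r).pos = n := hrp
          -- An instance about to call `addReaders` is enabled until it does so, and this call hands
          -- item `n` to `j` unless `j` has become a reader before.
          obtain ⟨T, hT, hact, hloc, -⟩ := exists_act hinit hctl hinv hrun hfair (T := T₂) (j := r)
            (by
              intro T' _ hloc
              rw [hloc]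
              obtain ⟨⟨N', hS'⟩, hD'⟩ := hinv T'
              exact ⟨Or.inr (by omega), hD'.enabled hS' (by rw [hloc]; omega)
                (by rw [hloc]; omega)⟩)
          refine ⟨T + 1, by omega, ?_⟩
          obtain ⟨⟨N', hS'⟩, hD'⟩ := hinv T
          have hst : ((run T).skel.loc r).st = 3 := by
            rw [← hr3, ← hloc]; rfl
          have hpr : ((run T).skel.loc r).pos = n := by
            rw [← hrp, ← hloc]; rfl
          rcases (hrun.step hact).skel with ⟨_, h⟩ | hs
          · rw [hloc, hr3] at h
            omega
          by_cases hrd : j ∈ (run T).readers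
          · have h1 := hS'.lower j (Or.inl hrd)
            have h2 := hN T (by omega) N' hS'
            have h3 := hS'.pos_mono hs j
            show n ≤ ((run (T + 1)).skel.loc j).pos
            omega
          · obtain ⟨hcfg, _⟩ := (hS'.loc r).cfg_pre (by omega) (by omega)
            rw [hpr] at hcfg
            have hON := hTr.ON_eq
            have hmemS : j ∈ (((run T).skel.loc r).cfg.ON \ ((run T).skel.loc r).cfg.O) \
                (run T).skel.readers := by
              rw [hcfg, hON]
              exact Finset.mem_sdiff.2 ⟨Finset.mem_sdiff.2 ⟨hj, hjo⟩, hrd⟩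
            show n ≤ ((run (T + 1)).skel.loc j).pos
            generalize (run (T + 1)).skel = b at hs
            cases hs with
            | addReaders =>
              dsimp only
              split
              · exact hpr.ge
              · exact hpr.ge
            | _ => omega
        refine exists_pos_lt_of_data hinit hctl hWA hinv hrun hfair hi hp₃ ?_
          fun _ i hi => lt_of_lt_of_le (harr i hi) (arrived_mono_run hinv hrun i (by omega))
        intro T hT hp h0
        obtain ⟨⟨N, hS⟩, hD⟩ := hinv T
        exact hS.reader_of_added (hN T (by omega) N hS) hj h0 hp
      · intro j hj
        rw [(cfgAt_not_triggers hTr).2.1] at hj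
        exact exists_pos_lt_of_data hinit hctl hWA hinv hrun hfair hi (hT₀ j hj)
          (fun T _ => hmem j hj T) fun h => absurd h hTr

end

section
variable (hinit : c₀.Valid) (hctl : ValidReconfigs c₀ inp) (hWA : 0 < op.WA)
  (hWS : op.WA ≤ op.WS) (hwm : Watermarked inp)
  (hstart : ∀ n t, inp n = .data t → (op.fMK t).Nonempty → 0 ≤ op.earliestWinL t)
include hinit hctl hWA hWS hwm hstart

theorem IsRun.reachable {run : ℕ → State I K Z Q ι} {act : ℕ → Option ι}
    (hrun : IsRun op c₀ inp run act) (T : ℕ) : Reachable op c₀ inp (run T) := by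
  induction T with
  | zero => rw [hrun.1]; exact .refl
  | succ T ih =>
    rcases hrun.2 T with ⟨_, h⟩ | ⟨j, _, h⟩
    · rwa [h]
    · exact ih.tail ⟨j, h⟩

/-- The outputs of a key extend those of the reference after some `m` such that `m + 1` has not been
reached for the key. Since reaching is inherited by smaller numbers and `n` has been reached, `n ≤
m`. -/
theorem results_produced {run : ℕ → State I K Z Q ι} {act : ℕ → Option ι}
    (hrun : IsRun op c₀ inp run act) (hfair : IsFair op inp run act) (n : ℕ) :
    (∃ T, ∀ T' ≥ T, ∀ j ∈ (epochAt c₀ inp n).2.O, n ≤ ((run T').loc j).pos) ∧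
      (∀ k, ∃ T, (refAt op inp n).outs k <+: (run T).outs k) := by
  have hreach := fun T => inv_of_reachable hinit hctl hWA hWS hwm hstart
    (hrun.reachable hinit hctl hWA hWS hwm hstart T)
  have hinv := fun T => (⟨(hreach T).1, (hreach T).2.1⟩ :
    (∃ N, SInv c₀ inp (run T).skel N) ∧ DInv op c₀ inp (run T))
  obtain ⟨T, hT⟩ := exists_all_done hinit hctl hWA hinv hrun hfair n
  refine ⟨⟨T, fun T' hT' j hj => (hT j hj).trans (pos_mono_run hinv hrun j hT')⟩,
    fun k => ⟨T, ?_⟩⟩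
  obtain ⟨⟨N, hS⟩, hD, B, hB⟩ := hreach T
  obtain ⟨m, h1, h2, -⟩ := hD.outs_between hinit hctl hWA hS
    (fun n k => refKey_prefix_succ hWA hWS hwm hstart n k c₀) hB k
  have hr : (run T).skel.Reached c₀ inp k n := hT _ ((cfgAt_valid hinit hctl n).2.1 k)
  have hnm : n ≤ m := by
    by_contra hlt
    exact h1 (hS.reached_of_le hinit hctl (by omega) hr)
  exact (refKey_prefix hWA hWS hwm hstart hnm k c₀).trans h2

end

end Liveness

end VSN

theorem theorem3 {I : ℕ} {K Z P Q ι : Type*} [DecidableEq K] [DecidableEq ι]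
    (op : VSN.Oper I K Z P Q) (hWA : 0 < op.WA) (hWS : op.WA ≤ op.WS)
    (c₀ : VSN.Ctl K ι) (inp : ℕ → VSN.Item I P K ι)
    (hinit : c₀.Valid) (hctl : VSN.ValidReconfigs c₀ inp) (hwm : VSN.Watermarked inp)
    (hstart : ∀ n t, inp n = .data t → (op.fMK t).Nonempty → 0 ≤ op.earliestWinL t) :
    -- each key is updated by exactly one instance at a time, the responsible one
    (∀ s, VSN.Reachable op c₀ inp s →
      (∀ i j k, s.Updating i k → s.Updating j k → i = j) ∧
      (∀ j s' k, VSN.Step op inp j s s' → s'.σ k ≠ s.σ k ∨ s'.outs k ≠ s.outs k →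
        (VSN.epochAt c₀ inp ((s.loc j).pos + 1)).2.f k = j ∧
        j ∈ s.readers ∧ j ∈ s.sources ∧ ∀ i, i ≠ j → ¬ s.Updating i k)) ∧
    -- state and outputs are at all times consistent with the semantics of the operator
    (∀ s, VSN.Reachable op c₀ inp s →
      (∀ n k j, (VSN.epochAt c₀ inp n).2.f k = j → s.DoneWith j n →
        s.σ k = (VSN.refAt op inp n).σ k ∧ s.outs k = (VSN.refAt op inp n).outs k) ∧
      (∀ k, ∃ n, s.outs k <+: (VSN.refAt op inp n).outs k)) ∧
    -- provisioned instances are connected, decommissioned ones are disconnected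
    (∀ s, VSN.Reachable op c₀ inp s → ∀ n,
      (∀ j ∈ (VSN.epochAt c₀ inp n).2.O, s.DoneWith j n →
        s.readers ⊆ (VSN.epochAt c₀ inp n).2.O ∧ (VSN.epochAt c₀ inp n).2.O ⊆ s.sources) ∧
      ((∀ i, (s.loc i).pc = .idle) → (∀ j ∈ (VSN.epochAt c₀ inp n).2.O, (s.loc j).pos = n) →
        s.readers = (VSN.epochAt c₀ inp n).2.O ∧ s.sources = (VSN.epochAt c₀ inp n).2.O)) ∧
    -- reconfigurations are carried out, and every result is produced
    (∀ run act, VSN.IsRun op c₀ inp run act → VSN.IsFair op inp run act →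
      ∀ n,
        (∃ T, ∀ T' ≥ T, ∀ j ∈ (VSN.epochAt c₀ inp n).2.O, n ≤ ((run T').loc j).pos) ∧
        (∀ k, ∃ T, (VSN.refAt op inp n).outs k <+: (run T).outs k)) := ⟨fun _ hr => VSN.updates_exclusive hinit hctl hWA hWS hwm hstart hr,
    fun _ hr => VSN.state_consistent hinit hctl hWA hWS hwm hstart hr,
    fun _ hr n => VSN.connections_consistent hinit hctl hWA hWS hwm hstart hr n,
    fun _ _ hrun hfair n => VSN.results_produced hinit hctl hWA hWS hwm hstart hrun hfair n⟩
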